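/- **Setting.** Let $\mathcal X\subset\mathbb R^n$ be nonempty, convex and compact, $f$ continuous on $\mathcal X\times\mathbb R^m$, and $g:\mathbb R^n\times\mathbb R^m\to\mathbb R$ of class $C^\infty$. Assume that on $\mathcal X\times\mathbb R^m$ the gradient $\nabla g$ is Lipschitz, $\nabla^2_{yy}g$ is Lipschitz with constant $M>0$, and $g\ge\underline g$. Fix $y_0\in\mathbb R^m$ and a compact set $\mathcal Y$ that contains $\{y:g(x,y)\le g(x,y_0)\}$ for every $x\in\mathcal X$, and let $g(x,y_0)\le\overline g_0$ for $x\in\mathcal X$. Assume that for $x\in\mathcal X$, on $\{y:g(x,y)\le g(x,y_0)\}$, one has $|f(x,\cdot)|\le\overline f$ and $f(x,\cdot)$ is Lipschitz with a constant independent of $x$. Let $\mathcal Y'$ be compact with $\mathcal Y\subset\operatorname{int}\mathcal Y'$. Call $y$ a degenerate stationary point of $g(x,\cdot)$ if $\nabla_yg(x,y)=0$ and $\det\nabla^2_{yy}g(x,y)=0$. Let $\widetilde{\mathcal X}$ be the set of $x\in\mathcal X$ for which $g(x,\cdot)$ has such a point, and $\widetilde{\mathcal X}_\delta=\{x\in\mathcal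 X:\operatorname{dist}(x,\widetilde{\mathcal X})\le\delta\}$. Let $d<n$ be the upper Minkowski dimension of $\widetilde{\mathcal X}$ (with $d=0$ if $\widetilde{\mathcal X}=\emptyset$). Assume that the degenerate stationary points of the functions $g(x,\cdot)$, $x\in\mathcal X$, form a bounded set, and that each such pair $(\bar x,\bar y)$ is a *fold*: $\ker\nabla^2_{yy}g(\bar x,\bar y)$ is one-dimensional and, for a unit vector $v$ spanning it, $w:=\nabla_x\big(\nabla_yg(x,y)^\top v\big)\big|_{(\bar x,\bar y)}\neq0$ and $\nabla^3_{yyy}g(\bar x,\bar y)[v,v,v]\ne0$. Assume also that neither $w$ nor $-w$ lies on the topological boundary of the normal cone $\{u:\langle u,z-\bar x\rangle\le0\ \forall z\in\mathcal X\}$ (for $\bar x\in\operatorname{int}\mathcal X$ this only says $w\ne0$). **Lower level.** For $x\in\mathcal X$ let $y_{k+1}(x)=y_k(x)+s_k$, $y_0(x)=y_0$, where $s_k$ is a global minimizer of $s\mapsto\nabla_yg(x,y_k)^\top s+\tfrac12s^\top\nabla^2_{yy}g(x,y_k)s+\tfrac M6\|s\|^3$ (cubic-regularized Newton). The output $\hat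 y_K(x)$ after $K$ steps is an iterate $y_k(x)$, $0\le k\le K$, minimizing $\max\{\sqrt{\|\nabla_yg(x,y_k)\|/M},-\tfrac2{3M}\lambda_{\min}(\nabla^2_{yy}g(x,y_k))\}$; it is measurable in $x$. Let $y^{\rm cd}(x)$ minimize $f(x,\cdot)$ over those accumulation points of $(y_k(x))_k$ at which $g(x,\cdot)$ is smallest, and assume that the discontinuity points of $y^{\rm cd}$ in $\mathcal X\setminus\widetilde{\mathcal X}$ form a null set. **Inner steps.** Let $\mu(\delta)$ be the infimum of $|\lambda|$ over the eigenvalues $\lambda$ of $\nabla^2_{yy}g(x,y)$ with $x\in\mathcal X\setminus\widetilde{\mathcal X}_\delta$, $y\in\mathcal Y'$, $\nabla_yg(x,y)=0$; let $\alpha(\delta,r)$ be the infimum of $\|\nabla_yg(x,y)\|$ over $x\in\mathcal X\setminus\widetilde{\mathcal X}_\delta$ and $y\in\mathcal Y$ at distance more than $r$ from $\{y'\in\mathcal Y':\nabla_yg(x,y')=0\}$ ($\inf\emptyset=\infty$). With $\rho_t=\frac1{t+1}$, $\delta_t=(t+1)^{-2/(n-d)}$, $N_t=t+1$, $\mu_t=\mu(\delta_t)$,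 $\alpha_t=\alpha(\delta_t,\mu_t/(2M))$, $D=\overline g_0-\underline g$, put $$B_t=\max\left\{\frac{256\,D\sqrt M}{9\min\{\alpha_t,\mu_t^2/(4M)\}^{3/2}},\ \frac{768\,D M^2}{\mu_t^3}\right\}+\frac{256\,D\sqrt M}{9(\mu_t\rho_t)^{3/2}}.$$ **Upper level (SCiNBiO).** Let $\xi>0$, $L=\overline f/\xi^2$, and let the constant step size $\beta>0$ satisfy $\beta L<1$. From a given starting point, for $t=0,1,\dots$, with independent $u_t^{(i)}\sim\mathcal N(0,I_n)$, set $$\hat\nabla_t=\frac1{N_t\xi}\sum_{i=1}^{N_t}u_t^{(i)}F_t(x_t+\xi u_t^{(i)}),\qquad x_{t+1}=\operatorname{proj}_{\mathcal X}(x_t-\beta\hat\nabla_t),\qquad\widetilde\Phi_{\mathcal X,t}=\frac{x_t-x_{t+1}}\beta,$$ where $F_t(x)=f(x,\hat y_{K_t}(x))$ for $x\in\mathcal X$ and $F_t(x)=\overline f$ otherwise. For a horizon $T\ge1$ let $R$ be independent of the samples with $\Pr(R=t)=\frac{\beta-L\beta^2}{\sum_{s=1}^T(\beta-L\beta^2)}$,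 $1\le t\le T$. **Claim.** $B_t<\infty$ for all $t$. Let $(K_t)$ be any integers with $B_t<K_t\le A(1+B_t)$ for all $t$, for some constant $A$ (e.g. the least integers exceeding $B_t$). Then there is a function $\epsilon\mapsto T(\epsilon)\geq 1$ such that for every $\epsilon>0$, with horizon $T(\epsilon)$ (and with every larger horizon), $\mathbb E\|\widetilde\Phi_{\mathcal X,R}\|^2\le\epsilon^2$, and as $\epsilon\to0^+$ (with $\widetilde O$ hiding powers of $\log(1/\epsilon)$): - the number of evaluations of $f$ is $\sum_{t=1}^{T(\epsilon)}N_t=\widetilde O(\epsilon^{-4})$; - the number of evaluations of $\nabla_yg$ is $\sum_{t=1}^{T(\epsilon)}K_tN_t=\widetilde O(\epsilon^{-10})$; - the number of evaluations of $\nabla^2_{yy}g$ is $\sum_{t=1}^{T(\epsilon)}K_tN_t=\widetilde O(\epsilon^{-10})$. -/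

import Mathlib

open MeasureTheory ProbabilityTheory Filter Topology
open scoped ENNReal NNReal

namespace SCiNBiO

noncomputable section

/-- `ℝᵏ` with the Euclidean norm. -/
abbrev Euc (k : ℕ) : Type := EuclideanSpace ℝ (Fin k)

/-! ### Derivatives of the lower-level objective `g : ℝⁿ × ℝᵐ → ℝ` -/

/-- Partial gradient `∇_x g(x, y)`. -/
def gradX {n m : ℕ} (g : Euc n → Euc m → ℝ) (x : Euc n) (y : Euc m) : Euc n :=
  gradient (fun x' => g x' y) x

/-- Partial gradient `∇_y g(x, y)`. -/
def gradY {n m : ℕ} (g : Euc n → Euc m → ℝ) (x : Euc n) (y : Euc m) : Euc m :=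
  gradient (g x) y

/-- Partial Hessian `∇²_yy g(x, y)`, as a linear operator on `ℝᵐ`. -/
def hessYY {n m : ℕ} (g : Euc n → Euc m → ℝ) (x : Euc n) (y : Euc m) : Euc m →L[ℝ] Euc m :=
  fderiv ℝ (gradY g x) y

/-- `a` is an eigenvalue of the operator `H`. -/
def IsEigenvalue {m : ℕ} (H : Euc m →L[ℝ] Euc m) (a : ℝ) : Prop :=
  Module.End.HasEigenvalue (H : Euc m →ₗ[ℝ] Euc m) a

/-- Smallest eigenvalue (meant for symmetric operators). -/
def minEigenvalue {m : ℕ} (H : Euc m →L[ℝ] Euc m) : ℝ := sInf {a : ℝ | IsEigenvalue H a}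

/-! ### Standing assumptions on the data -/

/-- Assumptions on the feasible set `X`, the objectives `f, g`, the initial point `y₀`, the compact
set `Y` containing the sublevel sets, the Lipschitz constants `Lg` (of the gradient of `g`) and `M`
(of `∇²_yy g`), the lower bound `gLow` of `g`, the upper bound `g0` of `g(·, y₀)`, and the bound
`fbar` of `|f|` and the Lipschitz constant `Lf` of `f` in `y` over the sublevel sets. All joint
Lipschitz conditions are with respect to the Euclidean norm of `ℝⁿ × ℝᵐ`. -/
structure StandingAssumptions {n m : ℕ} (X : Set (Euc n)) (f g : Euc n → Euc m → ℝ)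
    (y0 : Euc m) (Y : Set (Euc m)) (Lg M gLow g0 fbar Lf : ℝ) : Prop where
  f_cont : ContinuousOn (Function.uncurry f) (X ×ˢ Set.univ)
  g_smooth : ContDiff ℝ ((⊤ : ℕ∞) : WithTop ℕ∞) (Function.uncurry g)
  X_nonempty : X.Nonempty
  X_convex : Convex ℝ X
  X_compact : IsCompact X
  grad_lipschitz : ∀ x ∈ X, ∀ x' ∈ X, ∀ y y' : Euc m,
    √(‖gradX g x y - gradX g x' y'‖ ^ 2 + ‖gradY g x y - gradY g x' y'‖ ^ 2)
      ≤ Lg * √(‖x - x'‖ ^ 2 + ‖y - y'‖ ^ 2)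
  M_pos : 0 < M
  hess_lipschitz : ∀ x ∈ X, ∀ x' ∈ X, ∀ y y' : Euc m,
    ‖hessYY g x y - hessYY g x' y'‖ ≤ M * √(‖x - x'‖ ^ 2 + ‖y - y'‖ ^ 2)
  g_lower : ∀ x ∈ X, ∀ y, gLow ≤ g x y
  Y_compact : IsCompact Y
  sublevel_subset : ∀ x ∈ X, {y | g x y ≤ g x y0} ⊆ Y
  g0_upper : ∀ x ∈ X, g x y0 ≤ g0
  f_bound : ∀ x ∈ X, ∀ y, g x y ≤ g x y0 → |f x y| ≤ fbar
  f_lipschitz : ∀ x ∈ X, ∀ y y', g x y ≤ g x y0 → g x y' ≤ g x y0 →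
    |f x y - f x y'| ≤ Lf * ‖y - y'‖

/-! ### Degenerate stationary points, bifurcation set, fold points -/

/-- `y` is a degenerate stationary point of `g(x, ·)`. -/
def IsDegenerateStationary {n m : ℕ} (g : Euc n → Euc m → ℝ) (x : Euc n) (y : Euc m) : Prop :=
  gradY g x y = 0 ∧ LinearMap.det (hessYY g x y : Euc m →ₗ[ℝ] Euc m) = 0

/-- `g(x, ·)` is a Morse function: every stationary point is non-degenerate. -/
def IsMorseAt {n m : ℕ} (g : Euc n → Euc m → ℝ) (x : Euc n) : Prop :=
  ∀ y : Euc m, gradY g x y = 0 → LinearMap.det (hessYY g x y : Euc m →ₗ[ℝ] Euc m) ≠ 0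

/-- The bifurcation point set: all `x ∈ X` for which `g(x, ·)` is not Morse. -/
def bifurcationSet {n m : ℕ} (X : Set (Euc n)) (g : Euc n → Euc m → ℝ) : Set (Euc n) :=
  {x ∈ X | ¬ IsMorseAt g x}

/-- The part of `X` within distance `≤ δ` of the bifurcation point set. (`Metric.cthickening` is
used because it treats the empty set correctly: its neighbourhoods are empty.) -/
def bifurcationNbhd {n m : ℕ} (X : Set (Euc n)) (g : Euc n → Euc m → ℝ) (δ : ℝ) : Set (Euc n) :=
  {x ∈ X | x ∈ Metric.cthickening δ (bifurcationSet X g)}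

/-- The gradient, at `x`, of the scalar function `x' ↦ ⟨∇_y g(x', y), v⟩`. -/
def crossGrad {n m : ℕ} (g : Euc n → Euc m → ℝ) (x : Euc n) (y v : Euc m) : Euc n :=
  gradient (fun x' => inner ℝ (gradY g x' y) v) x

/-- `x` is a fold bifurcation point associated with the stationary point `y`. -/
structure IsFold {n m : ℕ} (g : Euc n → Euc m → ℝ) (x : Euc n) (y : Euc m) : Prop where
  stationary : gradY g x y = 0
  simple_zero : Module.finrank ℝ (LinearMap.ker (hessYY g x y : Euc m →ₗ[ℝ] Euc m)) = 1
  unfolding : ∀ v : Euc m, ‖v‖ = 1 → hessYY g x y v = 0 → crossGrad g x y v ≠ 0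
  cubic : ∀ v : Euc m, ‖v‖ = 1 → hessYY g x y v = 0 →
    iteratedFDeriv ℝ 3 (g x) y (fun _ => v) ≠ 0

/-- The (outward) normal cone of the convex set `X` at `x`. -/
def normalCone {n : ℕ} (X : Set (Euc n)) (x : Euc n) : Set (Euc n) :=
  {w | ∀ z ∈ X, inner ℝ w (z - x) ≤ 0}

/-- The bifurcation surface is not tangent to the boundary of `X` at `x`: its normal vector
`∇_x ⟨∇_y g, v⟩` does not lie on the boundary of the normal cone of `X`. (Replacing `v` by `-v`
gives the same for the opposite normal vector.) At an interior point `x` of `X` the normal cone is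
`{0}`, so that this only says that the vector is nonzero. -/
def IsNontangential {n m : ℕ} (X : Set (Euc n)) (g : Euc n → Euc m → ℝ) (x : Euc n)
    (y : Euc m) : Prop :=
  ∀ v : Euc m, ‖v‖ = 1 → hessYY g x y v = 0 → crossGrad g x y v ∉ frontier (normalCone X x)

/-- Upper Minkowski (box-counting) dimension of a bounded subset of `ℝᵏ`. The empty set has
dimension `0`, since `Real.log 0 = 0`. -/
def upperMinkowskiDim {k : ℕ} (A : Set (Euc k)) : ℝ :=
  limsup (fun r : ℝ =>
    Real.log ((Metric.externalCoveringNumber r.toNNReal A).toNat : ℝ) / (-Real.log r)) (𝓝[>] 0)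

/-! ### The lower-level method: cubic-regularized Newton -/

/-- The model `s ↦ ⟨∇_y g(x,y), s⟩ + ½ ⟨∇²_yy g(x,y) s, s⟩ + (M/6) ‖s‖³`. -/
def cubicModel {n m : ℕ} (g : Euc n → Euc m → ℝ) (M : ℝ) (x : Euc n) (y s : Euc m) : ℝ :=
  inner ℝ (gradY g x y) s + 1 / 2 * inner ℝ (hessYY g x y s) s + M / 6 * ‖s‖ ^ 3

/-- `y` is a sequence of iterates of the cubic-regularized Newton method for `g(x, ·)` started at
`y₀`; each step is a global minimizer of the model. -/
def IsCubicNewtonRun {n m : ℕ} (g : Euc n → Euc m → ℝ) (M : ℝ) (x : Euc n) (y0 : Euc m)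
    (y : ℕ → Euc m) : Prop :=
  y 0 = y0 ∧ ∀ k, ∀ s, cubicModel g M x (y k) (y (k + 1) - y k) ≤ cubicModel g M x (y k) s

/-- The stationarity measure by which the returned iterate is selected. -/
def stationarityMeasure {n m : ℕ} (g : Euc n → Euc m → ℝ) (M : ℝ) (x : Euc n) (y : Euc m) : ℝ :=
  max (√(1 / M * ‖gradY g x y‖)) (-(2 / (3 * M)) * minEigenvalue (hessYY g x y))

/-- `yhat` is an output of `K` steps of the method: the best of the iterates `0, …, K`. -/
def IsCubicNewtonOutput {n m : ℕ} (g : Euc n → Euc m → ℝ) (M : ℝ) (x : Euc n)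
    (y : ℕ → Euc m) (K : ℕ) (yhat : Euc m) : Prop :=
  ∃ k ≤ K, yhat = y k ∧ ∀ j ≤ K, stationarityMeasure g M x (y k) ≤ stationarityMeasure g M x (y j)

/-- The accumulation points of the sequence of iterates with the smallest value of `g(x, ·)`. -/
def attainableSet {n m : ℕ} (g : Euc n → Euc m → ℝ) (x : Euc n) (y : ℕ → Euc m) : Set (Euc m) :=
  {z | MapClusterPt z atTop y ∧ ∀ z', MapClusterPt z' atTop y → g x z ≤ g x z'}

/-- `ycd` is a correspondence-driven solution: it minimizes `f(x, ·)` over the attainable set. -/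
def IsCorrespondenceDriven {n m : ℕ} (f g : Euc n → Euc m → ℝ) (x : Euc n) (y : ℕ → Euc m)
    (ycd : Euc m) : Prop :=
  ycd ∈ attainableSet g x y ∧ ∀ z ∈ attainableSet g x y, f x ycd ≤ f x z

/-! ### The prescribed number of inner steps -/

/-- The stationary points of `g(x, ·)` in `Y'`. -/
def critSet {n m : ℕ} (g : Euc n → Euc m → ℝ) (Y' : Set (Euc m)) (x : Euc n) : Set (Euc m) :=
  {y ∈ Y' | gradY g x y = 0}

/-- `μ(δ)`: the largest lower bound of `|a|` over all eigenvalues `a` of `∇²_yy g(x, y)`, over all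
`x ∈ X` outside the `δ`-neighbourhood of the bifurcation set and all stationary `y ∈ Y'`
(`∞` if there are none). -/
def muSharp {n m : ℕ} (X : Set (Euc n)) (g : Euc n → Euc m → ℝ) (Y' : Set (Euc m))
    (δ : ℝ) : ℝ≥0∞ :=
  ⨅ x ∈ X \ bifurcationNbhd X g δ, ⨅ y ∈ critSet g Y' x, ⨅ a : ℝ,
    ⨅ _ : IsEigenvalue (hessYY g x y) a, ENNReal.ofReal |a|

/-- `α(δ, r)`: the largest lower bound of `‖∇_y g(x, y)‖` over all `x ∈ X` outside the
`δ`-neighbourhood of the bifurcation set and all `y ∈ Y` at distance `> r` from the stationary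
points of `g(x, ·)` in `Y'` (`∞` if there are none). -/
def alphaSharp {n m : ℕ} (X : Set (Euc n)) (g : Euc n → Euc m → ℝ) (Y Y' : Set (Euc m))
    (δ : ℝ) (r : ℝ≥0∞) : ℝ≥0∞ :=
  ⨅ x ∈ X \ bifurcationNbhd X g δ, ⨅ y ∈ Y,
    ⨅ _ : r < Metric.infEDist y (critSet g Y' x), ENNReal.ofReal ‖gradY g x y‖

/-- The lower bound required of the number of inner steps, in terms of `D = ḡ₀ - g̲`,
the Hessian Lipschitz constant `M`, `μ = μ(δ)`, `α = α(δ, μ(δ) / (2M))` and `ρ`. -/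
def innerStepBound (D M : ℝ) (μ α : ℝ≥0∞) (ρ : ℝ) : ℝ≥0∞ :=
  max (ENNReal.ofReal (256 * D * √M / 9) / (min α (μ ^ 2 / ENNReal.ofReal (4 * M))) ^ (3 / 2 : ℝ))
      (ENNReal.ofReal (768 * D * M ^ 2) / μ ^ 3)
    + ENNReal.ofReal (256 * D * √M / 9) / (μ * ENNReal.ofReal ρ) ^ (3 / 2 : ℝ)

/-- The schedule `ρ_t = 1 / (t + 1)`. -/
def rhoSeq (t : ℕ) : ℝ := 1 / ((t : ℝ) + 1)

/-- The schedule `δ_t = (t + 1) ^ (-2 / (n - d))`. -/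
def deltaSeq (n : ℕ) (d : ℝ) (t : ℕ) : ℝ := ((t : ℝ) + 1) ^ (-2 / ((n : ℝ) - d))

/-- The schedule `N_t = t + 1`. -/
def sampleSeq (t : ℕ) : ℕ := t + 1

/-- The lower bound required of `K_t` for the schedules above. -/
def innerStepBoundSeq {n m : ℕ} (X : Set (Euc n)) (g : Euc n → Euc m → ℝ) (Y Y' : Set (Euc m))
    (M gLow g0 d : ℝ) (t : ℕ) : ℝ≥0∞ :=
  innerStepBound (g0 - gLow) M (muSharp X g Y' (deltaSeq n d t))
    (alphaSharp X g Y Y' (deltaSeq n d t)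
      (muSharp X g Y' (deltaSeq n d t) / ENNReal.ofReal (2 * M)))
    (rhoSeq t)

/-! ### The upper-level method -/

/-- Euclidean projection onto a nonempty closed convex set. -/
def proj {n : ℕ} (X : Set (Euc n)) (z : Euc n) : Euc n :=
  Classical.epsilon fun p => p ∈ X ∧ ∀ q ∈ X, dist z p ≤ dist z q

open Classical in
/-- The value used by the algorithm at a perturbed point `x`: `f(x, ŷ(x))` on `X`, `f̄` outside. -/
def sampleValue {n m : ℕ} (X : Set (Euc n)) (f : Euc n → Euc m → ℝ) (fbar : ℝ)
    (yhat : Euc n → Euc m) (x : Euc n) : ℝ :=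
  if x ∈ X then f x (yhat x) else fbar

/-- The Monte Carlo gradient estimator `(1 / (N ξ)) ∑ i, f(x + ξ uᵢ, ŷ(x + ξ uᵢ)) uᵢ`. -/
def gradEstimator {n m : ℕ} (X : Set (Euc n)) (f : Euc n → Euc m → ℝ) (fbar ξ : ℝ)
    (yhat : Euc n → Euc m) (N : ℕ) (u : ℕ → Euc n) (x : Euc n) : Euc n :=
  (1 / ((N : ℝ) * ξ)) • ∑ i ∈ Finset.range N, sampleValue X f fbar yhat (x + ξ • u i) • u i

/-- The upper-level iterates, as a function of the samples `u t i` (`i < N t`) used at iteration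
`t`. Here `yhat K x` is the lower-level output after `K` steps at `x`. -/
def iterate {n m : ℕ} (X : Set (Euc n)) (f : Euc n → Euc m → ℝ) (fbar ξ β : ℝ)
    (yhat : ℕ → Euc n → Euc m) (K N : ℕ → ℕ) (xinit : Euc n) (u : ℕ → ℕ → Euc n) : ℕ → Euc n
  | 0 => xinit
  | t + 1 =>
    let x := iterate X f fbar ξ β yhat K N xinit u t
    proj X (x - β • gradEstimator X f fbar ξ (yhat (K t)) (N t) (u t) x)

/-- The projected gradient mapping `(x_t - proj_X (x_t - β ∇̂_t)) / β` at iteration `t`. -/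
def projGradMap {n m : ℕ} (X : Set (Euc n)) (f : Euc n → Euc m → ℝ) (fbar ξ β : ℝ)
    (yhat : ℕ → Euc n → Euc m) (K N : ℕ → ℕ) (xinit : Euc n) (u : ℕ → ℕ → Euc n) (t : ℕ) :
    Euc n :=
  let x := iterate X f fbar ξ β yhat K N xinit u t
  (1 / β) • (x - proj X (x - β • gradEstimator X f fbar ξ (yhat (K t)) (N t) (u t) x))

/-- The Lipschitz constant `f̄ / ξ²` of the gradient of the smoothed hyperfunction. -/
def smoothLip (fbar ξ : ℝ) : ℝ := fbar / ξ ^ 2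

/-- The probability mass function of the random output index on `{1, …, T}`, for step size `β`
and smoothness constant `L`. -/
def indexPmf (β L : ℝ) (T t : ℕ) : ℝ :=
  if t ∈ Finset.Icc 1 T then (β - L * β ^ 2) / ∑ _s ∈ Finset.Icc 1 T, (β - L * β ^ 2) else 0

/-! ### Oracle calls -/

/-- Evaluations of `f` in iterations `1, …, T`: one per sample. -/
def valueCalls (N : ℕ → ℕ) (T : ℕ) : ℕ := ∑ t ∈ Finset.Icc 1 T, N t

/-- Evaluations of `∇_y g` in iterations `1, …, T`: one per inner step of each sample. -/
def gradientCalls (K N : ℕ → ℕ) (T : ℕ) : ℕ := ∑ t ∈ Finset.Icc 1 T, K t * N t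

/-- Evaluations of `∇²_yy g` in iterations `1, …, T`: one per inner step of each sample. -/
def hessianCalls (K N : ℕ → ℕ) (T : ℕ) : ℕ := ∑ t ∈ Finset.Icc 1 T, K t * N t

/-- `Q(ε) = Õ(h(ε))` as `ε → 0⁺`. -/
def IsSoftO (Q h : ℝ → ℝ) : Prop :=
  ∃ p : ℕ, Q =O[𝓝[>] 0] fun ε => h ε * |Real.log ε| ^ p

end

end SCiNBiO

/-! The argument has an upper level, a bias estimate and a cost estimate, tied together by one
inequality for the lower-level landscape near folds.

Upper level. Off the bifurcation set the Newton iterates converge, so the values used by the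
algorithm have a bounded measurable limit `F`. Its Gaussian smoothing obeys a descent inequality
with constant `fbar / ξ ^ 2` although `F` has no regularity, because a shift of the argument can be
moved onto the Gaussian density (`gaussSmooth_add_le`). Projected stochastic descent on this
smoothing therefore telescopes, and the sum of the expected squared gradient mappings is bounded by
a constant plus the sum of the mean squared errors of the estimators. Both the variance (since `N_t
= t + 1`) and the squared bias are `O(1 / (t + 1))`, so the average over `T` iterations is `O((1 +
log T) / T)`. A horizon of order `ε⁻² log (1/ε)` suffices.

Bias. Outside the `δ_t`-neighbourhood of the bifurcation set the output is within `ρ_t` of the limit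
of the iterates (`lower_level_limit`). Inside it the values differ by at most `2 fbar`, but the
neighbourhood has volume `O(δ_t ^ ((n - d) / 2)) = O(1 / (t + 1))` by a covering argument
(`volume_cthickening_le`). Cauchy-Schwarz turns these two facts into a squared bias of order `1 / (t
+ 1)`.

Fold geometry. At a fold the inverse function theorem, applied to a bordered system, gives a scalar
function `s(x)` with derivative `w ≠ 0` whose zeros in `X` are bifurcation points and which
satisfies `|s(x)| ≤ C (‖∇_y g‖ + a²)` for every eigenvalue `a` of the Hessian
(`IsFold.exists_unfolding`). Nontangentiality supplies a zero of `s` inside `X` at distance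
`O(|s(x)|)` (`exists_zero_near`). By compactness `c δ ≤ ‖∇_y g‖ + a²` at distance more than `δ` from
the bifurcation set (`exists_mul_le_norm_gradY_add_sq`), hence `μ(δ) ≥ c √δ` and `α ≥ c δ`
(`exists_sharp_lower_bounds`).

Cost. The bifurcation set lies locally in the zero set of such an `s`, so it has codimension at
least one: `d ≤ n - 1` and `δ_t ≥ (t + 1)⁻²`. Then `μ_t` is at least of order `(t + 1)⁻¹`, `α_t` at
least of order `(t + 1)⁻²`, and `B_t = O((t + 1)³)`. Thus `∑ N_t = O(T²)` and `∑ K_t N_t = O(T⁵)`,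
which at the chosen horizon are `ε⁻⁴` and `ε⁻¹⁰` up to logarithms. -/

namespace SCiNBiO

/-! ### Symmetric operators: bounds from eigenvalues -/

section Symmetric

variable {E : Type*} [NormedAddCommGroup E] [InnerProductSpace ℝ E] [FiniteDimensional ℝ E]

lemma mul_norm_sq_le_inner_of_eigenvalue_ge {T : E →ₗ[ℝ] E} (hT : T.IsSymmetric) {c : ℝ}
    (hc : ∀ a, Module.End.HasEigenvalue T a → c ≤ a) (e : E) :
    c * ‖e‖ ^ 2 ≤ inner ℝ (T e) e := by
  set b := hT.eigenvectorBasis (n := Module.finrank ℝ E) rfl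
  have h1 : ‖e‖ ^ 2 = ∑ i, (b.repr e i) ^ 2 := by
    rw [← b.repr.norm_map e, EuclideanSpace.norm_sq_eq]
    simp
  have h2 : inner ℝ (T e) e = ∑ i, hT.eigenvalues rfl i * (b.repr e i) ^ 2 := by
    rw [← b.repr.inner_map_map, PiLp.inner_apply]
    refine Finset.sum_congr rfl fun i _ => ?_
    have := hT.eigenvectorBasis_apply_self_apply rfl e i
    simp only [RCLike.inner_apply, conj_trivial]
    rw [show (b.repr (T e)) i = _ from this]
    simp only [b, RCLike.ofReal_real_eq_id, id]
    ring
  rw [h1, h2, Finset.mul_sum]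
  exact Finset.sum_le_sum fun i _ => mul_le_mul_of_nonneg_right
    (hc _ (hT.hasEigenvalue_eigenvalues rfl i)) (sq_nonneg _)

lemma mul_norm_le_norm_apply_of_eigenvalue {T : E →ₗ[ℝ] E} (hT : T.IsSymmetric) {c : ℝ}
    (hc0 : 0 ≤ c) (hc : ∀ a, Module.End.HasEigenvalue T a → c ≤ |a|) (e : E) :
    c * ‖e‖ ≤ ‖T e‖ := by
  set b := hT.eigenvectorBasis (n := Module.finrank ℝ E) rfl
  have h1 : ‖e‖ ^ 2 = ∑ i, (b.repr e i) ^ 2 := by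
    rw [← b.repr.norm_map e, EuclideanSpace.norm_sq_eq]
    simp
  have h2 : ‖T e‖ ^ 2 = ∑ i, hT.eigenvalues rfl i ^ 2 * (b.repr e i) ^ 2 := by
    rw [← b.repr.norm_map, EuclideanSpace.norm_sq_eq]
    refine Finset.sum_congr rfl fun i _ => ?_
    have := hT.eigenvectorBasis_apply_self_apply rfl e i
    rw [show (b.repr (T e)) i = _ from this]
    simp only [b, RCLike.ofReal_real_eq_id, id, Real.norm_eq_abs, sq_abs]
    ring
  refine abs_le_of_sq_le_sq' ?_ (norm_nonneg _) |>.2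
  rw [mul_pow, h1, h2, Finset.mul_sum]
  refine Finset.sum_le_sum fun i _ => mul_le_mul_of_nonneg_right ?_ (sq_nonneg _)
  rw [← sq_abs (hT.eigenvalues rfl i)]
  exact pow_le_pow_left₀ hc0 (hc _ (hT.hasEigenvalue_eigenvalues rfl i)) 2

end Symmetric

/-! ### Cubic-regularized Newton steps -/

section CubicNewton

variable {E : Type*} [NormedAddCommGroup E] [InnerProductSpace ℝ E]

lemma norm_gradient_taylor_le {G : E → E} {H : E → E →L[ℝ] E} {M : ℝ}
    (hG : ∀ y, HasFDerivAt G (H y) y)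
    (hH : ∀ y y', ‖H y - H y'‖ ≤ M * ‖y - y'‖) (y s : E) :
    ‖G (y + s) - G y - H y s‖ ≤ M / 2 * ‖s‖ ^ 2 := by
  have hd : ∀ τ : ℝ, HasDerivAt (fun τ : ℝ => G (y + τ • s) - G y - τ • H y s)
      (H (y + τ • s) s - H y s) τ := by
    intro τ
    have h1 : HasDerivAt (fun τ : ℝ => y + τ • s) s τ := by
      simpa using ((hasDerivAt_id τ).smul_const s).const_add y
    have h2 := (hG (y + τ • s)).comp_hasDerivAt τ h1
    exact ((h2.sub_const (G y)).sub ((hasDerivAt_id τ).smul_const (H y s))).congr_deriv (by simp)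
  have := image_norm_le_of_norm_deriv_right_le_deriv_boundary (a := 0) (b := 1)
    (f := fun τ : ℝ => G (y + τ • s) - G y - τ • H y s)
    (B := fun τ => M / 2 * ‖s‖ ^ 2 * τ ^ 2) (B' := fun τ => M / 2 * ‖s‖ ^ 2 * (2 * τ))
    (fun τ _ => (hd τ).continuousAt.continuousWithinAt)
    (fun τ _ => (hd τ).hasDerivWithinAt) (by simp)
    (fun τ => by simpa using (hasDerivAt_pow 2 τ).const_mul (M / 2 * ‖s‖ ^ 2))
    (fun τ hτ => by
      rw [← _root_.sub_apply]
      refine (ContinuousLinearMap.le_opNorm _ _).trans ?_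
      have h3 := hH (y + τ • s) y
      rw [add_sub_cancel_left, norm_smul, Real.norm_of_nonneg hτ.1] at h3
      calc _ ≤ (M * (τ * ‖s‖)) * ‖s‖ := mul_le_mul_of_nonneg_right h3 (norm_nonneg _)
        _ = _ := by ring)
    (x := 1) (by simp)
  simpa using this

lemma taylor_cubic_le {φ : E → ℝ} {G : E → E} {H : E → E →L[ℝ] E} {M : ℝ}
    (hφ : ∀ y, HasFDerivAt φ (innerSL ℝ (G y)) y) (hG : ∀ y, HasFDerivAt G (H y) y)
    (hH : ∀ y y', ‖H y - H y'‖ ≤ M * ‖y - y'‖) (y s : E) :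
    φ (y + s) ≤ φ y + (inner ℝ (G y) s + 1 / 2 * inner ℝ (H y s) s + M / 6 * ‖s‖ ^ 3) := by
  have hd : ∀ τ : ℝ, HasDerivAt (fun τ : ℝ => φ (y + τ • s) - φ y - τ * inner ℝ (G y) s
      - τ ^ 2 * (1 / 2 * inner ℝ (H y s) s))
      (inner ℝ (G (y + τ • s) - G y - H y (τ • s)) s) τ := by
    intro τ
    have h1 : HasDerivAt (fun τ : ℝ => y + τ • s) s τ := by
      simpa using ((hasDerivAt_id τ).smul_const s).const_add y
    have h2 := (hφ (y + τ • s)).comp_hasDerivAt τ h1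
    have h3 := ((h2.sub_const (φ y)).sub ((hasDerivAt_id τ).mul_const (inner ℝ (G y) s))).sub
      ((hasDerivAt_pow 2 τ).mul_const (1 / 2 * inner ℝ (H y s) s))
    refine h3.congr_deriv ?_
    simp only [map_smul, inner_sub_left, real_inner_smul_left, innerSL_apply_apply]
    push_cast
    ring
  have := image_norm_le_of_norm_deriv_right_le_deriv_boundary (a := 0) (b := 1)
    (f := fun τ : ℝ => φ (y + τ • s) - φ y - τ * inner ℝ (G y) s
      - τ ^ 2 * (1 / 2 * inner ℝ (H y s) s))
    (B := fun τ => M / 6 * ‖s‖ ^ 3 * τ ^ 3) (B' := fun τ => M / 6 * ‖s‖ ^ 3 * (3 * τ ^ 2))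
    (fun τ _ => (hd τ).continuousAt.continuousWithinAt)
    (fun τ _ => (hd τ).hasDerivWithinAt) (by simp)
    (fun τ => by simpa using (hasDerivAt_pow 3 τ).const_mul (M / 6 * ‖s‖ ^ 3))
    (fun τ hτ => by
      refine (norm_inner_le_norm _ _).trans ?_
      have h3 := norm_gradient_taylor_le hG hH y (τ • s)
      rw [norm_smul, Real.norm_of_nonneg hτ.1] at h3
      calc _ ≤ (M / 2 * (τ * ‖s‖) ^ 2) * ‖s‖ := mul_le_mul_of_nonneg_right h3 (norm_nonneg _)
        _ = _ := by ring)
    (x := 1) (by simp)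
  simp only [one_smul, one_mul, one_pow, mul_one, Real.norm_eq_abs] at this
  linarith [le_abs_self (φ (y + s) - φ y - inner ℝ (G y) s - 1 / 2 * inner ℝ (H y s) s)]

/-- `s` is a global minimizer of the cubic model with linear part `a`, quadratic part `H`. -/
def IsCubicMin (a : E) (H : E →L[ℝ] E) (M : ℝ) (s : E) : Prop :=
  ∀ t, inner ℝ a s + 1 / 2 * inner ℝ (H s) s + M / 6 * ‖s‖ ^ 3
    ≤ inner ℝ a t + 1 / 2 * inner ℝ (H t) t + M / 6 * ‖t‖ ^ 3

lemma IsCubicMin.first_order {a : E} {H : E →L[ℝ] E} {M : ℝ} {s : E}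
    (hs : IsCubicMin a H M s) (hH : ∀ u v, inner ℝ (H u) v = inner ℝ u (H v)) :
    a + H s + (M / 2 * ‖s‖) • s = 0 := by
  -- The residual `r` is the gradient of the model at `s`. Differentiating the model along `r`
  -- itself gives `‖r‖²`, which must vanish at a minimizer.
  set r := a + H s + (M / 2 * ‖s‖) • s with hr
  have h0 : ∀ τ : ℝ, HasDerivAt (fun τ : ℝ => s + τ • r) r τ := fun τ => by
    simpa using ((hasDerivAt_id τ).smul_const r).const_add s
  have h1 : HasDerivAt (fun τ : ℝ => ‖s + τ • r‖ ^ 3) (3 * ‖s‖ * inner ℝ s r) 0 := by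
    have h := hasFDerivAt_norm_rpow (s + (0 : ℝ) • r) (p := 3) (by norm_num)
    have h2 := h.comp_hasDerivAt (0 : ℝ) (h0 0)
    have e : (fun τ : ℝ => ‖s + τ • r‖ ^ 3) = (fun x : E => ‖x‖ ^ (3 : ℝ)) ∘ fun τ : ℝ => s + τ • r := by
      ext τ; simp only [Function.comp]; norm_cast
    rw [e]
    refine h2.congr_deriv ?_
    rw [zero_smul, add_zero]
    norm_num
  have h2 : HasDerivAt (fun τ : ℝ => inner ℝ a (s + τ • r) + 1 / 2 * inner ℝ (H (s + τ • r)) (s + τ • r)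
      + M / 6 * ‖s + τ • r‖ ^ 3) (inner ℝ r r) 0 := by
    have ha := (hasDerivAt_const (0 : ℝ) a).inner ℝ (h0 0)
    have hb := (((H.hasFDerivAt).comp_hasDerivAt (0 : ℝ) (h0 0)).inner ℝ (h0 0)).const_mul (1 / 2 : ℝ)
    refine ((ha.add hb).add (h1.const_mul (M / 6))).congr_deriv ?_
    simp only [Function.comp, zero_smul, add_zero, inner_zero_left]
    rw [hH r s, real_inner_comm (H s) r]
    conv_rhs => rw [hr]
    simp only [inner_add_left, real_inner_smul_left]
    ring
  have h3 : IsLocalMin (fun τ : ℝ => inner ℝ a (s + τ • r) + 1 / 2 * inner ℝ (H (s + τ • r)) (s + τ • r)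
      + M / 6 * ‖s + τ • r‖ ^ 3) 0 := by
    refine Eventually.of_forall fun τ => ?_
    simpa using hs (s + τ • r)
  have := h3.hasDerivAt_eq_zero h2
  exact inner_self_eq_zero.1 this

/-- Global minimality is used, not only local. If `e` is not orthogonal to `s`, there is `τ ≠ 0`
with `‖s + τ e‖ = ‖s‖`; the cubic terms then cancel, and comparing the quadratic parts gives exactly
the claim times `τ² / 2`. Orthogonal directions follow by letting `τ → 0` in `e + τ s`. If `s = 0`,
the linear part vanishes and small multiples of `e` are compared. -/
lemma IsCubicMin.second_order {a : E} {H : E →L[ℝ] E} {M : ℝ} {s : E}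
    (hs : IsCubicMin a H M s) (hH : ∀ u v, inner ℝ (H u) v = inner ℝ u (H v)) (e : E) :
    0 ≤ inner ℝ (H e) e + M / 2 * ‖s‖ * ‖e‖ ^ 2 := by
  have hf := hs.first_order hH
  by_cases hs0 : s = 0
  · subst hs0
    have ha : a = 0 := by simpa using hf
    subst ha
    have key : ∀ τ : ℝ, 0 < τ → 0 ≤ 1 / 2 * inner ℝ (H e) e + τ * (M / 6 * ‖e‖ ^ 3) := by
      intro τ hτ
      have := hs (τ • e)
      simp only [inner_zero_left, map_smul, real_inner_smul_left, real_inner_smul_right,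
        norm_smul, Real.norm_of_nonneg hτ.le, norm_zero, map_zero] at this
      have h2 : 0 ≤ τ ^ 2 * (1 / 2 * inner ℝ (H e) e + τ * (M / 6 * ‖e‖ ^ 3)) := by
        calc (0 : ℝ) ≤ _ := by simpa using this
          _ = _ := by ring
      exact nonneg_of_mul_nonneg_right h2 (by positivity)
    have hlim : Tendsto (fun τ : ℝ => 1 / 2 * inner ℝ (H e) e + τ * (M / 6 * ‖e‖ ^ 3)) (𝓝[>] 0)
        (𝓝 (1 / 2 * inner ℝ (H e) e + 0 * (M / 6 * ‖e‖ ^ 3))) :=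
      (Continuous.tendsto (by fun_prop) 0).mono_left nhdsWithin_le_nhds
    have := ge_of_tendsto hlim (eventually_mem_nhdsWithin.mono fun τ hτ => key τ hτ)
    simp only [norm_zero]
    linarith
  · have main : ∀ e : E, inner ℝ e s ≠ 0 → 0 ≤ inner ℝ (H e) e + M / 2 * ‖s‖ * ‖e‖ ^ 2 := by
      intro e he
      have he0 : e ≠ 0 := by rintro rfl; simp at he
      set τ : ℝ := -2 * inner ℝ e s / ‖e‖ ^ 2 with hτ
      have hepos : 0 < ‖e‖ ^ 2 := by positivity
      have hτ0 : τ ≠ 0 := by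
        rw [hτ]; exact div_ne_zero (mul_ne_zero (by norm_num) he) hepos.ne'
      have hn2 : ‖s + τ • e‖ ^ 2 = ‖s‖ ^ 2 := by
        rw [norm_add_sq_real, real_inner_smul_right, norm_smul, mul_pow, Real.norm_eq_abs, sq_abs,
          real_inner_comm]
        have : τ * ‖e‖ ^ 2 = -2 * inner ℝ e s := by rw [hτ]; field_simp
        linear_combination τ * this
      have hn : ‖s + τ • e‖ = ‖s‖ := by
        rwa [sq_eq_sq₀ (norm_nonneg _) (norm_nonneg _)] at hn2
      have h1 := hs (s + τ • e)
      rw [hn] at h1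
      have h2 : inner ℝ a (τ • e) = - inner ℝ (H s) (τ • e) - M / 2 * ‖s‖ * inner ℝ s (τ • e) := by
        have : inner ℝ (a + H s + (M / 2 * ‖s‖) • s) (τ • e) = 0 := by rw [hf, inner_zero_left]
        rw [inner_add_left, inner_add_left, real_inner_smul_left] at this
        linarith
      have h3 : 2 * inner ℝ s (τ • e) = - ‖τ • e‖ ^ 2 := by
        rw [norm_add_sq_real] at hn2; linarith
      rw [inner_add_right a, map_add, inner_add_left, inner_add_right, inner_add_right,
        hH (τ • e) s, real_inner_comm (H s) (τ • e), h2] at h1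
      have h4 : 0 ≤ inner ℝ (H (τ • e)) (τ • e) + M / 2 * ‖s‖ * ‖τ • e‖ ^ 2 := by
        have : ‖τ • e‖ ^ 2 = -(2 * inner ℝ s (τ • e)) := by linarith
        rw [this]; linarith
      rw [map_smul, real_inner_smul_left, real_inner_smul_right, norm_smul, mul_pow,
        Real.norm_eq_abs, sq_abs] at h4
      have h5 : 0 ≤ τ ^ 2 * (inner ℝ (H e) e + M / 2 * ‖s‖ * ‖e‖ ^ 2) := by linarith
      exact nonneg_of_mul_nonneg_right h5 (by positivity)
    by_cases he : inner ℝ e s = 0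
    · have hlim : Tendsto (fun τ : ℝ => inner ℝ (H (e + τ • s)) (e + τ • s)
          + M / 2 * ‖s‖ * ‖e + τ • s‖ ^ 2) (𝓝[>] 0)
          (𝓝 (inner ℝ (H (e + (0 : ℝ) • s)) (e + (0 : ℝ) • s)
          + M / 2 * ‖s‖ * ‖e + (0 : ℝ) • s‖ ^ 2)) :=
        (Continuous.tendsto (by fun_prop) 0).mono_left nhdsWithin_le_nhds
      have := ge_of_tendsto hlim (eventually_mem_nhdsWithin.mono fun τ (hτ : 0 < τ) => main _ (by
        rw [inner_add_left, he, zero_add, real_inner_smul_left, real_inner_self_eq_norm_sq]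
        positivity))
      simpa using this
    · exact main e he

/-- Consequences of one cubic Newton step from `y` to `y + s`. -/
lemma IsCubicMin.step {φ : E → ℝ} {G : E → E} {H : E → E →L[ℝ] E} {M : ℝ}
    (hφ : ∀ y, HasFDerivAt φ (innerSL ℝ (G y)) y) (hG : ∀ y, HasFDerivAt G (H y) y)
    (hM : 0 ≤ M) (hH : ∀ y y', ‖H y - H y'‖ ≤ M * ‖y - y'‖)
    (hsymm : ∀ y u v, inner ℝ (H y u) v = inner ℝ u (H y v))
    {y s : E} (hs : IsCubicMin (G y) (H y) M s) :
    φ (y + s) + M / 12 * ‖s‖ ^ 3 ≤ φ y ∧ ‖G (y + s)‖ ≤ M * ‖s‖ ^ 2 ∧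
      ∀ e, -(3 / 2 * M * ‖s‖) * ‖e‖ ^ 2 ≤ inner ℝ (H (y + s) e) e := by
  have h1 := hs.first_order (hsymm y)
  have h2 := hs.second_order (hsymm y)
  refine ⟨?_, ?_, fun e => ?_⟩
  · have h3 := taylor_cubic_le hφ hG hH y s
    have h4 : inner ℝ (G y + H y s + (M / 2 * ‖s‖) • s) s = 0 := by rw [h1, inner_zero_left]
    rw [inner_add_left, inner_add_left, real_inner_smul_left, real_inner_self_eq_norm_sq] at h4
    have h5 := h2 s
    -- By `h4` the model value equals `-⟨H s, s⟩ / 2 - (M/3) ‖s‖³`, and `h5` bounds its first term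
    -- by `(M/4) ‖s‖³`. The sum is at most `-(M/12) ‖s‖³`.
    nlinarith [h3, h4, h5]
  · have h3 := norm_gradient_taylor_le hG hH y s
    have : G (y + s) = (G (y + s) - G y - H y s) - (M / 2 * ‖s‖) • s := by
      have : (M / 2 * ‖s‖) • s = - G y - H y s := by
        rw [← sub_eq_zero, ← h1]; abel
      rw [this]; abel
    rw [this]
    refine (norm_sub_le _ _).trans ?_
    rw [norm_smul, Real.norm_of_nonneg (by positivity)]
    linarith
  · have h3 : |inner ℝ ((H (y + s) - H y) e) e| ≤ M * ‖s‖ * ‖e‖ ^ 2 := by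
      refine (abs_real_inner_le_norm _ _).trans ?_
      have h4 := hH (y + s) y
      rw [add_sub_cancel_left] at h4
      calc _ ≤ (‖H (y + s) - H y‖ * ‖e‖) * ‖e‖ := by gcongr; exact ContinuousLinearMap.le_opNorm _ _
        _ ≤ (M * ‖s‖ * ‖e‖) * ‖e‖ := by gcongr
        _ = _ := by ring
    rw [_root_.sub_apply, inner_sub_left] at h3
    have := h2 e
    linarith [(abs_le.1 h3).1]

end CubicNewton

/-! ### Global complexity and local convergence of cubic-regularized Newton. -/

section CubicNewtonConvergence

variable {E : Type*} [NormedAddCommGroup E] [InnerProductSpace ℝ E]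

/-- The decreases `M/12 ‖s_j‖³` telescope to at most `D`, so the shortest of `K` steps uses at most
the share `D / K`. -/
lemma exists_step_le_of_cubicMin {φ : E → ℝ} {G : E → E} {H : E → E →L[ℝ] E} {M D : ℝ}
    (hφ : ∀ y, HasFDerivAt φ (innerSL ℝ (G y)) y) (hG : ∀ y, HasFDerivAt G (H y) y)
    (hM : 0 ≤ M) (hH : ∀ y y', ‖H y - H y'‖ ≤ M * ‖y - y'‖)
    (hsymm : ∀ y u v, inner ℝ (H y u) v = inner ℝ u (H y v))
    {y : ℕ → E} (hs : ∀ k, IsCubicMin (G (y k)) (H (y k)) M (y (k + 1) - y k)) (K : ℕ)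
    (hD : φ (y 0) - φ (y K) ≤ D) (hK : 0 < K) :
    ∃ j < K, M * K * ‖y (j + 1) - y j‖ ^ 3 ≤ 12 * D := by
  by_contra! hcon
  have hsum : ∀ k, ∑ j ∈ Finset.range k, M / 12 * ‖y (j + 1) - y j‖ ^ 3 ≤ φ (y 0) - φ (y k) := by
    intro k
    induction k with
    | zero => simp
    | succ k ih =>
      have h := ((hs k).step hφ hG hM hH hsymm).1
      rw [add_sub_cancel] at h
      rw [Finset.sum_range_succ]
      linarith
  have h1 : ∑ j ∈ Finset.range K, D / K < ∑ j ∈ Finset.range K, M / 12 * ‖y (j + 1) - y j‖ ^ 3 := by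
    refine Finset.sum_lt_sum_of_nonempty ⟨0, by simpa using hK⟩ fun j hj => ?_
    have := hcon j (Finset.mem_range.1 hj)
    have hK' : (0 : ℝ) < K := by exact_mod_cast hK
    rw [div_lt_iff₀ hK']
    linarith
  rw [Finset.sum_const, Finset.card_range, nsmul_eq_mul, mul_div_cancel₀ _ (by positivity)] at h1
  linarith [hsum K]

lemma antitone_of_cubicMin {φ : E → ℝ} {G : E → E} {H : E → E →L[ℝ] E} {M : ℝ}
    (hφ : ∀ y, HasFDerivAt φ (innerSL ℝ (G y)) y) (hG : ∀ y, HasFDerivAt G (H y) y)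
    (hM : 0 ≤ M) (hH : ∀ y y', ‖H y - H y'‖ ≤ M * ‖y - y'‖)
    (hsymm : ∀ y u v, inner ℝ (H y u) v = inner ℝ u (H y v))
    {y : ℕ → E} (hs : ∀ k, IsCubicMin (G (y k)) (H (y k)) M (y (k + 1) - y k)) :
    Antitone fun k => φ (y k) := by
  refine antitone_nat_of_succ_le fun k => ?_
  have h := ((hs k).step hφ hG hM hH hsymm).1
  rw [add_sub_cancel] at h
  have : 0 ≤ M / 12 * ‖y (k + 1) - y k‖ ^ 3 := by positivity
  linarith

/-- Near a nondegenerate minimizer the gradient controls the distance: in the ball of radius `μ /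
(2M)` the Taylor remainder `M/2 ‖p - z‖²` is at most a quarter of `μ ‖p - z‖`. -/
lemma norm_sub_le_of_strongMin {G : E → E} {H : E → E →L[ℝ] E} {M μ : ℝ}
    (hG : ∀ y, HasFDerivAt G (H y) y)
    (hM : 0 < M) (hH : ∀ y y', ‖H y - H y'‖ ≤ M * ‖y - y'‖)
    {z : E} (hz : G z = 0) (hzH : ∀ e, μ * ‖e‖ ^ 2 ≤ inner ℝ (H z e) e) {p : E}
    (hp : ‖p - z‖ ≤ μ / (2 * M)) : 3 / 4 * μ * ‖p - z‖ ≤ ‖G p‖ := by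
  have h1 := norm_gradient_taylor_le hG hH z (p - z)
  rw [add_sub_cancel, hz, sub_zero] at h1
  have h2 : μ * ‖p - z‖ ≤ ‖H z (p - z)‖ := by
    by_cases h0 : ‖p - z‖ = 0
    · rw [h0, mul_zero]; exact norm_nonneg _
    have hpos : 0 < ‖p - z‖ := lt_of_le_of_ne (norm_nonneg _) (Ne.symm h0)
    have h3 := (hzH (p - z)).trans (real_inner_le_norm _ _)
    rw [sq, ← mul_assoc] at h3
    exact le_of_mul_le_mul_right h3 hpos
  have h3 : ‖H z (p - z)‖ - ‖G p‖ ≤ M / 2 * ‖p - z‖ ^ 2 := by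
    refine (norm_sub_norm_le _ _).trans ?_
    rwa [norm_sub_rev]
  have h4 : M * ‖p - z‖ ≤ μ / 2 := by
    rw [le_div_iff₀ (by positivity)] at hp; linarith
  nlinarith [norm_nonneg (p - z)]

/-- A trapping argument. The gradient threshold places `y_j` within `3/16 · μ/M` of `z`, where the
Hessian is still at least `13/16 · μ`. Hence `‖s‖ ≤ 9/52 · μ/M`, and since `3/16 + 9/52 < 1/2` the
next iterate stays in the ball. The new gradient is at most `M ‖s‖² ≤ (9/52)(16/13) ‖G (y j)‖`,
below a quarter of the old one. This linear rate is enough for convergence to `z`. -/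
lemma tendsto_of_cubicMin {φ : E → ℝ} {G : E → E} {H : E → E →L[ℝ] E} {M μ : ℝ}
    (hφ : ∀ y, HasFDerivAt φ (innerSL ℝ (G y)) y) (hG : ∀ y, HasFDerivAt G (H y) y)
    (hM : 0 < M) (hH : ∀ y y', ‖H y - H y'‖ ≤ M * ‖y - y'‖)
    (hsymm : ∀ y u v, inner ℝ (H y u) v = inner ℝ u (H y v))
    {y : ℕ → E} (hs : ∀ k, IsCubicMin (G (y k)) (H (y k)) M (y (k + 1) - y k))
    {z : E} (hμ : 0 < μ) (hz : G z = 0) (hzH : ∀ e, μ * ‖e‖ ^ 2 ≤ inner ℝ (H z e) e) {k : ℕ}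
    (hk : ‖y k - z‖ ≤ μ / (2 * M)) (hGk : ‖G (y k)‖ ≤ 9 / 64 * (μ ^ 2 / M)) :
    Tendsto y atTop (𝓝 z) := by
  have hstep : ∀ j, ‖y j - z‖ ≤ μ / (2 * M) → ‖G (y j)‖ ≤ 9 / 64 * (μ ^ 2 / M) →
      ‖y (j + 1) - z‖ ≤ μ / (2 * M) ∧ ‖G (y (j + 1))‖ ≤ 1 / 4 * ‖G (y j)‖ := by
    intro j h1 h2
    have h3 := norm_sub_le_of_strongMin hG hM hH hz hzH h1
    have hd : ‖y j - z‖ ≤ 3 / 16 * (μ / M) := by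
      have h5 : 3 / 4 * μ * ‖y j - z‖ ≤ 3 / 4 * μ * (3 / 16 * (μ / M)) :=
        (h3.trans h2).trans_eq (by field_simp; norm_num)
      exact le_of_mul_le_mul_left h5 (by positivity)
    set s := y (j + 1) - y j with hsdef
    have hf := (hs j).first_order (hsymm (y j))
    have h6 : inner ℝ (H (y j) s) s ≤ ‖G (y j)‖ * ‖s‖ := by
      have h7 : inner ℝ (G (y j) + H (y j) s + (M / 2 * ‖s‖) • s) s = 0 := by
        rw [hf, inner_zero_left]
      rw [inner_add_left, inner_add_left, real_inner_smul_left, real_inner_self_eq_norm_sq] at h7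
      have h8 := (abs_le.1 (abs_real_inner_le_norm (G (y j)) s)).1
      have : 0 ≤ M / 2 * ‖s‖ * ‖s‖ ^ 2 := by positivity
      linarith
    have h9 : |inner ℝ ((H (y j) - H z) s) s| ≤ M * ‖y j - z‖ * ‖s‖ ^ 2 := by
      refine (abs_real_inner_le_norm _ _).trans ?_
      calc _ ≤ (‖H (y j) - H z‖ * ‖s‖) * ‖s‖ := by gcongr; exact ContinuousLinearMap.le_opNorm _ _
        _ ≤ (M * ‖y j - z‖ * ‖s‖) * ‖s‖ := by gcongr; exact hH _ _
        _ = _ := by ring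
    rw [_root_.sub_apply, inner_sub_left] at h9
    have hMd : M * ‖y j - z‖ ≤ 3 / 16 * μ := by
      calc M * ‖y j - z‖ ≤ M * (3 / 16 * (μ / M)) := by gcongr
        _ = _ := by field_simp
    have h10 : 13 / 16 * μ * ‖s‖ ≤ ‖G (y j)‖ := by
      by_cases h0 : ‖s‖ = 0
      · rw [h0, mul_zero]; exact norm_nonneg _
      have hpos : 0 < ‖s‖ := lt_of_le_of_ne (norm_nonneg _) (Ne.symm h0)
      refine le_of_mul_le_mul_right ?_ hpos
      have := hzH s
      have := (abs_le.1 h9).1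
      nlinarith [sq_nonneg ‖s‖]
    have hs1 : ‖s‖ ≤ 9 / 52 * (μ / M) := by
      have h11 : 13 / 16 * μ * ‖s‖ ≤ 13 / 16 * μ * (9 / 52 * (μ / M)) :=
        (h10.trans h2).trans_eq (by field_simp; norm_num)
      exact le_of_mul_le_mul_left h11 (by positivity)
    have hG1 := ((hs j).step hφ hG hM.le hH hsymm).2.1
    rw [add_sub_cancel, ← hsdef] at hG1
    refine ⟨?_, ?_⟩
    · have : y (j + 1) - z = s + (y j - z) := by rw [hsdef]; abel
      rw [this]
      refine (norm_add_le _ _).trans ?_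
      have : μ / (2 * M) = 1 / 2 * (μ / M) := by field_simp
      rw [this]
      have : 0 < μ / M := by positivity
      linarith
    · refine hG1.trans ?_
      have h12 : M * ‖s‖ ≤ 9 / 52 * μ := by
        calc M * ‖s‖ ≤ M * (9 / 52 * (μ / M)) := by gcongr
          _ = _ := by field_simp
      nlinarith [norm_nonneg s]
  have hinv : ∀ i, ‖y (k + i) - z‖ ≤ μ / (2 * M) ∧
      ‖G (y (k + i))‖ ≤ (1 / 4) ^ i * ‖G (y k)‖ := by
    intro i
    induction i with
    | zero => simpa using hk
    | succ i ih =>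
      have h1 : ‖G (y (k + i))‖ ≤ 9 / 64 * (μ ^ 2 / M) :=
        ih.2.trans ((mul_le_of_le_one_left (norm_nonneg _)
          (pow_le_one₀ (by norm_num) (by norm_num))).trans hGk)
      have h2 := hstep (k + i) ih.1 h1
      refine ⟨h2.1, h2.2.trans ?_⟩
      rw [pow_succ]
      linarith [ih.2]
  rw [← tendsto_add_atTop_iff_nat k, tendsto_iff_norm_sub_tendsto_zero]
  have hb : Tendsto (fun i : ℕ => 4 / (3 * μ) * ((1 / 4 : ℝ) ^ i * ‖G (y k)‖)) atTop (𝓝 0) := by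
    have := ((tendsto_pow_atTop_nhds_zero_of_lt_one (r := (1 / 4 : ℝ)) (by norm_num)
      (by norm_num)).mul_const ‖G (y k)‖).const_mul (4 / (3 * μ))
    simpa using this
  refine squeeze_zero (fun i => norm_nonneg _) (fun i => ?_) hb
  rw [add_comm i k]
  have h1 := norm_sub_le_of_strongMin hG hM hH hz hzH (hinv i).1
  have h2 := (hinv i).2
  calc ‖y (k + i) - z‖ = 4 / (3 * μ) * (3 / 4 * μ * ‖y (k + i) - z‖) := by field_simp
    _ ≤ _ := mul_le_mul_of_nonneg_left (h1.trans h2) (by positivity)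

end CubicNewtonConvergence

/-! ### Derivatives of the lower-level objective -/

section Derivatives

variable {n m : ℕ} {g : Euc n → Euc m → ℝ}

lemma contDiff_gradY (hg : ContDiff ℝ ((⊤ : ℕ∞) : WithTop ℕ∞) (Function.uncurry g)) :
    ContDiff ℝ ((⊤ : ℕ∞) : WithTop ℕ∞) (fun p : Euc n × Euc m => gradY g p.1 p.2) := by
  have h : ContDiff ℝ ((⊤ : ℕ∞) : WithTop ℕ∞)
      (fun p : Euc n × Euc m => fderiv ℝ (g p.1) p.2) :=
    ContDiff.fderiv (f := fun p : Euc n × Euc m => g p.1)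
      (by exact hg.comp ((contDiff_fst.comp contDiff_fst).prodMk contDiff_snd))
      contDiff_snd (by exact le_rfl)
  exact (InnerProductSpace.toDual ℝ (Euc m)).symm.contDiff.comp h

lemma contDiff_hessYY (hg : ContDiff ℝ ((⊤ : ℕ∞) : WithTop ℕ∞) (Function.uncurry g)) :
    ContDiff ℝ ((⊤ : ℕ∞) : WithTop ℕ∞) (fun p : Euc n × Euc m => hessYY g p.1 p.2) :=
  ContDiff.fderiv (f := fun p : Euc n × Euc m => gradY g p.1)
    (by exact (contDiff_gradY hg).comp ((contDiff_fst.comp contDiff_fst).prodMk contDiff_snd))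
    contDiff_snd (by exact le_rfl)

lemma contDiff_slice (hg : ContDiff ℝ ((⊤ : ℕ∞) : WithTop ℕ∞) (Function.uncurry g)) (x : Euc n) :
    ContDiff ℝ ((⊤ : ℕ∞) : WithTop ℕ∞) (g x) :=
  hg.comp (contDiff_const.prodMk contDiff_id)

lemma contDiff_gradY_slice (hg : ContDiff ℝ ((⊤ : ℕ∞) : WithTop ℕ∞) (Function.uncurry g))
    (x : Euc n) : ContDiff ℝ ((⊤ : ℕ∞) : WithTop ℕ∞) (gradY g x) :=
  (contDiff_gradY hg).comp (contDiff_const.prodMk contDiff_id)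

lemma innerSL_gradY (x : Euc n) (y : Euc m) : innerSL ℝ (gradY g x y) = fderiv ℝ (g x) y := by
  have := (InnerProductSpace.toDual ℝ (Euc m)).apply_symm_apply (fderiv ℝ (g x) y)
  ext u
  rw [← this]
  rfl

lemma hasFDerivAt_g (hg : ContDiff ℝ ((⊤ : ℕ∞) : WithTop ℕ∞) (Function.uncurry g))
    (x : Euc n) (y : Euc m) : HasFDerivAt (g x) (innerSL ℝ (gradY g x y)) y := by
  rw [innerSL_gradY]
  exact ((contDiff_slice hg x).differentiable (by simp) y).hasFDerivAt

lemma hasFDerivAt_gradY (hg : ContDiff ℝ ((⊤ : ℕ∞) : WithTop ℕ∞) (Function.uncurry g))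
    (x : Euc n) (y : Euc m) : HasFDerivAt (gradY g x) (hessYY g x y) y :=
  ((contDiff_gradY_slice hg x).differentiable (by simp) y).hasFDerivAt

lemma inner_hessYY (hg : ContDiff ℝ ((⊤ : ℕ∞) : WithTop ℕ∞) (Function.uncurry g))
    (x : Euc n) (y u v : Euc m) :
    inner ℝ (hessYY g x y u) v = fderiv ℝ (fderiv ℝ (g x)) y u v := by
  have h1 : fderiv ℝ (g x) = fun y => innerSL ℝ (gradY g x y) := by
    ext1 y; rw [innerSL_gradY]
  have h2 : HasFDerivAt (fun y => innerSL ℝ (gradY g x y))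
      ((innerSL ℝ : Euc m →L[ℝ] _).comp (hessYY g x y)) y :=
    (innerSL ℝ : Euc m →L[ℝ] _).hasFDerivAt.comp y (hasFDerivAt_gradY hg x y)
  rw [h1, h2.fderiv]
  rfl

lemma hessYY_symm (hg : ContDiff ℝ ((⊤ : ℕ∞) : WithTop ℕ∞) (Function.uncurry g))
    (x : Euc n) (y u v : Euc m) :
    inner ℝ (hessYY g x y u) v = inner ℝ u (hessYY g x y v) := by
  rw [inner_hessYY hg, real_inner_comm, inner_hessYY hg]
  have : IsSymmSndFDerivAt ℝ (g x) y :=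
    (contDiff_slice hg x).contDiffAt.isSymmSndFDerivAt (by
      rw [minSmoothness_of_isRCLikeNormedField]; exact WithTop.coe_le_coe.2 (le_top (a := (2 : ℕ∞))))
  exact this.eq u v

lemma isSymmetric_hessYY (hg : ContDiff ℝ ((⊤ : ℕ∞) : WithTop ℕ∞) (Function.uncurry g))
    (x : Euc n) (y : Euc m) :
    (hessYY g x y : Euc m →ₗ[ℝ] Euc m).IsSymmetric :=
  fun u v => hessYY_symm hg x y u v

end Derivatives

/-! ### Extreme eigenvalues and quadratic forms. -/

section MinEigenvalue

variable {m : ℕ} {H : Euc m →L[ℝ] Euc m}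

lemma IsEigenvalue.exists_unit {a : ℝ} (h : IsEigenvalue H a) : ∃ e, ‖e‖ = 1 ∧ H e = a • e := by
  obtain ⟨e, he⟩ := h.exists_hasEigenvector
  have h0 : ‖e‖ ≠ 0 := norm_ne_zero_iff.2 he.2
  refine ⟨‖e‖⁻¹ • e, by rw [norm_smul, norm_inv, norm_norm, inv_mul_cancel₀ h0], ?_⟩
  have h1 : H e = a • e := he.apply_eq_smul
  rw [map_smul, h1, smul_comm]

lemma IsEigenvalue.abs_le {a : ℝ} (h : IsEigenvalue H a) : |a| ≤ ‖H‖ := by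
  obtain ⟨e, he, hae⟩ := h.exists_unit
  have := H.le_opNorm e
  rwa [hae, norm_smul, he, mul_one, mul_one] at this

lemma minEigenvalue_mul_le (hH : (H : Euc m →ₗ[ℝ] Euc m).IsSymmetric) (e : Euc m) :
    minEigenvalue H * ‖e‖ ^ 2 ≤ inner ℝ (H e) e := by
  refine mul_norm_sq_le_inner_of_eigenvalue_ge hH (fun a ha => ?_) e
  exact csInf_le ⟨-‖H‖, fun b hb => (abs_le.1 (IsEigenvalue.abs_le hb)).1⟩ ha

/-- The sign condition on `c` covers `m = 0`, where there is no eigenvalue and `sInf ∅ = 0`. -/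
lemma le_minEigenvalue {c : ℝ} (hc : c ≤ 0) (h : ∀ e, c * ‖e‖ ^ 2 ≤ inner ℝ (H e) e) :
    c ≤ minEigenvalue H := by
  refine Real.le_sInf (fun a ha => ?_) hc
  obtain ⟨e, he, hae⟩ := IsEigenvalue.exists_unit ha
  have := h e
  rwa [hae, real_inner_smul_left, real_inner_self_eq_norm_sq, he, one_pow, mul_one, mul_one] at this

end MinEigenvalue

/-! ### The output of the lower-level method away from the bifurcation set -/

/-- Origin of the constant `256/9`: if `√M ν > 3/4 √a`, cubing gives `27/64 · K a^(3/2) ≤ K (√M ν)³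
≤ 12 D √M`, and `12 · 64/27 = 256/9`. -/
lemma mul_sq_le_of_lt_nat {M D a ν : ℝ} {K : ℕ} (hM : 0 < M) (ha : 0 < a)
    (hν3 : M * K * ν ^ 3 ≤ 12 * D)
    (hK : 256 * D * √M / 9 / a ^ (3 / 2 : ℝ) < K) : 0 ≤ ν → M * ν ^ 2 ≤ 9 / 16 * a := by
  intro hν
  by_contra! hcon
  set q := √M with hq
  set b := √a with hb
  have hq0 : 0 < q := Real.sqrt_pos.2 hM
  have hb0 : 0 < b := Real.sqrt_pos.2 ha
  have hMq : M = q ^ 2 := (Real.sq_sqrt hM.le).symm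
  have hab : a = b ^ 2 := (Real.sq_sqrt ha.le).symm
  have ha3 : a ^ (3 / 2 : ℝ) = b ^ 3 := by
    rw [hb, Real.sqrt_eq_rpow, ← Real.rpow_natCast, ← Real.rpow_mul ha.le]; norm_num
  rw [ha3, div_lt_iff₀ (by positivity)] at hK
  have h1 : 3 / 4 * b < q * ν := by
    refine lt_of_pow_lt_pow_left₀ 2 (by positivity) ?_
    rw [hMq, hab] at hcon
    linarith
  have h2 : (3 / 4 * b) ^ 3 ≤ (q * ν) ^ 3 := pow_le_pow_left₀ (by positivity) h1.le 3
  have h3 : K * (3 / 4 * b) ^ 3 ≤ K * (q * ν) ^ 3 := by gcongr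
  have h4 : K * (q * ν) ^ 3 ≤ q * (12 * D) := by
    calc K * (q * ν) ^ 3 = q * (M * K * ν ^ 3) := by rw [hMq]; ring
      _ ≤ _ := by gcongr
  linarith

/-- The weights in the stationarity measure are such that its value at `y (j + 1)` is at most the
length of step `j`; hence the best value `ν` is at most the shortest step. The three lower bounds on
`K` turn this into `‖∇g‖ ≤ 9/16 a`, `λ_min ≥ -3/8 μ` and `‖∇g‖ ≤ 9/16 μρ` at the output. The first
puts the output within `μ/(2M)` of a stationary point, the second makes that point a nondegenerate
minimizer, and the third gives the accuracy `ρ`. -/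
lemma lower_level_output {n m : ℕ} {X : Set (Euc n)} {f g : Euc n → Euc m → ℝ}
    {y0 : Euc m} {Y Y' : Set (Euc m)} {Lg M gLow g0 fbar Lf : ℝ}
    (hstd : StandingAssumptions X f g y0 Y Lg M gLow g0 fbar Lf)
    (hY' : IsCompact Y') {x : Euc n} (hx : x ∈ X) {y : ℕ → Euc m}
    (hy : IsCubicNewtonRun g M x y0 y) {K : ℕ} {yhat : Euc m}
    (hout : IsCubicNewtonOutput g M x y K yhat) {μ a ρ : ℝ} (hμ : 0 < μ) (ha : 0 < a) (hρ : 0 < ρ)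
    (haμ : a ≤ μ ^ 2 / (4 * M))
    (hμcrit : ∀ z ∈ critSet g Y' x, ∀ c, IsEigenvalue (hessYY g x z) c → μ ≤ |c|)
    (hacrit : ∀ z ∈ Y, ENNReal.ofReal (μ / (2 * M)) < Metric.infEDist z (critSet g Y' x) →
      a ≤ ‖gradY g x z‖)
    (hK1 : 256 * (g0 - gLow) * √M / 9 / a ^ (3 / 2 : ℝ) < K)
    (hK2 : 768 * (g0 - gLow) * M ^ 2 / μ ^ 3 < K)
    (hK3 : 256 * (g0 - gLow) * √M / 9 / (μ * ρ) ^ (3 / 2 : ℝ) < K) :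
    ∃ z, Tendsto y atTop (𝓝 z) ∧ ‖yhat - z‖ ≤ ρ ∧ g x z ≤ g x y0 ∧ g x yhat ≤ g x y0 := by
  have hM := hstd.M_pos
  have hg := hstd.g_smooth
  have hφ := hasFDerivAt_g hg x
  have hG := hasFDerivAt_gradY hg x
  have hsymm := hessYY_symm hg x
  have hH : ∀ y y', ‖hessYY g x y - hessYY g x y'‖ ≤ M * ‖y - y'‖ := fun y y' => by
    have := hstd.hess_lipschitz x hx x hx y y'
    simpa [Real.sqrt_sq] using this
  have hs : ∀ k, IsCubicMin (gradY g x (y k)) (hessYY g x (y k)) M (y (k + 1) - y k) :=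
    fun k t => hy.2 k t
  set D := g0 - gLow with hDdef
  have hD0 : 0 ≤ D := by
    have h1 := hstd.g_lower x hx y0
    have h2 := hstd.g0_upper x hx
    rw [hDdef]; linarith
  have hKpos : 0 < K := by
    have h1 : 0 ≤ 768 * D * M ^ 2 / μ ^ 3 := by positivity
    have : (0 : ℝ) < K := h1.trans_lt hK2
    exact_mod_cast this
  have hanti := antitone_of_cubicMin hφ hG hM.le hH hsymm hs
  have hDK : g x (y 0) - g x (y K) ≤ D := by
    have h1 := hstd.g_lower x hx (y K)
    have h2 := hstd.g0_upper x hx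
    rw [hy.1, hDdef]; linarith
  obtain ⟨j, hjK, hj⟩ := exists_step_le_of_cubicMin hφ hG hM.le hH hsymm hs K hDK hKpos
  obtain ⟨k, hkK, rfl, hkbest⟩ := hout
  set ν := stationarityMeasure g M x (y k) with hνdef
  have hν0 : 0 ≤ ν := (Real.sqrt_nonneg _).trans (le_max_left _ _)
  have hνs : ν ≤ ‖y (j + 1) - y j‖ := by
    refine (hkbest (j + 1) hjK).trans (max_le ?_ ?_)
    · refine Real.sqrt_le_iff.2 ⟨norm_nonneg _, ?_⟩
      have := ((hs j).step hφ hG hM.le hH hsymm).2.1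
      rw [add_sub_cancel] at this
      rw [one_div, inv_mul_le_iff₀ hM]
      exact this
    · have h1 := ((hs j).step hφ hG hM.le hH hsymm).2.2
      rw [add_sub_cancel] at h1
      have h2 := le_minEigenvalue (by
        have : 0 ≤ 3 / 2 * M * ‖y (j + 1) - y j‖ := by positivity
        linarith) h1
      calc -(2 / (3 * M)) * minEigenvalue (hessYY g x (y (j + 1)))
          = 2 / (3 * M) * (-minEigenvalue (hessYY g x (y (j + 1)))) := by ring
        _ ≤ 2 / (3 * M) * (3 / 2 * M * ‖y (j + 1) - y j‖) := by gcongr; linarith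
        _ = _ := by field_simp
  have hν3 : M * K * ν ^ 3 ≤ 12 * D := le_trans (by gcongr) hj
  have hGν : ‖gradY g x (y k)‖ ≤ M * ν ^ 2 := by
    have h1 : √(1 / M * ‖gradY g x (y k)‖) ≤ ν := le_max_left _ _
    have h2 := (Real.sqrt_le_iff.1 h1).2
    rwa [one_div, inv_mul_le_iff₀ hM] at h2
  have hGa := hGν.trans (mul_sq_le_of_lt_nat hM ha hν3 hK1 hν0)
  have hGρ := hGν.trans (mul_sq_le_of_lt_nat hM (by positivity) hν3 hK3 hν0)
  have hνμ : 4 * M * ν < μ := by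
    by_contra! hcon
    rw [div_lt_iff₀ (by positivity)] at hK2
    have h1 : μ ^ 3 ≤ (4 * M * ν) ^ 3 := pow_le_pow_left₀ hμ.le hcon 3
    have h2 : K * μ ^ 3 ≤ K * (4 * M * ν) ^ 3 := by gcongr
    have h3 : K * (4 * M * ν) ^ 3 = 64 * M ^ 2 * (M * K * ν ^ 3) := by ring
    have h4 : 64 * M ^ 2 * (M * K * ν ^ 3) ≤ 64 * M ^ 2 * (12 * D) := by gcongr
    linarith
  have hmin : -(3 / 8 * μ) ≤ minEigenvalue (hessYY g x (y k)) := by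
    have h1 : -(2 / (3 * M)) * minEigenvalue (hessYY g x (y k)) ≤ ν := le_max_right _ _
    have h2 : -(minEigenvalue (hessYY g x (y k))) ≤ 3 / 2 * M * ν := by
      calc -(minEigenvalue (hessYY g x (y k)))
          = 3 / 2 * M * (-(2 / (3 * M)) * minEigenvalue (hessYY g x (y k))) := by field_simp
        _ ≤ _ := by gcongr
    linarith
  have hsub : ∀ i, g x (y i) ≤ g x y0 := fun i => by
    have := hanti (Nat.zero_le i)
    simpa [hy.1] using this
  have hyY : y k ∈ Y := hstd.sublevel_subset x hx (hsub k)
  have hclose : Metric.infEDist (y k) (critSet g Y' x) ≤ ENNReal.ofReal (μ / (2 * M)) := by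
    by_contra! hcon
    have := hacrit (y k) hyY hcon
    linarith
  have hne : (critSet g Y' x).Nonempty := by
    by_contra hcon
    rw [Set.not_nonempty_iff_eq_empty] at hcon
    simp [hcon] at hclose
  have hcomp : IsCompact (critSet g Y' x) :=
    hY'.inter_right (isClosed_eq (contDiff_gradY_slice hg x).continuous continuous_const)
  obtain ⟨z, hz, hzd⟩ := hcomp.exists_infEDist_eq_edist hne (y k)
  rw [hzd, edist_dist, ENNReal.ofReal_le_ofReal_iff (by positivity), dist_eq_norm] at hclose
  have hzH : ∀ e, μ * ‖e‖ ^ 2 ≤ inner ℝ (hessYY g x z e) e := by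
    refine fun e => mul_norm_sq_le_inner_of_eigenvalue_ge (isSymmetric_hessYY hg x z) ?_ e
    intro c hc
    have h1 := hμcrit z hz c hc
    obtain ⟨e, he, hce⟩ := IsEigenvalue.exists_unit (H := hessYY g x z) hc
    have h2 := minEigenvalue_mul_le (isSymmetric_hessYY hg x (y k)) e
    have h3 : |inner ℝ ((hessYY g x (y k) - hessYY g x z) e) e| ≤ M * ‖y k - z‖ := by
      refine (abs_real_inner_le_norm _ _).trans ?_
      calc _ ≤ (‖hessYY g x (y k) - hessYY g x z‖ * ‖e‖) * ‖e‖ := by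
            gcongr; exact ContinuousLinearMap.le_opNorm _ _
        _ ≤ (M * ‖y k - z‖ * ‖e‖) * ‖e‖ := by gcongr; exact hH _ _
        _ = _ := by rw [he]; ring
    rw [_root_.sub_apply, inner_sub_left, hce, real_inner_smul_left,
      real_inner_self_eq_norm_sq, he] at h3
    rw [he] at h2
    have h4 : M * ‖y k - z‖ ≤ μ / 2 := by
      calc _ ≤ M * (μ / (2 * M)) := by gcongr
        _ = _ := by field_simp
    have h5 := (abs_le.1 h3).2
    -- The Hessian changes by at most `μ/2` between the output and `z`, so `c ≥ -3/8 μ - 1/2 μ >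
    -- -μ`. The spectral gap at `z` leaves only `c ≥ μ`.
    rcases le_abs'.1 h1 with h | h
    · linarith
    · exact h
  have hGk : ‖gradY g x (y k)‖ ≤ 9 / 64 * (μ ^ 2 / M) := by
    refine hGa.trans ?_
    calc 9 / 16 * a ≤ 9 / 16 * (μ ^ 2 / (4 * M)) := by gcongr
      _ = _ := by field_simp; norm_num
  have hlim := tendsto_of_cubicMin hφ hG hM hH hsymm hs hμ hz.2 hzH hclose hGk
  refine ⟨z, hlim, ?_, ?_, hsub k⟩
  · have h1 := norm_sub_le_of_strongMin hG hM hH hz.2 hzH hclose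
    have h2 : μ * ‖y k - z‖ ≤ μ * ρ := by
      have : 0 < μ * ρ := by positivity
      linarith
    exact le_of_mul_le_mul_left h2 hμ
  · exact le_of_tendsto (((contDiff_slice hg x).continuous.tendsto z).comp hlim)
      (Eventually.of_forall hsub)

/-! ### Fold points -/

section Fold

variable {n m : ℕ} {g : Euc n → Euc m → ℝ}

lemma iteratedFDeriv_three_eq (hg : ContDiff ℝ ((⊤ : ℕ∞) : WithTop ℕ∞) (Function.uncurry g))
    (x : Euc n) (y v : Euc m) :
    iteratedFDeriv ℝ 3 (g x) y (fun _ => v) = inner ℝ (fderiv ℝ (hessYY g x) y v v) v := by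
  have hgx := contDiff_slice hg x
  have h1 : iteratedFDeriv ℝ 3 (g x) y (fun _ => v)
      = fderiv ℝ (iteratedFDeriv ℝ 2 (g x)) y v (fun _ => v) := by
    rw [iteratedFDeriv_succ_apply_left]; rfl
  have hd2 : HasFDerivAt (iteratedFDeriv ℝ 2 (g x)) (fderiv ℝ (iteratedFDeriv ℝ 2 (g x)) y) y :=
    (hgx.differentiable_iteratedFDeriv (m := 2) (WithTop.coe_lt_coe.2 (ENat.natCast_lt_top 2)) y).hasFDerivAt
  have h2 : HasFDerivAt (fun y' => iteratedFDeriv ℝ 2 (g x) y' (fun _ => v))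
      ((ContinuousMultilinearMap.apply ℝ (fun _ : Fin 2 => Euc m) ℝ (fun _ => v)).comp
        (fderiv ℝ (iteratedFDeriv ℝ 2 (g x)) y)) y :=
    (ContinuousMultilinearMap.apply ℝ (fun _ : Fin 2 => Euc m) ℝ (fun _ => v)).hasFDerivAt.comp y hd2
  have h3 : (fun y' => iteratedFDeriv ℝ 2 (g x) y' (fun _ => v))
      = fun y' => inner ℝ (hessYY g x y' v) v := by
    ext y'
    rw [iteratedFDeriv_two_apply, inner_hessYY hg]
  have hh : HasFDerivAt (hessYY g x) (fderiv ℝ (hessYY g x) y) y := by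
    have : ContDiff ℝ ((⊤ : ℕ∞) : WithTop ℕ∞) (hessYY g x) :=
      (contDiff_hessYY hg).comp (contDiff_const.prodMk contDiff_id)
    exact (this.differentiable (by simp) y).hasFDerivAt
  have h4 : HasFDerivAt (fun y' => inner ℝ (hessYY g x y' v) v)
      ((innerSL ℝ v).comp ((ContinuousLinearMap.apply ℝ (Euc m) v).comp
        (fderiv ℝ (hessYY g x) y))) y := by
    have := (innerSL ℝ v).hasFDerivAt.comp y
      ((ContinuousLinearMap.apply ℝ (Euc m) v).hasFDerivAt.comp y hh)
    refine this.congr_of_eventuallyEq (Eventually.of_forall fun y' => ?_)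
    simp [real_inner_comm]
  rw [h3] at h2
  have := congrArg (fun L => L v) (h2.unique h4)
  simp only [ContinuousLinearMap.comp_apply, ContinuousMultilinearMap.apply_apply,
    innerSL_apply_apply, ContinuousLinearMap.apply_apply] at this
  rw [h1, this, real_inner_comm]

lemma inner_crossGrad (hg : ContDiff ℝ ((⊤ : ℕ∞) : WithTop ℕ∞) (Function.uncurry g))
    (x : Euc n) (y v : Euc m) (p : Euc n) :
    inner ℝ (crossGrad g x y v) p
      = inner ℝ (fderiv ℝ (fun p : Euc n × Euc m => gradY g p.1 p.2) (x, y) (p, 0)) v := by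
  have ha : HasFDerivAt (fun p : Euc n × Euc m => gradY g p.1 p.2)
      (fderiv ℝ (fun p : Euc n × Euc m => gradY g p.1 p.2) (x, y)) (x, y) :=
    ((contDiff_gradY hg).differentiable (by simp) (x, y)).hasFDerivAt
  have hx : HasFDerivAt (fun x' : Euc n => (x', y)) (ContinuousLinearMap.inl ℝ (Euc n) (Euc m)) x :=
    hasFDerivAt_prodMk_left x y
  have h1 : HasFDerivAt (fun x' => inner ℝ (gradY g x' y) v)
      ((innerSL ℝ v).comp ((fderiv ℝ (fun p : Euc n × Euc m => gradY g p.1 p.2) (x, y)).comp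
        (ContinuousLinearMap.inl ℝ (Euc n) (Euc m)))) x := by
    have := (innerSL ℝ v).hasFDerivAt.comp x (ha.comp x hx)
    refine this.congr_of_eventuallyEq (Eventually.of_forall fun y' => ?_)
    simp [real_inner_comm]
  have h2 : inner ℝ (crossGrad g x y v) p = fderiv ℝ (fun x' => inner ℝ (gradY g x' y) v) x p := by
    have := (InnerProductSpace.toDual ℝ (Euc n)).apply_symm_apply
      (fderiv ℝ (fun x' => inner ℝ (gradY g x' y) v) x)
    rw [← this]; rfl
  rw [h2, h1.fderiv]
  simp [real_inner_comm]

lemma fderiv_gradY_inr (hg : ContDiff ℝ ((⊤ : ℕ∞) : WithTop ℕ∞) (Function.uncurry g))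
    (x : Euc n) (y e : Euc m) :
    fderiv ℝ (fun p : Euc n × Euc m => gradY g p.1 p.2) (x, y) (0, e) = hessYY g x y e := by
  have ha : HasFDerivAt (fun p : Euc n × Euc m => gradY g p.1 p.2)
      (fderiv ℝ (fun p : Euc n × Euc m => gradY g p.1 p.2) (x, y)) (x, y) :=
    ((contDiff_gradY hg).differentiable (by simp) (x, y)).hasFDerivAt
  have h1 := ha.comp y (hasFDerivAt_prodMk_right x y)
  exact (congrArg (fun L => L e) (h1.unique (hasFDerivAt_gradY hg x y)))

lemma fderiv_hessYY_inr (hg : ContDiff ℝ ((⊤ : ℕ∞) : WithTop ℕ∞) (Function.uncurry g))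
    (x : Euc n) (y e : Euc m) :
    fderiv ℝ (fun p : Euc n × Euc m => hessYY g p.1 p.2) (x, y) (0, e)
      = fderiv ℝ (hessYY g x) y e := by
  have ha : HasFDerivAt (fun p : Euc n × Euc m => hessYY g p.1 p.2)
      (fderiv ℝ (fun p : Euc n × Euc m => hessYY g p.1 p.2) (x, y)) (x, y) :=
    ((contDiff_hessYY hg).differentiable (by simp) (x, y)).hasFDerivAt
  have h1 := ha.comp y (hasFDerivAt_prodMk_right x y)
  exact (congrArg (fun L => L e) h1.fderiv).symm

/-- The bordered system whose solutions with `s = 0` are the degenerate stationary points. -/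
noncomputable def borderedMap (g : Euc n → Euc m → ℝ) (v : Euc m)
    (q : Euc n × Euc m × Euc m × ℝ) : Euc n × Euc m × Euc m × ℝ :=
  (q.1, gradY g q.1 q.2.1 - q.2.2.2 • v, hessYY g q.1 q.2.1 q.2.2.1, inner ℝ v q.2.2.1 - 1)

lemma contDiff_borderedMap (hg : ContDiff ℝ ((⊤ : ℕ∞) : WithTop ℕ∞) (Function.uncurry g))
    (v : Euc m) : ContDiff ℝ ((⊤ : ℕ∞) : WithTop ℕ∞) (borderedMap g v) := by
  have h1 : ContDiff ℝ ((⊤ : ℕ∞) : WithTop ℕ∞)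
      (fun q : Euc n × Euc m × Euc m × ℝ => gradY g q.1 q.2.1) :=
    (contDiff_gradY hg).comp (contDiff_fst.prodMk (contDiff_fst.comp contDiff_snd))
  have h2 : ContDiff ℝ ((⊤ : ℕ∞) : WithTop ℕ∞)
      (fun q : Euc n × Euc m × Euc m × ℝ => hessYY g q.1 q.2.1) :=
    (contDiff_hessYY hg).comp (contDiff_fst.prodMk (contDiff_fst.comp contDiff_snd))
  unfold borderedMap
  refine contDiff_fst.prodMk ((h1.sub ?_).prodMk ((h2.clm_apply (by fun_prop)).prodMk ?_))
  · fun_prop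
  · exact ((innerSL ℝ v).contDiff.comp
      (contDiff_fst.comp (contDiff_snd.comp contDiff_snd))).sub contDiff_const

lemma fderiv_borderedMap (hg : ContDiff ℝ ((⊤ : ℕ∞) : WithTop ℕ∞) (Function.uncurry g))
    (x : Euc n) (y v : Euc m) (p : Euc n) (η υ : Euc m) (σ : ℝ) :
    fderiv ℝ (borderedMap g v) (x, y, v, 0) (p, η, υ, σ) =
      (p, fderiv ℝ (fun p : Euc n × Euc m => gradY g p.1 p.2) (x, y) (p, η) - σ • v,
        fderiv ℝ (fun p : Euc n × Euc m => hessYY g p.1 p.2) (x, y) (p, η) v + hessYY g x y υ,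
        inner ℝ v υ) := by
  set q0 : Euc n × Euc m × Euc m × ℝ := (x, y, v, 0) with hq0
  have ha : HasFDerivAt (fun p : Euc n × Euc m => gradY g p.1 p.2)
      (fderiv ℝ (fun p : Euc n × Euc m => gradY g p.1 p.2) (x, y)) (x, y) :=
    ((contDiff_gradY hg).differentiable (by simp) (x, y)).hasFDerivAt
  have hA : HasFDerivAt (fun p : Euc n × Euc m => hessYY g p.1 p.2)
      (fderiv ℝ (fun p : Euc n × Euc m => hessYY g p.1 p.2) (x, y)) (x, y) :=
    ((contDiff_hessYY hg).differentiable (by simp) (x, y)).hasFDerivAt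
  have h0 : HasFDerivAt (fun q : Euc n × Euc m × Euc m × ℝ => (q.1, q.2.1)) _ q0 :=
    (hasFDerivAt_fst (𝕜 := ℝ)).prodMk (hasFDerivAt_fst.comp q0 hasFDerivAt_snd)
  have hu : HasFDerivAt (fun q : Euc n × Euc m × Euc m × ℝ => q.2.2.1) _ q0 :=
    (hasFDerivAt_fst (𝕜 := ℝ)).comp q0 (hasFDerivAt_snd.comp q0 hasFDerivAt_snd)
  have hs : HasFDerivAt (fun q : Euc n × Euc m × Euc m × ℝ => q.2.2.2) _ q0 :=
    (hasFDerivAt_snd (𝕜 := ℝ)).comp q0 (hasFDerivAt_snd.comp q0 hasFDerivAt_snd)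
  have ha' := HasFDerivAt.comp (g := fun p : Euc n × Euc m => gradY g p.1 p.2) q0 ha h0
  have hA' := HasFDerivAt.comp (g := fun p : Euc n × Euc m => hessYY g p.1 p.2) q0 hA h0
  have hv : HasFDerivAt (fun q : Euc n × Euc m × Euc m × ℝ => inner ℝ v q.2.2.1) _ q0 :=
    (innerSL ℝ v).hasFDerivAt.comp q0 hu
  have main := (hasFDerivAt_fst (𝕜 := ℝ) (p := q0)).prodMk
    ((ha'.sub (hs.smul_const v)).prodMk ((hA'.clm_apply hu).prodMk (hv.sub_const 1)))
  have heq : borderedMap g v = fun q : Euc n × Euc m × Euc m × ℝ => (q.1,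
    ((fun p : Euc n × Euc m => gradY g p.1 p.2) ∘ (fun q : Euc n × Euc m × Euc m × ℝ => (q.1, q.2.1))
      - fun q : Euc n × Euc m × Euc m × ℝ => q.2.2.2 • v) q, 
    ((fun p : Euc n × Euc m => hessYY g p.1 p.2) ∘ (fun q : Euc n × Euc m × Euc m × ℝ => (q.1, q.2.1))) q
      q.2.2.1, inner ℝ v q.2.2.1 - 1) := rfl
  rw [heq, main.fderiv]
  simp [hq0, add_comm]

lemma IsFold.eq_smul_of_hessYY_eq_zero {x : Euc n} {y v : Euc m} (hf : IsFold g x y)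
    (hv : ‖v‖ = 1) (hHv : hessYY g x y v = 0) {e : Euc m} (he : hessYY g x y e = 0) :
    e = (inner ℝ v e) • v := by
  have hv0 : (⟨v, hHv⟩ : LinearMap.ker (hessYY g x y : Euc m →ₗ[ℝ] Euc m)) ≠ 0 := by
    intro h
    have : v = 0 := congrArg Subtype.val h
    rw [this, norm_zero] at hv
    exact zero_ne_one hv
  obtain ⟨c, hc⟩ := (finrank_eq_one_iff_of_nonzero' _ hv0).1 hf.simple_zero ⟨e, he⟩
  have hc' : c • v = e := congrArg Subtype.val hc
  rw [← hc', real_inner_smul_right, real_inner_self_eq_norm_sq, hv]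
  simp

/-- Pairing the gradient row with `v` removes the symmetric Hessian term and gives `σ = 0`, so `η =
c v`. Pairing the Hessian row with `v` leaves `c` times the third derivative along `v`, and the
cubic condition gives `c = 0`. What remains is `υ` in the kernel and orthogonal to `v`, hence zero.
-/
lemma IsFold.injective_fderiv_borderedMap
    (hg : ContDiff ℝ ((⊤ : ℕ∞) : WithTop ℕ∞) (Function.uncurry g)) {x : Euc n} {y v : Euc m}
    (hf : IsFold g x y) (hv : ‖v‖ = 1) (hHv : hessYY g x y v = 0) :
    Function.Injective (fderiv ℝ (borderedMap g v) (x, y, v, 0)) := by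
  rw [injective_iff_map_eq_zero]
  rintro ⟨p, η, υ, σ⟩ h
  rw [fderiv_borderedMap hg] at h
  simp only [Prod.mk_eq_zero] at h
  obtain ⟨rfl, h2, h3, h4⟩ := h
  rw [fderiv_gradY_inr hg] at h2
  rw [fderiv_hessYY_inr hg] at h3
  have hker : ∀ e, inner ℝ v (hessYY g x y e) = 0 := fun e => by
    rw [← hessYY_symm hg, hHv, inner_zero_left]
  have hσ : σ = 0 := by
    have := congrArg (inner ℝ v) h2
    rw [inner_sub_right, hker, real_inner_smul_right, real_inner_self_eq_norm_sq, hv,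
      inner_zero_right] at this
    linarith
  subst hσ
  rw [zero_smul, sub_zero] at h2
  have hη := hf.eq_smul_of_hessYY_eq_zero hv hHv h2
  set c := inner ℝ v η
  have hc : c = 0 := by
    have := congrArg (inner ℝ v) h3
    rw [inner_add_right, hker, inner_zero_right, add_zero, hη, map_smul, _root_.smul_apply,
      real_inner_smul_right, real_inner_comm, ← iteratedFDeriv_three_eq hg] at this
    exact (mul_eq_zero.1 this).resolve_right (hf.cubic v hv hHv)
  rw [hc, zero_smul] at hη
  subst hη
  rw [map_zero, _root_.zero_apply, zero_add] at h3
  have hυ := hf.eq_smul_of_hessYY_eq_zero hv hHv h3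
  rw [h4, zero_smul] at hυ
  subst hυ
  rfl

/-- The rank-one correction `T + v ⟨v, ·⟩` is injective and agrees with `T` on the complement of
`v`; its antilipschitz constant provides `c`. -/
lemma exists_mul_norm_sub_proj_le {E : Type*} [NormedAddCommGroup E] [InnerProductSpace ℝ E]
    [FiniteDimensional ℝ E] {T : E →L[ℝ] E} (hT : ∀ u v, inner ℝ (T u) v = inner ℝ u (T v)) {v : E}
    (hv : ‖v‖ = 1) (hTv : T v = 0) (hker : ∀ e, T e = 0 → e = (inner ℝ v e : ℝ) • v) :
    ∃ c : ℝ, 0 < c ∧ ∀ e, c * ‖e - (inner ℝ v e : ℝ) • v‖ ≤ ‖T e‖ := by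
  set S : E →L[ℝ] E := T + (innerSL ℝ v).smulRight v with hS
  have hSapp : ∀ e, S e = T e + (inner ℝ v e : ℝ) • v := fun e => rfl
  have hinj : LinearMap.ker (S : E →ₗ[ℝ] E) = ⊥ := by
    rw [LinearMap.ker_eq_bot']
    intro e he
    have he' : T e + (inner ℝ v e : ℝ) • v = 0 := he
    have h1 := congrArg (inner ℝ v) he'
    rw [inner_add_right, ← hT, hTv, inner_zero_left, zero_add, real_inner_smul_right,
      real_inner_self_eq_norm_sq, hv, inner_zero_right] at h1
    have h2 : (inner ℝ v e : ℝ) = 0 := by linarith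
    rw [h2, zero_smul, add_zero] at he'
    rw [hker e he', h2, zero_smul]
  obtain ⟨K, hK, hanti⟩ := LinearMap.exists_antilipschitzWith (S : E →ₗ[ℝ] E) hinj
  refine ⟨(K : ℝ)⁻¹, by positivity, fun e => ?_⟩
  have h1 := hanti.le_mul_dist (e - (inner ℝ v e : ℝ) • v) 0
  rw [dist_zero_right, map_zero, dist_zero_right] at h1
  have h2 : (S : E →ₗ[ℝ] E) (e - (inner ℝ v e : ℝ) • v) = T e := by
    change S (e - (inner ℝ v e : ℝ) • v) = T e
    rw [hSapp, map_sub, map_smul, hTv, inner_sub_right, real_inner_smul_right,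
      real_inner_self_eq_norm_sq, hv]
    simp
  rw [h2] at h1
  rw [inv_mul_le_iff₀ (by positivity)]
  exact h1

lemma det_eq_zero_of_apply_eq_zero {T : Euc m →L[ℝ] Euc m} {e : Euc m} (he : e ≠ 0)
    (hT : T e = 0) : LinearMap.det (T : Euc m →ₗ[ℝ] Euc m) = 0 := by
  by_contra h
  have := (LinearMap.equivOfDetNeZero _ h).injective
  apply he
  apply this
  rw [map_zero]
  exact hT

/-- The gradient at `y` is expanded about `ys` and paired with `us`. The linear term vanishes
because `us` is in the kernel of the symmetric Hessian at `ys`, and `⟨ss v, us⟩ = ss`; so `|ss| ≤ 2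
‖∇g‖ + M ‖y - ys‖²`. In the square of the distance bound, `‖∇g‖ ≤ 1` reduces `‖∇g‖²` to `‖∇g‖`,
while `a` keeps its square. This quadratic gain is the source of the `√δ` behaviour of `μ(δ)`. -/
lemma unfolding_le_of_close (hg : ContDiff ℝ ((⊤ : ℕ∞) : WithTop ℕ∞) (Function.uncurry g))
    {x : Euc n} {M : ℝ} (hM : 0 < M)
    (hH : ∀ y y', ‖hessYY g x y - hessYY g x y'‖ ≤ M * ‖y - y'‖) {y ys us v : Euc m} {ss a K : ℝ}
    (h1 : gradY g x ys = ss • v) (h2 : hessYY g x ys us = 0) (h3 : inner ℝ v us = (1 : ℝ))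
    (h4 : ‖us‖ ≤ 2) (h5 : ‖gradY g x y‖ ≤ 1) (h6 : ‖y - ys‖ ≤ K * (‖gradY g x y‖ + 2 * |a|)) :
    |ss| ≤ (2 + 8 * M * K ^ 2) * (‖gradY g x y‖ + a ^ 2) := by
  have htay := norm_gradient_taylor_le (hasFDerivAt_gradY hg x) hH ys (y - ys)
  rw [add_sub_cancel, h1] at htay
  have h9 : |inner ℝ (gradY g x y - ss • v - hessYY g x ys (y - ys)) us|
      ≤ M / 2 * ‖y - ys‖ ^ 2 * 2 :=
    (abs_real_inner_le_norm _ _).trans (by gcongr)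
  rw [inner_sub_left, inner_sub_left, hessYY_symm hg, h2, inner_zero_right, sub_zero,
    real_inner_smul_left, h3, mul_one] at h9
  have h10 : |inner ℝ (gradY g x y) us| ≤ ‖gradY g x y‖ * 2 :=
    (abs_real_inner_le_norm _ _).trans (by gcongr)
  have hgn := norm_nonneg (gradY g x y)
  have h11 : (‖gradY g x y‖ + 2 * |a|) ^ 2 ≤ 2 * ‖gradY g x y‖ + 8 * a ^ 2 := by
    rw [← sq_abs a]
    nlinarith [sq_nonneg (‖gradY g x y‖ - 2 * |a|)]
  have h12 : ‖y - ys‖ ^ 2 ≤ K ^ 2 * (2 * ‖gradY g x y‖ + 8 * a ^ 2) := by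
    calc ‖y - ys‖ ^ 2 ≤ (K * (‖gradY g x y‖ + 2 * |a|)) ^ 2 :=
          pow_le_pow_left₀ (norm_nonneg _) h6 2
      _ = K ^ 2 * (‖gradY g x y‖ + 2 * |a|) ^ 2 := by ring
      _ ≤ _ := mul_le_mul_of_nonneg_left h11 (sq_nonneg _)
  have h13 := mul_le_mul_of_nonneg_left h12 hM.le
  have h15 : 0 ≤ M * K ^ 2 * ‖gradY g x y‖ := by positivity
  have h16 := sq_nonneg a
  have h17 := abs_le.1 h9
  have h18 := abs_le.1 h10
  rw [abs_le]
  constructor <;> linarith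

/-- Near a fold point, the degenerate stationary points are resolved by a scalar function `s`. -/
lemma IsFold.exists_unfolding (hg : ContDiff ℝ ((⊤ : ℕ∞) : WithTop ℕ∞) (Function.uncurry g))
    {xb : Euc n} {yb v : Euc m} (hf : IsFold g xb yb) (hv : ‖v‖ = 1) (hHv : hessYY g xb yb v = 0)
    {X : Set (Euc n)} {M : ℝ} (hM : 0 < M)
    (hH : ∀ x ∈ X, ∀ y y', ‖hessYY g x y - hessYY g x y'‖ ≤ M * ‖y - y'‖) :
    ∃ s : Euc n → ℝ, HasStrictFDerivAt s (innerSL ℝ (crossGrad g xb yb v)) xb ∧ s xb = 0 ∧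
      (∀ᶠ x in 𝓝 xb, s x = 0 → ∃ y, IsDegenerateStationary g x y) ∧
      ∃ C : ℝ, 0 < C ∧ ∀ᶠ p : Euc n × Euc m in 𝓝 (xb, yb), p.1 ∈ X → ∀ (a : ℝ) (e : Euc m),
        ‖e‖ = 1 → hessYY g p.1 p.2 e = a • e → |s p.1| ≤ C * (‖gradY g p.1 p.2‖ + a ^ 2) := by
  set q0 : Euc n × Euc m × Euc m × ℝ := (xb, yb, v, 0) with hq0
  have hinj := hf.injective_fderiv_borderedMap hg hv hHv
  let L : (Euc n × Euc m × Euc m × ℝ) ≃L[ℝ] (Euc n × Euc m × Euc m × ℝ) :=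
    (LinearEquiv.ofInjectiveEndo
      (fderiv ℝ (borderedMap g v) q0 : (Euc n × Euc m × Euc m × ℝ) →ₗ[ℝ] _) hinj).toContinuousLinearEquiv
  have hL : ∀ q, L q = fderiv ℝ (borderedMap g v) q0 q := fun q => rfl
  have hstrict : HasStrictFDerivAt (borderedMap g v)
      (L : (Euc n × Euc m × Euc m × ℝ) →L[ℝ] (Euc n × Euc m × Euc m × ℝ)) q0 := by
    have h1 := (contDiff_borderedMap hg v).contDiffAt.hasStrictFDerivAt (x := q0) (by simp)
    have h2 : (L : (Euc n × Euc m × Euc m × ℝ) →L[ℝ] (Euc n × Euc m × Euc m × ℝ))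
        = fderiv ℝ (borderedMap g v) q0 := 
      ContinuousLinearMap.ext hL
    rwa [h2]
  have himg : borderedMap g v q0 = (xb, 0) := by
    simp only [borderedMap, hq0, hf.stationary, hHv, real_inner_self_eq_norm_sq, hv]
    simp
  set J := hstrict.localInverse with hJ
  have hJstrict := hstrict.to_localInverse
  rw [himg] at hJstrict
  have hJ0 : J (xb, 0) = q0 := by
    rw [← himg]; exact hstrict.localInverse_apply_image
  have hright : ∀ᶠ q in 𝓝 ((xb, 0) : Euc n × Euc m × Euc m × ℝ), borderedMap g v (J q) = q := by
    rw [← himg]; exact hstrict.eventually_right_inverse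
  have hleft := hstrict.eventually_left_inverse
  let ι : Euc n →L[ℝ] (Euc n × Euc m × Euc m × ℝ) := ContinuousLinearMap.inl ℝ _ _
  have hι : ∀ x, ι x = (x, 0) := fun x => rfl
  have hιt : Tendsto ι (𝓝 xb) (𝓝 ((xb, 0) : Euc n × Euc m × Euc m × ℝ)) := ι.continuous.tendsto xb
  have hJι : HasStrictFDerivAt (fun x => J (ι x)) _ xb := HasStrictFDerivAt.comp xb
    (by rw [hι]; exact hJstrict) ι.hasStrictFDerivAt
  have hJc : Tendsto (fun x => J (ι x)) (𝓝 xb) (𝓝 q0) := by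
    have := hJι.continuousAt.tendsto
    rwa [hι, hJ0] at this
  -- `J (x, 0)` solves the bordered system over `x`: a point where `∇_y g = s v`, together with a
  -- kernel vector `u` of its Hessian normalized by `⟨v, u⟩ = 1`. The unfolding function is the
  -- multiplier `s`.
  refine ⟨fun x => (J (ι x)).2.2.2, ?_, ?_, ?_, ?_⟩
  · have h1 := ((hasStrictFDerivAt_snd (𝕜 := ℝ)).comp xb ((hasStrictFDerivAt_snd (𝕜 := ℝ)).comp xb
      ((hasStrictFDerivAt_snd (𝕜 := ℝ)).comp xb hJι)))
    refine h1.congr_fderiv ?_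
    ext1 p
    simp only [ContinuousLinearMap.comp_apply]
    set r := L.symm (ι p) with hr
    have hr' : L r = ι p := L.apply_symm_apply _
    obtain ⟨p', η, υ, σ⟩ := r
    rw [hL, hq0, fderiv_borderedMap hg, hι] at hr'
    simp only [Prod.mk.injEq, Prod.mk_eq_zero] at hr'
    obtain ⟨rfl, h2, -⟩ := hr'
    have h3 : L.symm (ι p') = (p', η, υ, σ) := hr.symm
    change (L.symm (ι p')).2.2.2 = inner ℝ (crossGrad g xb yb v) p'
    rw [h3]
    change σ = _
    rw [inner_crossGrad hg]
    have h4 : ((p', η) : Euc n × Euc m) = (p', 0) + (0, η) := by simp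
    rw [h4, map_add, fderiv_gradY_inr hg] at h2
    -- Pairing with `v` annihilates the Hessian term and identifies the derivative `σ` of `s` with
    -- `⟨crossGrad, p'⟩`.
    have h5 := congrArg (fun z => inner ℝ z v) h2
    simp only [inner_sub_left, inner_add_left, real_inner_smul_left, real_inner_self_eq_norm_sq,
      hv, inner_zero_left, hessYY_symm hg, hHv, inner_zero_right] at h5
    linarith
  · simp only [hι, hJ0, hq0]
  · filter_upwards [hιt.eventually hright] with x hx hs
    simp only [borderedMap, hι, Prod.mk.injEq, Prod.mk_eq_zero] at hx
    obtain ⟨hx1, hx2, hx3, hx4⟩ := hx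
    rw [hι] at hs
    rw [hx1, hs, zero_smul, sub_zero] at hx2
    rw [hx1] at hx3
    refine ⟨_, hx2, det_eq_zero_of_apply_eq_zero (e := (J (x, 0)).2.2.1) ?_ hx3⟩
    intro h0
    rw [h0, inner_zero_right] at hx4
    norm_num at hx4
  · obtain ⟨c, hc, hcv⟩ := exists_mul_norm_sub_proj_le (T := hessYY g xb yb) (hessYY_symm hg xb yb) hv hHv
      (fun e he => hf.eq_smul_of_hessYY_eq_zero hv hHv he)
    obtain ⟨Kl, S, hS, hlip⟩ := hJstrict.exists_lipschitzOnWith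
    have hbt : Tendsto (borderedMap g v) (𝓝 q0) (𝓝 (xb, 0)) := by
      have := hstrict.continuousAt.tendsto
      rwa [himg] at this
    obtain ⟨ε, hε, hball⟩ := Metric.eventually_nhds_iff.1 (hleft.and (hbt.eventually hS))
    -- For `|a| < ε1` an eigenvector lies within `2 ε1 / c` of the line of `v`. The two entries make
    -- this at most `1/4`, so that `|⟨v, e⟩| ≥ 1/2`, and at most `ε/4`, so that the rescaled vector
    -- is in the domain of the local inverse.
    set ε1 : ℝ := min (c / 8) (c * ε / 8) with hε1
    have hε1pos : 0 < ε1 := by positivity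
    have ev1 : ∀ᶠ p : Euc n × Euc m in 𝓝 (xb, yb), ‖hessYY g p.1 p.2 - hessYY g xb yb‖ < ε1 := by
      have := (contDiff_hessYY hg).continuous.tendsto (xb, yb)
      have h2 := (tendsto_iff_norm_sub_tendsto_zero.1 this)
      exact h2.eventually (gt_mem_nhds hε1pos)
    have ev2 : ∀ᶠ p : Euc n × Euc m in 𝓝 (xb, yb), ‖gradY g p.1 p.2‖ < 1 := by
      have := (contDiff_gradY hg).continuous.norm.tendsto (xb, yb)
      refine this.eventually (gt_mem_nhds ?_)
      simp [hf.stationary]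
    have hfst : Tendsto (Prod.fst : Euc n × Euc m → Euc n) (𝓝 (xb, yb)) (𝓝 xb) :=
      continuous_fst.tendsto (xb, yb)
    have ev3 : ∀ᶠ p : Euc n × Euc m in 𝓝 (xb, yb), borderedMap g v (J (ι p.1)) = ι p.1 :=
      hfst.eventually (hιt.eventually hright)
    have ev4 : ∀ᶠ p : Euc n × Euc m in 𝓝 (xb, yb), ι p.1 ∈ S := hfst.eventually (hιt.eventually hS)
    have ev5 : ∀ᶠ p : Euc n × Euc m in 𝓝 (xb, yb), dist (J (ι p.1)) q0 < 1 :=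
      hfst.eventually (hJc.eventually (Metric.ball_mem_nhds q0 one_pos))
    have ev6 : ∀ᶠ p : Euc n × Euc m in 𝓝 (xb, yb), dist p (xb, yb) < ε :=
      Metric.ball_mem_nhds _ hε
    refine ⟨1 / ε1 ^ 2 + (2 + 8 * M * Kl ^ 2), by positivity, ?_⟩
    filter_upwards [ev1, ev2, ev3, ev4, ev5, ev6] with ⟨x, y⟩ h1 h2 h3 h4 h5 h6 hxX a e he hae
    simp only at h1 h2 h3 h4 h5 hxX hae ⊢
    have hsle : |(J (ι x)).2.2.2| ≤ 1 := by
      have : dist (J (ι x)).2.2.2 (0 : ℝ) ≤ dist (J (ι x)) q0 := by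
        simp only [Prod.dist_eq, hq0]
        exact (le_max_right _ _).trans ((le_max_right _ _).trans (le_max_right _ _))
      rw [Real.dist_eq, sub_zero] at this
      linarith
    have hunorm : ‖(J (ι x)).2.2.1‖ ≤ 2 := by
      have h7 : dist (J (ι x)).2.2.1 v ≤ dist (J (ι x)) q0 := by
        simp only [Prod.dist_eq, hq0]
        exact (le_max_left _ _).trans ((le_max_right _ _).trans (le_max_right _ _))
      rw [dist_eq_norm] at h7
      have h8 := norm_sub_norm_le (J (ι x)).2.2.1 v
      rw [hv] at h8
      linarith
    have hgn := norm_nonneg (gradY g x y)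
    -- Eigenvalues of modulus at least `ε1` need no geometry: `|s| ≤ 1 ≤ a² / ε1²`.
    by_cases hal : ε1 ≤ |a|
    · have h7 : 1 ≤ 1 / ε1 ^ 2 * a ^ 2 := by
        rw [one_div, ← sq_abs a, inv_mul_eq_div, one_le_div (by positivity)]
        exact pow_le_pow_left₀ hε1pos.le hal 2
      have h8 : 0 ≤ 1 / ε1 ^ 2 * ‖gradY g x y‖ := by positivity
      have h9 : 0 ≤ (2 + 8 * M * (Kl : ℝ) ^ 2) * (‖gradY g x y‖ + a ^ 2) := by positivity
      linarith
    · push Not at hal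
      set t : ℝ := inner ℝ v e with ht
      have hd : ‖e - t • v‖ ≤ 2 * ε1 / c := by
        rw [le_div_iff₀ hc, mul_comm]
        refine (hcv e).trans ?_
        have h7 : hessYY g xb yb e = a • e - (hessYY g x y - hessYY g xb yb) e := by
          rw [_root_.sub_apply, hae]; abel
        rw [h7]
        refine (norm_sub_le _ _).trans ?_
        have h8 := (hessYY g x y - hessYY g xb yb).le_opNorm e
        rw [he, mul_one] at h8
        rw [norm_smul, he, mul_one, Real.norm_eq_abs]
        linarith
      have hd1 : ‖e - t • v‖ ≤ 1 / 4 := hd.trans (by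
        rw [div_le_iff₀ hc]; linarith [min_le_left (c / 8) (c * ε / 8)])
      have hd2 : ‖e - t • v‖ ≤ ε / 4 := hd.trans (by
        rw [div_le_iff₀ hc]; linarith [min_le_right (c / 8) (c * ε / 8)])
      have htabs : 1 / 2 ≤ |t| := by
        have h7 := norm_sub_norm_le e (t • v)
        rw [norm_smul, hv, he, mul_one, Real.norm_eq_abs] at h7
        linarith
      have ht0 : t ≠ 0 := by intro h; rw [h, abs_zero] at htabs; linarith
      -- With `⟨v, u⟩ = 1`, the point `(x, y, u, 0)` solves the bordered system up to the residual
      -- `(∇_y g, a u)`. The Lipschitz local inverse turns this residual into a distance to the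
      -- exact solution over `x`.
      set u : Euc m := t⁻¹ • e with hu
      have htinv : |t⁻¹| ≤ 2 := by
        rw [abs_inv]
        exact inv_le_of_inv_le₀ (by norm_num) (by linarith)
      have huv : ‖u - v‖ ≤ ε / 2 := by
        have h7 : u - v = t⁻¹ • (e - t • v) := by
          rw [smul_sub, smul_smul, inv_mul_cancel₀ ht0, one_smul]
        rw [h7, norm_smul, Real.norm_eq_abs]
        calc |t⁻¹| * ‖e - t • v‖ ≤ 2 * (ε / 4) := by gcongr
          _ = _ := by ring
      set q : Euc n × Euc m × Euc m × ℝ := (x, y, u, 0) with hq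
      have hqd : dist q q0 < ε := by
        simp only [hq, hq0, Prod.dist_eq, max_lt_iff, dist_self] at h6 ⊢
        refine ⟨h6.1, h6.2, ?_, hε⟩
        rw [dist_eq_norm]; linarith
      obtain ⟨hq1, hq2⟩ := hball hqd
      have hbq : borderedMap g v q = (x, gradY g x y, (a * t⁻¹) • e, 0) := by
        simp only [borderedMap, hq, zero_smul, sub_zero, hu, map_smul, hae, real_inner_smul_right,
          ← ht, inv_mul_cancel₀ ht0, sub_self, smul_smul, mul_comm]
      have hdist := hlip.dist_le_mul _ hq2 _ h4
      rw [hq1] at hdist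
      change dist q (J (ι x)) ≤ _ at hdist
      have hdd : dist (borderedMap g v q) (ι x) ≤ ‖gradY g x y‖ + 2 * |a| := by
        rw [hbq, hι]
        have h0' : (0 : Euc m × Euc m × ℝ) = (0, 0, 0) := rfl
        rw [h0']
        simp only [Prod.dist_eq, dist_self, dist_zero_right,
          norm_smul, norm_mul, he, Real.norm_eq_abs, mul_one]
        have : |a| * |t⁻¹| ≤ |a| * 2 := by gcongr
        have h0 := abs_nonneg a
        have h00 : 0 ≤ |a| * |t⁻¹| := by positivity
        refine max_le (by positivity) (max_le (by linarith) (max_le ?_ (by positivity)))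
        linarith
      have hyd : ‖y - (J (ι x)).2.1‖ ≤ Kl * (‖gradY g x y‖ + 2 * |a|) := by
        rw [← dist_eq_norm]
        have h7 : dist y (J (ι x)).2.1 ≤ dist q (J (ι x)) := by
          simp only [Prod.dist_eq, hq]
          exact (le_max_left _ _).trans (le_max_right _ _)
        refine h7.trans (hdist.trans ?_)
        gcongr
      have h3' : borderedMap g v (J (ι x)) = (x, 0, 0, 0) := h3
      simp only [borderedMap, Prod.mk.injEq] at h3'
      obtain ⟨e1, e2, e3, e4⟩ := h3'
      rw [e1, sub_eq_zero] at e2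
      rw [e1] at e3
      have hfin := unfolding_le_of_close hg hM (hH x hxX) e2 e3 (by linarith) hunorm h2.le hyd
      have h14 : 0 ≤ 1 / ε1 ^ 2 * (‖gradY g x y‖ + a ^ 2) := by positivity
      linarith

end Fold

/-! ### Distance to the bifurcation set -/

section Regularity

variable {n m : ℕ} {g : Euc n → Euc m → ℝ}

lemma HasStrictFDerivAt.exists_ball {s : Euc n → ℝ} {w xb : Euc n}
    (hs : HasStrictFDerivAt s (innerSL ℝ w) xb) {ε : ℝ} (hε : 0 < ε) :
    ∃ r > 0, ∀ a ∈ Metric.ball xb r, ∀ b ∈ Metric.ball xb r,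
      |s a - s b - inner ℝ w (a - b)| ≤ ε * ‖a - b‖ := by
  have h := hs.isLittleO.bound hε
  rw [nhds_prod_eq, Metric.nhds_basis_ball.prod_self.eventually_iff] at h
  obtain ⟨r, hr, h⟩ := h
  exact ⟨r, hr, fun a ha b hb => h (Set.mk_mem_prod ha hb)⟩

/-- Along the segment from `x` towards `z` the function `s` falls at average rate at least `c/2`:
the linear part contributes `-3c/4` and the strict differentiability error at most `c/4`. It is
therefore nonpositive at time `2 s(x) / c`, the intermediate value theorem gives a zero, and
convexity keeps it in `X`. -/
lemma exists_zero_of_descent {X : Set (Euc n)} (hX : Convex ℝ X) {s : Euc n → ℝ} {w xb z : Euc n}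
    (hs : HasStrictFDerivAt s (innerSL ℝ w) xb) (hs0 : s xb = 0) (hz : z ∈ X)
    (hwz : inner ℝ w (z - xb) < 0) {V : Set (Euc n)} (hV : V ∈ 𝓝 xb) :
    ∃ C : ℝ, 0 < C ∧ ∀ᶠ x in 𝓝[X] xb, 0 ≤ s x →
      ∃ x' ∈ X, x' ∈ V ∧ s x' = 0 ∧ dist x x' ≤ C * s x := by
  set c := -inner ℝ w (z - xb) with hc
  have hc0 : 0 < c := by rw [hc]; linarith
  set R := ‖z - xb‖ + 1 with hR
  have hR0 : 0 < R := by positivity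
  obtain ⟨r1, hr1, hb1⟩ := HasStrictFDerivAt.exists_ball hs (ε := c / (4 * R)) (by positivity)
  obtain ⟨r2, hr2, hb2⟩ := Metric.mem_nhds_iff.1 hV
  obtain ⟨K, S, hS, hlip⟩ := hs.exists_lipschitzOnWith
  obtain ⟨r3, hr3, hb3⟩ := Metric.mem_nhds_iff.1 hS
  set r := min r1 (min r2 r3) with hr
  have hr0 : 0 < r := by positivity
  have hsc : Tendsto s (𝓝[X] xb) (𝓝 0) := by
    have := hs.continuousAt.tendsto
    rw [hs0] at this
    exact this.mono_left nhdsWithin_le_nhds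
  have ev1 : ∀ᶠ x in 𝓝[X] xb, s x < min (c / 2) (c * r / (4 * R)) :=
    hsc.eventually (gt_mem_nhds (by positivity))
  have ev2 : ∀ᶠ x in 𝓝[X] xb, dist x xb < min (min (r / 2) 1) (c / (4 * (‖w‖ + 1))) :=
    nhdsWithin_le_nhds (Metric.ball_mem_nhds xb (by positivity))
  refine ⟨2 * R / c, by positivity, ?_⟩
  filter_upwards [ev1, ev2, self_mem_nhdsWithin] with x h1 h2 hx hsx
  rw [lt_min_iff] at h1 h2
  rw [lt_min_iff] at h2
  rw [dist_eq_norm] at h2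
  obtain ⟨⟨h2a, h2b⟩, h2c⟩ := h2
  have hzx : ‖z - x‖ ≤ R := by
    have : z - x = (z - xb) - (x - xb) := by abel
    rw [this]
    refine (norm_sub_le _ _).trans ?_
    rw [hR]; linarith
  set τ0 : ℝ := 2 * s x / c with hτ0
  have hτ0n : 0 ≤ τ0 := by positivity
  have hτ01 : τ0 ≤ 1 := by rw [hτ0, div_le_one hc0]; linarith
  have hτ0r : τ0 * R < r / 2 := by
    have := h1.2
    rw [lt_div_iff₀ (by positivity)] at this
    rw [hτ0, div_mul_eq_mul_div, div_lt_iff₀ hc0]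
    linarith
  have hball : ∀ τ ∈ Set.Icc 0 τ0, x + τ • (z - x) ∈ Metric.ball xb r := by
    intro τ hτ
    rw [mem_ball_iff_norm]
    have : x + τ • (z - x) - xb = (x - xb) + τ • (z - x) := by abel
    rw [this]
    refine (norm_add_le _ _).trans_lt ?_
    rw [norm_smul, Real.norm_of_nonneg hτ.1]
    have : τ * ‖z - x‖ ≤ τ0 * R := mul_le_mul hτ.2 hzx (norm_nonneg _) hτ0n
    linarith
  have hcont : ContinuousOn (fun τ : ℝ => s (x + τ • (z - x))) (Set.Icc 0 τ0) := by
    refine hlip.continuousOn.comp (by fun_prop) fun τ hτ => hb3 ?_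
    exact Metric.ball_subset_ball ((min_le_right _ _).trans (min_le_right _ _)) (hball τ hτ)
  have hend : s (x + τ0 • (z - x)) ≤ 0 := by
    have h3 := hb1 _ (Metric.ball_subset_ball (min_le_left _ _) (hball τ0 ⟨hτ0n, le_rfl⟩)) _
      (Metric.ball_subset_ball (min_le_left _ _) (hball 0 ⟨le_rfl, hτ0n⟩))
    rw [zero_smul, add_zero, add_sub_cancel_left, real_inner_smul_right, norm_smul,
      Real.norm_of_nonneg hτ0n] at h3
    have h4 : inner ℝ w (z - x) ≤ -c + c / 4 := by
      have : z - x = (z - xb) - (x - xb) := by abel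
      rw [this, inner_sub_right]
      have h5 := (abs_le.1 (abs_real_inner_le_norm w (x - xb))).1
      rw [lt_div_iff₀ (by positivity)] at h2c
      have h6 : ‖w‖ * ‖x - xb‖ ≤ c / 4 := by nlinarith [norm_nonneg (x - xb), norm_nonneg w]
      linarith
    have h5 : c / (4 * R) * (τ0 * ‖z - x‖) ≤ c / 4 * τ0 := by
      calc _ ≤ c / (4 * R) * (τ0 * R) := by gcongr
        _ = _ := by field_simp
    have h6 := mul_le_mul_of_nonneg_left h4 hτ0n
    have h7 : τ0 * c = 2 * s x := by rw [hτ0]; field_simp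
    have := (abs_le.1 h3).2
    linarith
  have hivt := intermediate_value_Icc' hτ0n hcont
  obtain ⟨τ, hτ, hτs⟩ := hivt ⟨hend, by simpa using hsx⟩
  refine ⟨x + τ • (z - x), hX.add_smul_sub_mem hx hz ⟨hτ.1, hτ.2.trans hτ01⟩,
    hb2 (Metric.ball_subset_ball ((min_le_right _ _).trans (min_le_left _ _)) (hball τ hτ)), hτs, ?_⟩
  rw [dist_self_add_right, norm_smul, Real.norm_of_nonneg hτ.1]
  calc τ * ‖z - x‖ ≤ τ0 * R := mul_le_mul hτ.2 hzx (norm_nonneg _) hτ0n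
    _ = _ := by rw [hτ0]; ring

/-- If a ball of radius `ρ` about `w` lies in the normal cone, then `⟨w, x - xb⟩ ≤ -(ρ/2) ‖x - xb‖`
on `X`. The linear part of `s` dominates, and `xb` itself serves as the nearby zero. -/
lemma norm_sub_le_of_mem_interior_normalCone {X : Set (Euc n)} {s : Euc n → ℝ} {w xb : Euc n}
    (hs : HasStrictFDerivAt s (innerSL ℝ w) xb) (hs0 : s xb = 0)
    (hw : w ∈ interior (normalCone X xb)) :
    ∃ C : ℝ, 0 < C ∧ ∀ᶠ x in 𝓝[X] xb, dist x xb ≤ C * |s x| := by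
  obtain ⟨ρ, hρ, hball⟩ := Metric.mem_nhds_iff.1 (mem_interior_iff_mem_nhds.1 hw)
  obtain ⟨r, hr, hb⟩ := HasStrictFDerivAt.exists_ball hs (ε := ρ / 4) (by positivity)
  refine ⟨4 / ρ, by positivity, ?_⟩
  filter_upwards [self_mem_nhdsWithin, nhdsWithin_le_nhds (Metric.ball_mem_nhds xb hr)]
    with x hx hxr
  have h1 := hb x hxr xb (Metric.mem_ball_self hr)
  rw [hs0, sub_zero] at h1
  rw [dist_eq_norm]
  by_cases h0 : x - xb = 0
  · rw [h0, norm_zero]; positivity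
  have hn : 0 < ‖x - xb‖ := norm_pos_iff.2 h0
  have h2 : w + (ρ / 2 / ‖x - xb‖) • (x - xb) ∈ normalCone X xb := by
    refine hball ?_
    rw [mem_ball_iff_norm, add_sub_cancel_left, norm_smul, Real.norm_of_nonneg (by positivity),
      div_mul_cancel₀ _ hn.ne']
    linarith
  have h3 := h2 x hx
  rw [inner_add_left, real_inner_smul_left, real_inner_self_eq_norm_sq] at h3
  have h4 : ρ / 2 / ‖x - xb‖ * ‖x - xb‖ ^ 2 = ρ / 2 * ‖x - xb‖ := by field_simp
  rw [h4] at h3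
  have h5 := (abs_le.1 h1).2
  have h6 := neg_abs_le (s x)
  rw [div_mul_eq_mul_div, le_div_iff₀ hρ]
  linarith

/-- Off the frontier of the normal cone there are two situations. Either `w` or `-w` is interior to
the cone, and `X` touches the zero set only at `xb` nearby; or both are outside the cone, and `X`
contains directions in which `s` decreases and directions in which it increases, so a zero is
reached from either sign. -/
lemma exists_zero_near {X : Set (Euc n)} (hX : Convex ℝ X) {s : Euc n → ℝ} {w xb : Euc n}
    (hxb : xb ∈ X) (hs : HasStrictFDerivAt s (innerSL ℝ w) xb) (hs0 : s xb = 0)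
    (hw : w ∉ frontier (normalCone X xb)) (hw' : -w ∉ frontier (normalCone X xb))
    {V : Set (Euc n)} (hV : V ∈ 𝓝 xb) :
    ∃ C : ℝ, 0 < C ∧ ∀ᶠ x in 𝓝[X] xb, ∃ x' ∈ X, x' ∈ V ∧ s x' = 0 ∧ dist x x' ≤ C * |s x| := by
  have hneg : HasStrictFDerivAt (-s) (innerSL ℝ (-w)) xb := by
    rw [map_neg]; exact hs.neg
  by_cases h1 : w ∈ interior (normalCone X xb)
  · obtain ⟨C, hC, h⟩ := norm_sub_le_of_mem_interior_normalCone hs hs0 h1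
    exact ⟨C, hC, h.mono fun x hx => ⟨xb, hxb, mem_of_mem_nhds hV, hs0, hx⟩⟩
  by_cases h2 : -w ∈ interior (normalCone X xb)
  · obtain ⟨C, hC, h⟩ := norm_sub_le_of_mem_interior_normalCone hneg (by simp [hs0]) h2
    exact ⟨C, hC, h.mono fun x hx => ⟨xb, hxb, mem_of_mem_nhds hV, hs0, by simpa using hx⟩⟩
  have h3 : w ∉ normalCone X xb := fun h => hw ⟨subset_closure h, h1⟩
  have h4 : -w ∉ normalCone X xb := fun h => hw' ⟨subset_closure h, h2⟩
  simp only [normalCone, Set.mem_ofPred_eq, not_forall, not_le] at h3 h4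
  obtain ⟨z1, hz1, hwz1⟩ := h3
  obtain ⟨z2, hz2, hwz2⟩ := h4
  obtain ⟨C1, hC1, e1⟩ := exists_zero_of_descent hX hneg (by simp [hs0]) hz1
    (by rw [inner_neg_left]; linarith) hV
  obtain ⟨C2, hC2, e2⟩ := exists_zero_of_descent hX hs hs0 hz2
    (by rw [inner_neg_left] at hwz2; linarith) hV
  refine ⟨max C1 C2, by positivity, ?_⟩
  filter_upwards [e1, e2] with x h1 h2
  rcases le_total 0 (s x) with h | h
  · obtain ⟨x', ha, hb, hc, hd⟩ := h2 h
    refine ⟨x', ha, hb, hc, hd.trans ?_⟩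
    rw [abs_of_nonneg h]
    gcongr
    exact le_max_right _ _
  · obtain ⟨x', ha, hb, hc, hd⟩ := h1 (by simpa using h)
    refine ⟨x', ha, hb, by simpa using hc, hd.trans ?_⟩
    rw [abs_of_nonpos h]
    simp only [Pi.neg_apply]
    exact mul_le_mul_of_nonneg_right (le_max_left _ _) (by linarith)

lemma IsFold.exists_unit_ker {x : Euc n} {y : Euc m} (hf : IsFold g x y) :
    ∃ v, ‖v‖ = 1 ∧ hessYY g x y v = 0 := by
  obtain ⟨⟨v, hv⟩, hv0, -⟩ := finrank_eq_one_iff'.1 hf.simple_zero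
  have hv0' : v ≠ 0 := fun h => hv0 (Subtype.ext h)
  have hn : ‖v‖ ≠ 0 := norm_ne_zero_iff.2 hv0'
  have hv' : hessYY g x y v = 0 := hv
  exact ⟨‖v‖⁻¹ • v, by rw [norm_smul, norm_inv, norm_norm, inv_mul_cancel₀ hn],
    by rw [map_smul, hv', smul_zero]⟩

lemma crossGrad_neg (hg : ContDiff ℝ ((⊤ : ℕ∞) : WithTop ℕ∞) (Function.uncurry g))
    (x : Euc n) (y v : Euc m) : crossGrad g x y (-v) = -crossGrad g x y v := by
  refine ext_inner_right ℝ fun p => ?_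
  rw [inner_neg_left, inner_crossGrad hg, inner_crossGrad hg, inner_neg_right]

/-- The distance to the bifurcation set is controlled by the gradient and the eigenvalues. -/
lemma exists_mul_le_norm_gradY_add_sq {X : Set (Euc n)} {f : Euc n → Euc m → ℝ}
    {y0 : Euc m} {Y Y' : Set (Euc m)} {Lg M gLow g0 fbar Lf : ℝ}
    (hstd : StandingAssumptions X f g y0 Y Lg M gLow g0 fbar Lf) (hY' : IsCompact Y')
    (hfold : ∀ x ∈ X, ∀ y, IsDegenerateStationary g x y → IsFold g x y)
    (htan : ∀ x ∈ X, ∀ y, IsDegenerateStationary g x y → IsNontangential X g x y) :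
    ∃ c : ℝ, 0 < c ∧ ∀ δ : ℝ, 0 < δ → δ ≤ 1 → ∀ x ∈ X \ bifurcationNbhd X g δ, ∀ y ∈ Y',
      ∀ (a : ℝ) (e : Euc m), ‖e‖ = 1 → hessYY g x y e = a • e →
        c * δ ≤ ‖gradY g x y‖ + a ^ 2 := by
  have hg := hstd.g_smooth
  have hM := hstd.M_pos
  have hH : ∀ x ∈ X, ∀ y y', ‖hessYY g x y - hessYY g x y'‖ ≤ M * ‖y - y'‖ := fun x hx y y' => by
    have := hstd.hess_lipschitz x hx x hx y y'
    simpa [Real.sqrt_sq] using this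
  have hcG := (contDiff_gradY hg).continuous
  have hcH := (contDiff_hessYY hg).continuous
  have key : ∃ c : ℝ, 0 < c ∧ ∀ p ∈ X ×ˢ Y', ∀ δ : ℝ, 0 < δ → δ ≤ 1 →
      p.1 ∉ bifurcationNbhd X g δ → ∀ (a : ℝ) (e : Euc m), ‖e‖ = 1 →
      hessYY g p.1 p.2 e = a • e → c * δ ≤ ‖gradY g p.1 p.2‖ + a ^ 2 := by
    -- Compactness of `X × Y'` reduces the bound to neighbourhoods of single points. At a
    -- nonstationary point the gradient is bounded below, at a nondegenerate stationary point the
    -- eigenvalues are (both with `δ ≤ 1`), and at a degenerate one the fold analysis applies.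
    refine (hstd.X_compact.prod hY').induction_on (p := fun S => ∃ c : ℝ, 0 < c ∧ ∀ p ∈ S, ∀ δ : ℝ,
      0 < δ → δ ≤ 1 → p.1 ∉ bifurcationNbhd X g δ → ∀ (a : ℝ) (e : Euc m), ‖e‖ = 1 →
      hessYY g p.1 p.2 e = a • e → c * δ ≤ ‖gradY g p.1 p.2‖ + a ^ 2)
      ⟨1, one_pos, by simp⟩ ?_ ?_ ?_
    · rintro S S' hSS' ⟨c, hc, h⟩
      exact ⟨c, hc, fun p hp => h p (hSS' hp)⟩
    · rintro S S' ⟨c, hc, h⟩ ⟨c', hc', h'⟩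
      refine ⟨min c c', lt_min hc hc', ?_⟩
      rintro p (hp | hp) δ hδ hδ1 hn a e he hae
      · exact (mul_le_mul_of_nonneg_right (min_le_left _ _) hδ.le).trans (h p hp δ hδ hδ1 hn a e he hae)
      · exact (mul_le_mul_of_nonneg_right (min_le_right _ _) hδ.le).trans (h' p hp δ hδ hδ1 hn a e he hae)
    · rintro ⟨xb, yb⟩ ⟨hxb, hyb⟩
      simp only at hxb hyb
      suffices h : ∃ c : ℝ, 0 < c ∧ ∀ᶠ p : Euc n × Euc m in 𝓝 (xb, yb), p.1 ∈ X → ∀ δ : ℝ,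
          0 < δ → δ ≤ 1 → p.1 ∉ bifurcationNbhd X g δ → ∀ (a : ℝ) (e : Euc m), ‖e‖ = 1 →
          hessYY g p.1 p.2 e = a • e → c * δ ≤ ‖gradY g p.1 p.2‖ + a ^ 2 by
        obtain ⟨c, hc, h⟩ := h
        refine ⟨_, mem_nhdsWithin_of_mem_nhds h |> fun h' => inter_mem h' self_mem_nhdsWithin,
          c, hc, fun p hp => hp.1 hp.2.1⟩
      by_cases hG : gradY g xb yb = 0
      swap
      · refine ⟨‖gradY g xb yb‖ / 2, by positivity, ?_⟩
        have hpos : 0 < ‖gradY g xb yb‖ := norm_pos_iff.2 hG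
        have ev := (hcG.norm.tendsto (xb, yb)).eventually
          (lt_mem_nhds (show ‖gradY g xb yb‖ / 2 < ‖gradY g xb yb‖ by linarith))
        refine ev.mono fun p hp _ δ hδ hδ1 _ a e _ _ => ?_
        have := sq_nonneg a
        nlinarith
      by_cases hdet : LinearMap.det (hessYY g xb yb : Euc m →ₗ[ℝ] Euc m) = 0
      swap
      · have hinj := (LinearMap.equivOfDetNeZero _ hdet).injective
        obtain ⟨K, hK, hanti⟩ := LinearMap.exists_antilipschitzWith
          (hessYY g xb yb : Euc m →ₗ[ℝ] Euc m) (LinearMap.ker_eq_bot.2 hinj)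
        have hKpos : (0 : ℝ) < K := hK
        have ev : ∀ᶠ p : Euc n × Euc m in 𝓝 (xb, yb),
            ‖hessYY g p.1 p.2 - hessYY g xb yb‖ < 1 / (2 * K) :=
          (tendsto_iff_norm_sub_tendsto_zero.1 (hcH.tendsto (xb, yb))).eventually
            (gt_mem_nhds (by positivity))
        refine ⟨(1 / (2 * K)) ^ 2, by positivity, ev.mono fun p hp _ δ hδ hδ1 _ a e he hae => ?_⟩
        have h1 := hanti.le_mul_dist e 0
        rw [dist_zero_right, map_zero, dist_zero_right, he] at h1
        have h2 : ‖hessYY g xb yb e‖ ≤ |a| + 1 / (2 * K) := by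
          have h7 : hessYY g xb yb e = a • e - (hessYY g p.1 p.2 - hessYY g xb yb) e := by
            rw [_root_.sub_apply, hae]; abel
          rw [h7]
          refine (norm_sub_le _ _).trans ?_
          have h8 := (hessYY g p.1 p.2 - hessYY g xb yb).le_opNorm e
          rw [he, mul_one] at h8
          rw [norm_smul, he, mul_one, Real.norm_eq_abs]
          linarith
        have h3 : 1 ≤ K * (|a| + 1 / (2 * K)) := h1.trans (by gcongr; exact h2)
        have h4 : 1 / (2 * K) ≤ |a| := by
          have : (K : ℝ) * (1 / (2 * K)) = 1 / 2 := by field_simp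
          rw [div_le_iff₀ (by positivity)]
          linarith
        have h5 : (1 / (2 * (K : ℝ))) ^ 2 ≤ a ^ 2 := by
          rw [← sq_abs a]; exact pow_le_pow_left₀ (by positivity) h4 2
        have h6 := norm_nonneg (gradY g p.1 p.2)
        have h7 : (1 / (2 * (K : ℝ))) ^ 2 * δ ≤ (1 / (2 * (K : ℝ))) ^ 2 :=
          mul_le_of_le_one_right (by positivity) hδ1
        linarith
      · have hdeg : IsDegenerateStationary g xb yb := ⟨hG, hdet⟩
        have hf := hfold xb hxb yb hdeg
        obtain ⟨v, hv, hHv⟩ := hf.exists_unit_ker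
        obtain ⟨s, hs, hs0, hsdeg, C1, hC1, hC1e⟩ := hf.exists_unfolding hg hv hHv hM hH
        have ht1 := htan xb hxb yb hdeg v hv hHv
        have ht2 := htan xb hxb yb hdeg (-v) (by rwa [norm_neg]) (by rw [map_neg, hHv, neg_zero])
        rw [crossGrad_neg hg] at ht2
        obtain ⟨C2, hC2, hC2e⟩ := exists_zero_near hstd.X_convex hxb hs hs0 ht1 ht2 hsdeg
        refine ⟨1 / (C2 * C1), by positivity, ?_⟩
        have hfst : Tendsto (Prod.fst : Euc n × Euc m → Euc n) (𝓝 (xb, yb)) (𝓝 xb) :=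
          continuous_fst.tendsto (xb, yb)
        filter_upwards [hC1e, hfst.eventually (eventually_nhdsWithin_iff.1 hC2e)]
          with p h1 h2 hp δ hδ hδ1 hn a e he hae
        obtain ⟨x', hx', hx'V, hsx', hd⟩ := h2 hp
        have h3 := h1 hp a e he hae
        have hbif : x' ∈ bifurcationSet X g := by
          obtain ⟨y, hy⟩ := hx'V hsx'
          exact ⟨hx', fun h => h y hy.1 hy.2⟩
        have h4 : δ < dist p.1 x' := by
          by_contra! hcon
          exact hn ⟨hp, Metric.mem_cthickening_of_dist_le _ _ _ _ hbif hcon⟩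
        rw [div_mul_eq_mul_div, one_mul, div_le_iff₀ (by positivity)]
        calc δ ≤ C2 * |s p.1| := h4.le.trans hd
          _ ≤ C2 * (C1 * (‖gradY g p.1 p.2‖ + a ^ 2)) := by gcongr
          _ = _ := by ring
  obtain ⟨c, hc, h⟩ := key
  exact ⟨c, hc, fun δ hδ hδ1 x hx y hy a e he hae => h (x, y) ⟨hx.1, hy⟩ δ hδ hδ1 hx.2 a e he hae⟩

end Regularity

/-! ### Lower bounds for `μ(δ)` and `α(δ, r)` -/

/-- A quantitative inverse function theorem: on the ball of radius `ε` the map `G` differs from its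
linearization by a Lipschitz constant `M ε ≤ σ/2`, so the image of the ball covers radius `σ/2 · ε`
around `G y`, and hence `0`. -/
lemma exists_zero_of_small_gradient {E : Type*} [NormedAddCommGroup E] [NormedSpace ℝ E]
    [FiniteDimensional ℝ E] {G : E → E} {H : E → E →L[ℝ] E} {M σ ε : ℝ}
    (hG : ∀ y, HasFDerivAt G (H y) y) (hM : 0 < M) (hH : ∀ y y', ‖H y - H y'‖ ≤ M * ‖y - y'‖)
    (hσ : 0 < σ) (hε : 0 ≤ ε) {y : E} (hy : ∀ e, σ * ‖e‖ ≤ ‖H y e‖) (hεσ : ε ≤ σ / (2 * M))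
    (hGy : ‖G y‖ ≤ σ / 2 * ε) : ∃ z, ‖z - y‖ ≤ ε ∧ G z = 0 := by
  have hinj : Function.Injective (H y : E →ₗ[ℝ] E) := by
    rw [injective_iff_map_eq_zero]
    intro e he
    have h1 := hy e
    have h2 : H y e = 0 := he
    rw [h2, norm_zero] at h1
    exact norm_eq_zero.1 (le_antisymm (by nlinarith [norm_nonneg e]) (norm_nonneg e))
  let L := LinearEquiv.ofInjectiveEndo (H y : E →ₗ[ℝ] E) hinj
  let R : (H y).NonlinearRightInverse :=
    { toFun := L.symm
      nnnorm := ⟨σ⁻¹, by positivity⟩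
      bound' := fun u => by
        have h1 := hy (L.symm u)
        have h2 : H y (L.symm u) = u := L.apply_symm_apply u
        rw [h2] at h1
        change ‖L.symm u‖ ≤ σ⁻¹ * ‖u‖
        rw [inv_mul_eq_div, le_div_iff₀ hσ]
        linarith
      right_inv' := fun u => L.apply_symm_apply u }
  have happ : ApproximatesLinearOn G (H y) (Metric.closedBall y ε) ⟨M * ε, by positivity⟩ := by
    intro a ha b hb
    refine (convex_closedBall y ε).norm_image_sub_le_of_norm_hasFDerivWithin_le'
      (fun z _ => (hG z).hasFDerivWithinAt) (fun z hz => (hH z y).trans ?_) hb ha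
    rw [mem_closedBall_iff_norm] at hz
    change _ ≤ M * ε
    gcongr
  have hsurj := happ.surjOn_closedBall_of_nonlinearRightInverse R hε subset_rfl
  have hmem : (0 : E) ∈ Metric.closedBall (G y) (((R.nnnorm : ℝ)⁻¹ - M * ε) * ε) := by
    rw [mem_closedBall_iff_norm, zero_sub, norm_neg]
    refine hGy.trans ?_
    have : (R.nnnorm : ℝ)⁻¹ = σ := inv_inv σ
    rw [this]
    gcongr
    rw [le_div_iff₀ (by positivity)] at hεσ
    linarith
  obtain ⟨z, hz, hz0⟩ := hsurj hmem
  exact ⟨z, by rwa [mem_closedBall_iff_norm] at hz, hz0⟩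

section Sharp

variable {n m : ℕ} {X : Set (Euc n)} {f g : Euc n → Euc m → ℝ}
  {y0 : Euc m} {Y Y' : Set (Euc m)} {Lg M gLow g0 fbar Lf : ℝ}

/-- At stationary points the key inequality reads `a² ≥ c δ`, which bounds `μ`. For `α` one argues
by contradiction: a gradient below `c δ / 2` forces every eigenvalue at `y` to satisfy `a² ≥ c δ /
2`, so a true stationary point lies within `κ √δ ≤ μ(δ)/(2M)` of `y`. -/
lemma exists_sharp_lower_bounds (hstd : StandingAssumptions X f g y0 Y Lg M gLow g0 fbar Lf)
    (hY' : IsCompact Y') (hYY' : Y ⊆ interior Y')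
    (hfold : ∀ x ∈ X, ∀ y, IsDegenerateStationary g x y → IsFold g x y)
    (htan : ∀ x ∈ X, ∀ y, IsDegenerateStationary g x y → IsNontangential X g x y) :
    ∃ c : ℝ, 0 < c ∧ ∀ δ : ℝ, 0 < δ → δ ≤ 1 → ENNReal.ofReal (c * √δ) ≤ muSharp X g Y' δ ∧
      ENNReal.ofReal (c * δ) ≤
        alphaSharp X g Y Y' δ (muSharp X g Y' δ / ENNReal.ofReal (2 * M)) := by
  have hg := hstd.g_smooth
  have hM := hstd.M_pos
  obtain ⟨c, hc, hkey⟩ := exists_mul_le_norm_gradY_add_sq hstd hY' hfold htan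
  obtain ⟨r0, hr0, hr0Y⟩ := hstd.Y_compact.exists_cthickening_subset_open isOpen_interior hYY'
  set b := √(c / 2) with hb
  have hb0 : 0 < b := Real.sqrt_pos.2 (by positivity)
  have hb2 : b ^ 2 = c / 2 := Real.sq_sqrt (by positivity)
  -- The first entry meets the radius condition of the inverse function theorem and keeps `κ √δ`
  -- below `μ(δ)/(2M)`; the second keeps the zero inside `Y'`.
  set κ := min (b / (2 * M)) r0 with hκ
  have hκ0 : 0 < κ := by positivity
  have hmu : ∀ δ : ℝ, 0 < δ → δ ≤ 1 → ENNReal.ofReal (b * √δ) ≤ muSharp X g Y' δ := by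
    intro δ hδ hδ1
    refine le_iInf₂ fun x hx => le_iInf₂ fun y hy => le_iInf₂ fun a ha => ?_
    obtain ⟨e, he, hae⟩ := IsEigenvalue.exists_unit ha
    have h1 := hkey δ hδ hδ1 x hx y hy.1 a e he hae
    rw [hy.2, norm_zero, zero_add] at h1
    refine ENNReal.ofReal_le_ofReal (abs_le_of_sq_le_sq' ?_ (abs_nonneg a)).2
    rw [mul_pow, hb2, Real.sq_sqrt hδ.le, sq_abs]
    have : 0 < c * δ := by positivity
    linarith
  refine ⟨min b (min (c / 2) (b * κ / 2)), by positivity, fun δ hδ hδ1 => ⟨?_, ?_⟩⟩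
  · exact (ENNReal.ofReal_le_ofReal (by gcongr; exact min_le_left _ _)).trans (hmu δ hδ hδ1)
  · refine le_iInf₂ fun x hx => le_iInf₂ fun y hy => le_iInf fun hdist => ENNReal.ofReal_le_ofReal ?_
    by_contra! hcon
    have hsδ : √δ ^ 2 = δ := Real.sq_sqrt hδ.le
    have hsδ0 : 0 < √δ := Real.sqrt_pos.2 hδ
    have hc1 : ‖gradY g x y‖ < c / 2 * δ := hcon.trans_le
      (by gcongr; exact (min_le_right _ _).trans (min_le_left _ _))
    have hc2 : ‖gradY g x y‖ < b * κ / 2 * δ := hcon.trans_le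
      (by gcongr; exact (min_le_right _ _).trans (min_le_right _ _))
    have hyY' : y ∈ Y' := interior_subset (hYY' hy)
    have hH : ∀ y y', ‖hessYY g x y - hessYY g x y'‖ ≤ M * ‖y - y'‖ := fun y y' => by
      have := hstd.hess_lipschitz x hx.1 x hx.1 y y'
      simpa [Real.sqrt_sq] using this
    have hlow : ∀ e, b * √δ * ‖e‖ ≤ ‖hessYY g x y e‖ := by
      refine mul_norm_le_norm_apply_of_eigenvalue (isSymmetric_hessYY hg x y) (by positivity) ?_
      intro a ha
      obtain ⟨e, he, hae⟩ := IsEigenvalue.exists_unit (H := hessYY g x y) ha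
      have h1 := hkey δ hδ hδ1 x hx y hyY' a e he hae
      refine (abs_le_of_sq_le_sq' ?_ (abs_nonneg a)).2
      rw [mul_pow, hb2, hsδ, sq_abs]
      linarith
    obtain ⟨z, hz, hz0⟩ := exists_zero_of_small_gradient (ε := κ * √δ) (hasFDerivAt_gradY hg x) hM hH
      (by positivity) (by positivity) hlow (by
        rw [mul_div_right_comm]
        gcongr
        exact min_le_left _ _) (by
        refine hc2.le.trans_eq ?_
        rw [← hsδ, Real.sqrt_sq hsδ0.le]; ring)
    have hzY' : z ∈ Y' := by
      refine interior_subset (hr0Y (Metric.mem_cthickening_of_dist_le z y r0 Y hy ?_))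
      rw [dist_eq_norm]
      refine hz.trans ((mul_le_of_le_one_right hκ0.le ?_).trans (min_le_right _ _))
      exact Real.sqrt_le_one.2 hδ1
    have h2 : Metric.infEDist y (critSet g Y' x) ≤ ENNReal.ofReal (κ * √δ) := by
      refine (Metric.infEDist_le_edist_of_mem (show z ∈ critSet g Y' x from ⟨hzY', hz0⟩)).trans ?_
      rw [edist_dist, dist_comm, dist_eq_norm]
      exact ENNReal.ofReal_le_ofReal hz
    refine absurd hdist (not_lt.2 (h2.trans ?_))
    rw [ENNReal.le_div_iff_mul_le (Or.inl (by simpa using hM)) (Or.inl ENNReal.ofReal_ne_top),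
      ← ENNReal.ofReal_mul (by positivity)]
    refine le_trans (ENNReal.ofReal_le_ofReal ?_) (hmu δ hδ hδ1)
    have h3 : κ * (2 * M) ≤ b := by
      calc κ * (2 * M) ≤ b / (2 * M) * (2 * M) := by gcongr; exact min_le_left _ _
        _ = b := by field_simp
    calc κ * √δ * (2 * M) = κ * (2 * M) * √δ := by ring
      _ ≤ _ := by gcongr

end Sharp

/-! ### The prescribed number of inner steps -/

section InnerSteps

lemma ofReal_div_rpow {c b : ℝ} (hb : 0 < b) (p : ℝ) :
    ENNReal.ofReal c / ENNReal.ofReal b ^ p = ENNReal.ofReal (c / b ^ p) := by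
  rw [ENNReal.ofReal_rpow_of_pos hb, ENNReal.ofReal_div_of_pos (Real.rpow_pos_of_pos hb _)]

lemma innerStepBound_anti {D M ρ : ℝ} {μ μ' α α' : ℝ≥0∞} (hμ : μ' ≤ μ) (hα : α' ≤ α) :
    innerStepBound D M μ α ρ ≤ innerStepBound D M μ' α' ρ := by
  unfold innerStepBound
  gcongr

lemma innerStepBound_ofReal {D M ρ μ α : ℝ} (hM : 0 < M) (hμ : 0 < μ) (hα : 0 < α) (hρ : 0 < ρ)
    (hD : 0 ≤ D) :
    innerStepBound D M (ENNReal.ofReal μ) (ENNReal.ofReal α) ρ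
      = ENNReal.ofReal (max (256 * D * √M / 9 / (min α (μ ^ 2 / (4 * M))) ^ (3 / 2 : ℝ))
        (768 * D * M ^ 2 / μ ^ 3) + 256 * D * √M / 9 / (μ * ρ) ^ (3 / 2 : ℝ)) := by
  unfold innerStepBound
  rw [← ENNReal.ofReal_pow hμ.le, ← ENNReal.ofReal_div_of_pos (by positivity),
    ← ENNReal.ofReal_min, ofReal_div_rpow (by positivity), ← ENNReal.ofReal_pow hμ.le,
    ← ENNReal.ofReal_div_of_pos (by positivity), ← ENNReal.ofReal_mul hμ.le,
    ofReal_div_rpow (by positivity), ← ENNReal.ofReal_max, ← ENNReal.ofReal_add]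
  · have : 0 ≤ 768 * D * M ^ 2 / μ ^ 3 := by positivity
    exact this.trans (le_max_right _ _)
  · positivity

lemma div_sq_rpow {b T : ℝ} (hb : 0 < b) (hT : 0 < T) :
    (b / T ^ 2) ^ (3 / 2 : ℝ) = b ^ (3 / 2 : ℝ) / T ^ 3 := by
  rw [Real.div_rpow hb.le (by positivity)]
  congr 1
  rw [← Real.rpow_natCast, ← Real.rpow_natCast, ← Real.rpow_mul hT.le]
  norm_num

/-- With `μ` proportional to `1/T`, `α` to `1/T²` and `ρ = 1/T`, each of `min(α, μ²/(4M))^(3/2)`,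
`μ³` and `(μρ)^(3/2)` scales as `T⁻³`. -/
lemma exists_innerStepBound_le {D M μ0 α0 : ℝ} (hM : 0 < M) (hμ : 0 < μ0) (hα : 0 < α0)
    (hD : 0 ≤ D) : ∃ C : ℝ, 0 ≤ C ∧ ∀ T : ℝ, 0 < T →
      innerStepBound D M (ENNReal.ofReal (μ0 / T)) (ENNReal.ofReal (α0 / T ^ 2)) (1 / T)
        = ENNReal.ofReal (C * T ^ 3) := by
  refine ⟨max (256 * D * √M / 9 / (min α0 (μ0 ^ 2 / (4 * M))) ^ (3 / 2 : ℝ))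
        (768 * D * M ^ 2 / μ0 ^ 3) + 256 * D * √M / 9 / μ0 ^ (3 / 2 : ℝ), by positivity, ?_⟩
  intro T hT
  rw [innerStepBound_ofReal hM (by positivity) (by positivity) (by positivity) hD]
  congr 1
  have h1 : (μ0 / T) ^ 2 / (4 * M) = μ0 ^ 2 / (4 * M) / T ^ 2 := by field_simp
  have h2 : min (α0 / T ^ 2) ((μ0 / T) ^ 2 / (4 * M)) = min α0 (μ0 ^ 2 / (4 * M)) / T ^ 2 := by
    rw [h1, min_div_div_right (by positivity)]
  have h3 : μ0 / T * (1 / T) = μ0 / T ^ 2 := by field_simp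
  rw [h2, h3, div_sq_rpow (by positivity) hT, div_sq_rpow hμ hT, add_mul,
    max_mul_of_nonneg _ _ (by positivity)]
  congr 1
  · congr 1 <;> field_simp
  · field_simp

variable {n m : ℕ} {X : Set (Euc n)} {f g : Euc n → Euc m → ℝ}
  {y0 : Euc m} {Y Y' : Set (Euc m)} {Lg M gLow g0 fbar Lf d : ℝ}

lemma deltaSeq_pos (n : ℕ) (d : ℝ) (t : ℕ) : 0 < deltaSeq n d t := by
  unfold deltaSeq; positivity

lemma deltaSeq_le_one (hdn : d < n) (t : ℕ) : deltaSeq n d t ≤ 1 := by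
  unfold deltaSeq
  refine Real.rpow_le_one_of_one_le_of_nonpos (by linarith [Nat.cast_nonneg (α := ℝ) t]) ?_
  exact div_nonpos_of_nonpos_of_nonneg (by norm_num) (by linarith)

lemma one_div_sq_le_deltaSeq (hdn : d + 1 ≤ n) (t : ℕ) : 1 / ((t : ℝ) + 1) ^ 2 ≤ deltaSeq n d t := by
  unfold deltaSeq
  have h1 : (1 : ℝ) ≤ (t : ℝ) + 1 := by linarith [Nat.cast_nonneg (α := ℝ) t]
  rw [one_div, ← Real.rpow_natCast, ← Real.rpow_neg (by positivity)]
  refine Real.rpow_le_rpow_of_exponent_le h1 ?_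
  rw [neg_div, Nat.cast_ofNat, neg_le_neg_iff]
  exact div_le_self (by norm_num) (by linarith)

lemma nonneg_of_standing (hstd : StandingAssumptions X f g y0 Y Lg M gLow g0 fbar Lf) :
    0 ≤ g0 - gLow := by
  obtain ⟨x, hx⟩ := hstd.X_nonempty
  linarith [hstd.g_lower x hx y0, hstd.g0_upper x hx]

lemma exists_innerStepBoundSeq_le (hstd : StandingAssumptions X f g y0 Y Lg M gLow g0 fbar Lf)
    (hY' : IsCompact Y') (hYY' : Y ⊆ interior Y')
    (hfold : ∀ x ∈ X, ∀ y, IsDegenerateStationary g x y → IsFold g x y)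
    (htan : ∀ x ∈ X, ∀ y, IsDegenerateStationary g x y → IsNontangential X g x y)
    (hdn : d + 1 ≤ n) :
    ∃ C : ℝ, 0 ≤ C ∧ ∀ t : ℕ, innerStepBoundSeq X g Y Y' M gLow g0 d t
      ≤ ENNReal.ofReal (C * ((t : ℝ) + 1) ^ 3) := by
  obtain ⟨c, hc, hcb⟩ := exists_sharp_lower_bounds hstd hY' hYY' hfold htan
  obtain ⟨C, hC, hCe⟩ := exists_innerStepBound_le hstd.M_pos hc hc (nonneg_of_standing hstd)
  refine ⟨C, hC, fun t => ?_⟩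
  have hT : (0 : ℝ) < (t : ℝ) + 1 := by positivity
  have hδ := one_div_sq_le_deltaSeq hdn t
  obtain ⟨h1, h2⟩ := hcb _ (deltaSeq_pos n d t) (deltaSeq_le_one (by linarith) t)
  rw [← hCe _ hT]
  refine innerStepBound_anti (le_trans (ENNReal.ofReal_le_ofReal ?_) h1)
    (le_trans (ENNReal.ofReal_le_ofReal ?_) h2)
  · rw [div_eq_mul_one_div]
    refine mul_le_mul_of_nonneg_left (Real.le_sqrt_of_sq_le ?_) hc.le
    rw [div_pow, one_pow]; exact hδ
  · rw [div_eq_mul_one_div]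
    gcongr

lemma lt_of_innerStepBound_lt {D M ρ μ a : ℝ} {α : ℝ≥0∞} {K : ℕ} (hμ : 0 < μ)
    (hρ : 0 < ρ) (ha : 0 < a)
    (hmin : min α (ENNReal.ofReal μ ^ 2 / ENNReal.ofReal (4 * M)) = ENNReal.ofReal a)
    (hK : innerStepBound D M (ENNReal.ofReal μ) α ρ < K) :
    256 * D * √M / 9 / a ^ (3 / 2 : ℝ) < K ∧ 768 * D * M ^ 2 / μ ^ 3 < K ∧
      256 * D * √M / 9 / (μ * ρ) ^ (3 / 2 : ℝ) < K := by
  have hK0 : K ≠ 0 := by rintro rfl; simp at hK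
  unfold innerStepBound at hK
  rw [hmin, ofReal_div_rpow ha, ← ENNReal.ofReal_pow hμ.le,
    ← ENNReal.ofReal_div_of_pos (by positivity), ← ENNReal.ofReal_mul hμ.le,
    ofReal_div_rpow (by positivity)] at hK
  refine ⟨?_, ?_, ?_⟩
  · exact (ENNReal.ofReal_lt_natCast hK0).1 (((le_max_left _ _).trans le_self_add).trans_lt hK)
  · exact (ENNReal.ofReal_lt_natCast hK0).1 (((le_max_right _ _).trans le_self_add).trans_lt hK)
  · exact (ENNReal.ofReal_lt_natCast hK0).1 (le_add_self.trans_lt hK)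

/-- The minimizer of `g(x, ·)` on `Y` is global because `Y` contains the sublevel set of `y0`. Its
existence makes `μ(δ)` finite when `m > 0` and some admissible `x` exists. -/
lemma exists_critSet (hstd : StandingAssumptions X f g y0 Y Lg M gLow g0 fbar Lf)
    (hYY' : Y ⊆ interior Y') {x : Euc n} (hx : x ∈ X) : (critSet g Y' x).Nonempty := by
  have hy0 : y0 ∈ Y := hstd.sublevel_subset x hx (show g x y0 ≤ g x y0 from le_rfl)
  obtain ⟨z, hz, hzmin⟩ := hstd.Y_compact.exists_isMinOn ⟨y0, hy0⟩
    (contDiff_slice hstd.g_smooth x).continuous.continuousOn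
  refine ⟨z, interior_subset (hYY' hz), ?_⟩
  have hmin : ∀ y, g x z ≤ g x y := fun y => by
    by_cases hy : y ∈ Y
    · exact hzmin hy
    · have : ¬ g x y ≤ g x y0 := fun h => hy (hstd.sublevel_subset x hx h)
      exact (hzmin hy0).trans (not_le.1 this).le
  have h0 : fderiv ℝ (g x) z = 0 :=
    IsLocalMin.fderiv_eq_zero (Eventually.of_forall hmin)
  unfold gradY gradient
  rw [h0, map_zero]

lemma exists_isEigenvalue (hg : ContDiff ℝ ((⊤ : ℕ∞) : WithTop ℕ∞) (Function.uncurry g))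
    (hm : 0 < m) (x : Euc n) (y : Euc m) : ∃ a, IsEigenvalue (hessYY g x y) a :=
  ⟨_, (isSymmetric_hessYY hg x y).hasEigenvalue_eigenvalues (finrank_euclideanSpace_fin) ⟨0, hm⟩⟩

lemma lower_level_limit (hstd : StandingAssumptions X f g y0 Y Lg M gLow g0 fbar Lf)
    (hY' : IsCompact Y') (hYY' : Y ⊆ interior Y')
    (hfold : ∀ x ∈ X, ∀ y, IsDegenerateStationary g x y → IsFold g x y)
    (htan : ∀ x ∈ X, ∀ y, IsDegenerateStationary g x y → IsNontangential X g x y)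
    (hdn : d < n) {t K : ℕ} (hK : innerStepBoundSeq X g Y Y' M gLow g0 d t < K)
    {x : Euc n} (hx : x ∈ X \ bifurcationNbhd X g (deltaSeq n d t)) {y : ℕ → Euc m}
    (hy : IsCubicNewtonRun g M x y0 y) {yhat : Euc m}
    (hout : IsCubicNewtonOutput g M x y K yhat) :
    ∃ z, Tendsto y atTop (𝓝 z) ∧ ‖yhat - z‖ ≤ rhoSeq t ∧ g x z ≤ g x y0 ∧ g x yhat ≤ g x y0 := by
  have hM := hstd.M_pos
  have hρ : 0 < rhoSeq t := by unfold rhoSeq; positivity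
  -- For `m = 0` there are no eigenvalues and `μ = ∞`, so conversion to real numbers fails; but then
  -- `y` ranges over a single point.
  rcases Nat.eq_zero_or_pos m with rfl | hm
  · refine ⟨y 0, ?_, ?_, ?_, ?_⟩
    · refine (tendsto_const_nhds (x := y 0)).congr fun k => Subsingleton.elim _ _
    · rw [Subsingleton.elim (yhat - y 0) 0, norm_zero]; exact hρ.le
    · rw [Subsingleton.elim (y 0) y0]
    · rw [Subsingleton.elim yhat y0]
  obtain ⟨c, hc, hcb⟩ := exists_sharp_lower_bounds hstd hY' hYY' hfold htan
  obtain ⟨h1, h2⟩ := hcb _ (deltaSeq_pos n d t) (deltaSeq_le_one hdn t)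
  unfold innerStepBoundSeq at hK
  set δ := deltaSeq n d t
  have hδ : 0 < δ := deltaSeq_pos n d t
  set μ := muSharp X g Y' δ with hμdef
  have hμle : ∀ z ∈ critSet g Y' x, ∀ c, IsEigenvalue (hessYY g x z) c → μ ≤ ENNReal.ofReal |c| :=
    fun z hz c hc => (iInf₂_le x hx).trans ((iInf₂_le z hz).trans (iInf₂_le c hc))
  obtain ⟨z0, hz0⟩ := exists_critSet hstd hYY' hx.1
  obtain ⟨a0, ha0⟩ := exists_isEigenvalue hstd.g_smooth hm x z0
  have hμtop : μ ≠ ⊤ := ne_top_of_le_ne_top ENNReal.ofReal_ne_top (hμle z0 hz0 a0 ha0)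
  have hμpos : 0 < μ := lt_of_lt_of_le (ENNReal.ofReal_pos.2 (by positivity)) h1
  set α := alphaSharp X g Y Y' δ (μ / ENNReal.ofReal (2 * M)) with hαdef
  have hαpos : 0 < α := lt_of_lt_of_le (ENNReal.ofReal_pos.2 (by positivity)) h2
  set μr := μ.toReal with hμr
  have hμr0 : 0 < μr := ENNReal.toReal_pos hμpos.ne' hμtop
  have hμe : μ = ENNReal.ofReal μr := (ENNReal.ofReal_toReal hμtop).symm
  have hquot : ENNReal.ofReal μr ^ 2 / ENNReal.ofReal (4 * M) = ENNReal.ofReal (μr ^ 2 / (4 * M)) := by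
    rw [← ENNReal.ofReal_pow hμr0.le, ← ENNReal.ofReal_div_of_pos (by positivity)]
  set mm := min α (ENNReal.ofReal μr ^ 2 / ENNReal.ofReal (4 * M)) with hmm
  have hmmtop : mm ≠ ⊤ := by
    refine ne_top_of_le_ne_top ?_ (min_le_right _ _)
    rw [hquot]; exact ENNReal.ofReal_ne_top
  have hmmpos : 0 < mm := lt_min hαpos (by rw [hquot]; exact ENNReal.ofReal_pos.2 (by positivity))
  set a := mm.toReal with ha
  have ha0 : 0 < a := ENNReal.toReal_pos hmmpos.ne' hmmtop
  have hae : mm = ENNReal.ofReal a := (ENNReal.ofReal_toReal hmmtop).symm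
  rw [hμe] at hK
  obtain ⟨k1, k2, k3⟩ := lt_of_innerStepBound_lt hμr0 hρ ha0 hae hK
  refine lower_level_output hstd hY' hx.1 hy hout hμr0 ha0 hρ ?_ ?_ ?_ k1 k2 k3
  · have : mm ≤ ENNReal.ofReal (μr ^ 2 / (4 * M)) := by rw [← hquot]; exact min_le_right _ _
    rw [hae] at this
    exact (ENNReal.ofReal_le_ofReal_iff (by positivity)).1 this
  · intro z hz c hc
    have := hμle z hz c hc
    rw [hμe] at this
    exact (ENNReal.ofReal_le_ofReal_iff (abs_nonneg c)).1 this
  · intro z hz hlt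
    have h3 : mm ≤ ENNReal.ofReal ‖gradY g x z‖ := by
      refine (min_le_left _ _).trans ((iInf₂_le x hx).trans ((iInf₂_le z hz).trans (iInf_le _ ?_)))
      rwa [hμe, ← ENNReal.ofReal_div_of_pos (by positivity)]
    rw [hae] at h3
    exact (ENNReal.ofReal_le_ofReal_iff (norm_nonneg _)).1 h3

end InnerSteps

/-! ### Covering numbers and the dimension of the bifurcation set -/

section Packing

variable {n : ℕ}

lemma card_mul_pow_le_of_separated {ι : Type*} (S : Finset ι) (f : ι → Euc n) {r R : ℝ}
    (hr : 0 < r) (hR : 0 ≤ R) (hsep : ∀ i ∈ S, ∀ j ∈ S, i ≠ j → 2 * r ≤ dist (f i) (f j))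
    (hb : ∀ i ∈ S, ‖f i‖ ≤ R) : (S.card : ℝ) * r ^ n ≤ (R + r) ^ n := by
  have hdisj : (S : Set ι).PairwiseDisjoint fun i => Metric.ball (f i) r := by
    intro i hi j hj hij
    refine Metric.ball_disjoint_ball ?_
    linarith [hsep i hi j hj hij]
  have hsub : (⋃ i ∈ S, Metric.ball (f i) r) ⊆ Metric.ball (0 : Euc n) (R + r) := by
    intro x hx
    simp only [Set.mem_iUnion, exists_prop] at hx
    obtain ⟨i, hi, hx⟩ := hx
    rw [mem_ball_iff_norm] at hx ⊢
    rw [sub_zero]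
    calc ‖x‖ = ‖(x - f i) + f i‖ := by rw [sub_add_cancel]
      _ ≤ ‖x - f i‖ + ‖f i‖ := norm_add_le _ _
      _ < _ := by linarith [hb i hi]
  have hvol := measure_mono (μ := (volume : Measure (Euc n))) hsub
  rw [measure_biUnion_finset hdisj (fun i _ => measurableSet_ball)] at hvol
  simp_rw [Measure.addHaar_ball_of_pos volume _ hr] at hvol
  rw [Measure.addHaar_ball_of_pos volume _ (by positivity : 0 < R + r), Finset.sum_const,
    nsmul_eq_mul, ← mul_assoc, ENNReal.mul_le_mul_iff_left
      (Metric.measure_ball_pos volume _ one_pos).ne' measure_ball_lt_top.ne,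
    finrank_euclideanSpace_fin, ← ENNReal.ofReal_natCast, ← ENNReal.ofReal_mul (by positivity),
    ENNReal.ofReal_le_ofReal_iff (by positivity)] at hvol
  exact hvol

/-- Codimension one by stacking: `⌈1/r⌉` translates of `D` along `w`, at spacing `r`, remain
`r/2`-separated since `‖u + τ w‖² ≥ ‖u‖² - ⟨w, u⟩² ≥ 3/4 ‖u‖²`. The `n`-dimensional volume bound for
the stack gains the factor `r` for `D`. -/
lemma card_mul_pow_le_of_transversal (D : Finset (Euc n)) {w : Euc n} (hw : ‖w‖ = 1) {r R : ℝ}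
    (hr : 0 < r) (hr1 : r ≤ 1) (hR : 0 ≤ R) (hsep : ∀ a ∈ D, ∀ b ∈ D, a ≠ b → r ≤ dist a b)
    (hb : ∀ a ∈ D, ‖a‖ ≤ R)
    (htr : ∀ a ∈ D, ∀ b ∈ D, |inner ℝ w (a - b)| ≤ 1 / 2 * ‖a - b‖) :
    (D.card : ℝ) * r ^ n ≤ (4 * (R + 2)) ^ n * r := by
  set k := ⌈1 / r⌉₊ with hk
  have hk1 : 1 / r ≤ k := Nat.le_ceil _
  have hmain := card_mul_pow_le_of_separated (D ×ˢ Finset.range k)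
    (fun q : Euc n × ℕ => q.1 + ((q.2 : ℝ) * r) • w) (r := r / 4) (R := R + 1)
    (by positivity) (by positivity) (by
      rintro ⟨a, i⟩ ha ⟨b, j⟩ hb' hne
      simp only [Finset.mem_product] at ha hb'
      simp only
      rw [dist_eq_norm]
      by_cases hab : a = b
      · subst hab
        have hij : i ≠ j := fun h => hne (by rw [h])
        rw [add_sub_add_left_eq_sub, ← sub_smul, ← sub_mul, norm_smul, hw, mul_one, norm_mul,
          Real.norm_of_nonneg hr.le, Real.norm_eq_abs]
        have : (1 : ℝ) ≤ |(i : ℝ) - j| := by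
          have h : (1 : ℤ) ≤ |(i : ℤ) - j| := Int.one_le_abs (by omega)
          exact_mod_cast h
        nlinarith
      · have h1 := hsep a ha.1 b hb'.1 hab
        rw [dist_eq_norm] at h1
        have h2 := htr a ha.1 b hb'.1
        set u := a - b
        set τ : ℝ := i * r - j * r
        have h3 : a + ((i : ℝ) * r) • w - (b + ((j : ℝ) * r) • w) = u + τ • w := by
          simp only [u, τ, sub_smul]; abel
        rw [h3]
        have h4 : ‖u + τ • w‖ ^ 2 = ‖u‖ ^ 2 + 2 * τ * inner ℝ w u + τ ^ 2 := by
          rw [norm_add_sq_real, real_inner_smul_right, norm_smul, hw, mul_one, Real.norm_eq_abs,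
            sq_abs, real_inner_comm]
          ring
        have h5 : (inner ℝ w u : ℝ) ^ 2 ≤ 1 / 4 * ‖u‖ ^ 2 := by
          have := pow_le_pow_left₀ (abs_nonneg _) h2 2
          rw [sq_abs] at this
          linarith
        refine (abs_le_of_sq_le_sq' ?_ (norm_nonneg _)).2
        rw [h4]
        nlinarith [sq_nonneg (τ + inner ℝ w u)])
    (by
      rintro ⟨a, i⟩ ha
      simp only [Finset.mem_product, Finset.mem_range] at ha
      refine (norm_add_le _ _).trans (add_le_add (hb a ha.1) ?_)
      rw [norm_smul, hw, mul_one, Real.norm_of_nonneg (by positivity)]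
      have : (i : ℝ) < 1 / r := Nat.lt_ceil.1 ha.2
      rw [lt_div_iff₀ hr] at this
      exact this.le)
  rw [Finset.card_product, Finset.card_range, Nat.cast_mul] at hmain
  have h1 : (D.card : ℝ) * (1 / r) * (r / 4) ^ n ≤ (R + 2) ^ n := by
    calc _ ≤ (D.card : ℝ) * k * (r / 4) ^ n := by gcongr
      _ ≤ _ := hmain
      _ ≤ _ := pow_le_pow_left₀ (by positivity) (by linarith) n
  rw [mul_pow]
  rw [div_pow] at h1
  calc (D.card : ℝ) * r ^ n = (D.card : ℝ) * (1 / r) * (r ^ n / 4 ^ n) * (4 ^ n * r) := by field_simp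
    _ ≤ (R + 2) ^ n * (4 ^ n * r) := by gcongr
    _ = _ := by ring

/-- A maximal `r`-separated subset is an `r`-cover. The count for finite separated subsets also
shows that the packing number is finite. -/
lemma exists_cover_of_transversal {A : Set (Euc n)} {w : Euc n} (hw : ‖w‖ = 1) {R : ℝ}
    (hR : 0 ≤ R) (hb : ∀ a ∈ A, ‖a‖ ≤ R)
    (htr : ∀ a ∈ A, ∀ b ∈ A, |inner ℝ w (a - b)| ≤ 1 / 2 * ‖a - b‖) {r : ℝ≥0}
    (hr : 0 < r) (hr1 : r ≤ 1) :
    ∃ D : Finset (Euc n), Metric.IsCover r A D ∧ (D.card : ℝ) * r ^ n ≤ (4 * (R + 2)) ^ n * r := by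
  have hfin : ∀ D : Finset (Euc n), (D : Set (Euc n)) ⊆ A → Metric.IsSeparated r (D : Set (Euc n)) →
      (D.card : ℝ) * r ^ n ≤ (4 * (R + 2)) ^ n * r := by
    intro D hDA hD
    refine card_mul_pow_le_of_transversal D hw hr hr1 hR ?_ (fun a ha => hb a (hDA ha))
      (fun a ha b hb => htr a (hDA ha) b (hDA hb))
    intro a ha b hb hab
    have h1 : (r : ℝ≥0∞) < edist a b := hD ha hb hab
    rw [edist_nndist, ENNReal.coe_lt_coe] at h1
    exact_mod_cast h1.le
  have hpack : Metric.packingNumber r A ≠ ⊤ := by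
    set N := ⌈(4 * (R + 2)) ^ n * r / (r : ℝ) ^ n⌉₊ with hN
    refine ne_top_of_le_ne_top (ENat.natCast_ne_top N) (iSup_le fun C => iSup_le fun hCA => iSup_le fun hC => ?_)
    by_contra! hcon
    obtain ⟨t, htC, ht⟩ := Set.exists_subset_encard_eq (s := C) (k := (N + 1 : ℕ))
      (by exact_mod_cast Order.add_one_le_of_lt hcon)
    have htfin : t.Finite := Set.finite_of_encard_eq_coe ht
    have h1 := hfin htfin.toFinset (by simpa using htC.trans hCA) (by
      rw [Set.Finite.coe_toFinset]; exact Set.Pairwise.mono htC hC)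
    have h2 : htfin.toFinset.card = N + 1 := by
      rw [htfin.encard_eq_coe_toFinset_card] at ht
      exact_mod_cast ht
    rw [h2, ← le_div_iff₀ (by positivity)] at h1
    have h3 := h1.trans (Nat.le_ceil _)
    rw [← hN] at h3
    push_cast at h3
    linarith
  obtain ⟨C, hCA, hCfin, hCsep, -⟩ := Metric.exists_set_encard_eq_packingNumber hpack
  set D := Metric.maximalSeparatedSet r A
  have hDfin : D.Finite := by
    have h1 := Metric.encard_maximalSeparatedSet hpack
    exact Set.encard_ne_top_iff.1 (by rw [h1]; exact hpack)
  refine ⟨hDfin.toFinset, ?_, ?_⟩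
  · simpa using Metric.isCover_maximalSeparatedSet hpack
  · exact hfin _ (by simpa using Metric.maximalSeparatedSet_subset)
      (by simpa using Metric.isSeparated_maximalSeparatedSet)

end Packing

/-! ### Codimension of the bifurcation set and volume of its neighbourhoods. -/

section Dimension

variable {n m : ℕ} {X : Set (Euc n)} {f g : Euc n → Euc m → ℝ}
  {y0 : Euc m} {Y Y' : Set (Euc m)} {Lg M gLow g0 fbar Lf : ℝ}

lemma isCompact_degenerate (hstd : StandingAssumptions X f g y0 Y Lg M gLow g0 fbar Lf)
    (hbdd : Bornology.IsBounded {y : Euc m | ∃ x ∈ X, IsDegenerateStationary g x y}) :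
    IsCompact {p : Euc n × Euc m | p.1 ∈ X ∧ IsDegenerateStationary g p.1 p.2} := by
  have hg := hstd.g_smooth
  refine (hstd.X_compact.prod hbdd.isCompact_closure).of_isClosed_subset ?_ ?_
  · have h1 : IsClosed {p : Euc n × Euc m | p.1 ∈ X} :=
      hstd.X_compact.isClosed.preimage continuous_fst
    have h2 : IsClosed {p : Euc n × Euc m | gradY g p.1 p.2 = 0} :=
      isClosed_eq (contDiff_gradY hg).continuous continuous_const
    have h3 : IsClosed {p : Euc n × Euc m |
        LinearMap.det (hessYY g p.1 p.2 : Euc m →ₗ[ℝ] Euc m) = 0} :=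
      isClosed_eq (ContinuousLinearMap.continuous_det.comp (contDiff_hessYY hg).continuous)
        continuous_const
    exact h1.inter (h2.inter h3)
  · exact fun p hp => ⟨hp.1, subset_closure ⟨p.1, hp.1, hp.2⟩⟩

lemma bifurcationSet_eq_image :
    bifurcationSet X g
      = Prod.fst '' {p : Euc n × Euc m | p.1 ∈ X ∧ IsDegenerateStationary g p.1 p.2} := by
  ext x
  constructor
  · rintro ⟨hx, h⟩
    simp only [IsMorseAt, not_forall, not_not] at h
    obtain ⟨y, hy1, hy2⟩ := h
    exact ⟨(x, y), ⟨hx, hy1, hy2⟩, rfl⟩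
  · rintro ⟨⟨x', y⟩, ⟨hx, hy1, hy2⟩, rfl⟩
    exact ⟨hx, fun h => h y hy1 hy2⟩

lemma isCompact_bifurcationSet (hstd : StandingAssumptions X f g y0 Y Lg M gLow g0 fbar Lf)
    (hbdd : Bornology.IsBounded {y : Euc m | ∃ x ∈ X, IsDegenerateStationary g x y}) :
    IsCompact (bifurcationSet X g) := by
  rw [bifurcationSet_eq_image]
  exact (isCompact_degenerate hstd hbdd).image continuous_fst

/-- Near a fold, the unfolding estimate with `a = 0` and zero gradient gives `s = 0` at every
degenerate pair. Differences of two zeros of `s` are nearly orthogonal to its derivative `w ≠ 0`,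
which is the transversality required for the cover. Compactness of the set of degenerate pairs makes
finitely many such pieces suffice. -/
lemma exists_cover_bifurcationSet (hstd : StandingAssumptions X f g y0 Y Lg M gLow g0 fbar Lf)
    (hbdd : Bornology.IsBounded {y : Euc m | ∃ x ∈ X, IsDegenerateStationary g x y})
    (hfold : ∀ x ∈ X, ∀ y, IsDegenerateStationary g x y → IsFold g x y) :
    ∃ C : ℝ, 0 ≤ C ∧ ∀ r : ℝ≥0, 0 < r → r ≤ 1 → ∃ D : Finset (Euc n),
      Metric.IsCover r (bifurcationSet X g) D ∧ (D.card : ℝ) * r ^ n ≤ C * r := by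
  have hg := hstd.g_smooth
  have hM := hstd.M_pos
  have hH : ∀ x ∈ X, ∀ y y', ‖hessYY g x y - hessYY g x y'‖ ≤ M * ‖y - y'‖ := fun x hx y y' => by
    have := hstd.hess_lipschitz x hx x hx y y'
    simpa [Real.sqrt_sq] using this
  obtain ⟨R, hR⟩ := hstd.X_compact.isBounded.exists_norm_le
  rw [bifurcationSet_eq_image]
  refine (isCompact_degenerate hstd hbdd).induction_on
    (p := fun S => ∃ C : ℝ, 0 ≤ C ∧ ∀ r : ℝ≥0, 0 < r → r ≤ 1 → ∃ D : Finset (Euc n),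
      Metric.IsCover r (Prod.fst '' S) (D : Set (Euc n)) ∧ (D.card : ℝ) * r ^ n ≤ C * r)
    ⟨0, le_rfl, fun r hr hr1 => ⟨∅, by simp⟩⟩ ?_ ?_ ?_
  · rintro S S' hSS' ⟨C, hC, h⟩
    refine ⟨C, hC, fun r hr hr1 => ?_⟩
    obtain ⟨D, hD, hDc⟩ := h r hr hr1
    exact ⟨D, hD.anti (Set.image_mono hSS'), hDc⟩
  · rintro S S' ⟨C, hC, h⟩ ⟨C', hC', h'⟩
    refine ⟨C + C', by positivity, fun r hr hr1 => ?_⟩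
    obtain ⟨D, hD, hDc⟩ := h r hr hr1
    obtain ⟨D', hD', hDc'⟩ := h' r hr hr1
    classical
    refine ⟨D ∪ D', ?_, ?_⟩
    · rw [Set.image_union, Finset.coe_union]
      rw [Metric.isCover_iff_subset_iUnion_closedBall] at *
      rw [Set.biUnion_union]
      exact Set.union_subset_union hD hD'
    · have h1 : ((D ∪ D').card : ℝ) ≤ D.card + D'.card := by exact_mod_cast Finset.card_union_le D D'
      calc _ ≤ ((D.card : ℝ) + D'.card) * r ^ n := by gcongr
        _ ≤ _ := by linarith
  · rintro ⟨xb, yb⟩ ⟨hxb, hdeg⟩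
    simp only at hxb hdeg
    have hf := hfold xb hxb yb hdeg
    obtain ⟨v, hv, hHv⟩ := hf.exists_unit_ker
    obtain ⟨s, hs, hs0, hsdeg, C1, hC1, hC1e⟩ := hf.exists_unfolding hg hv hHv hM hH
    set w := crossGrad g xb yb v with hw
    have hw0 : w ≠ 0 := hf.unfolding v hv hHv
    have hwn : 0 < ‖w‖ := norm_pos_iff.2 hw0
    obtain ⟨ρ, hρ, hball⟩ := HasStrictFDerivAt.exists_ball hs (ε := ‖w‖ / 2) (by positivity)
    have hfst : Tendsto (Prod.fst : Euc n × Euc m → Euc n) (𝓝 (xb, yb)) (𝓝 xb) :=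
      continuous_fst.tendsto (xb, yb)
    have hev := hC1e.and (hfst.eventually (Metric.ball_mem_nhds xb hρ))
    set U := {p : Euc n × Euc m | (p.1 ∈ X → ∀ (a : ℝ) (e : Euc m), ‖e‖ = 1 →
      hessYY g p.1 p.2 e = a • e → |s p.1| ≤ C1 * (‖gradY g p.1 p.2‖ + a ^ 2)) ∧
      p.1 ∈ Metric.ball xb ρ} with hU
    refine ⟨U ∩ {p : Euc n × Euc m | p.1 ∈ X ∧ IsDegenerateStationary g p.1 p.2},
      inter_mem (mem_nhdsWithin_of_mem_nhds hev) self_mem_nhdsWithin, (4 * (max R 0 + 2)) ^ n,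
      by positivity, ?_⟩
    have hzero : ∀ x ∈ Prod.fst '' (U ∩ {p : Euc n × Euc m | p.1 ∈ X ∧
        IsDegenerateStationary g p.1 p.2}), x ∈ X ∧ x ∈ Metric.ball xb ρ ∧ s x = 0 := by
      rintro _ ⟨⟨x, y⟩, ⟨⟨h1, h2⟩, hx, hxy⟩, rfl⟩
      simp only at h1 h2 hx hxy ⊢
      obtain ⟨e, he, hHe⟩ := (hfold x hx y hxy).exists_unit_ker
      have h3 := h1 hx 0 e he (by rw [hHe, zero_smul])
      rw [hxy.1, norm_zero] at h3
      refine ⟨hx, h2, abs_nonpos_iff.1 (h3.trans_eq (by ring))⟩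
    intro r hr hr1
    refine exists_cover_of_transversal (w := ‖w‖⁻¹ • w)
      (by rw [norm_smul, norm_inv, norm_norm, inv_mul_cancel₀ hwn.ne']) (le_max_right _ _)
      (fun a ha => (hR a (hzero a ha).1).trans (le_max_left _ _)) ?_ hr hr1
    intro a ha b hb
    obtain ⟨-, ha1, ha2⟩ := hzero a ha
    obtain ⟨-, hb1, hb2⟩ := hzero b hb
    have h3 := hball a ha1 b hb1
    rw [ha2, hb2, sub_zero, zero_sub, abs_neg] at h3
    rw [real_inner_smul_left, abs_mul, abs_inv, abs_norm, inv_mul_le_iff₀ hwn]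
    linarith

/-- The quotient whose upper limit is the upper Minkowski dimension. -/
noncomputable def boxQuotient {k : ℕ} (A : Set (Euc k)) (r : ℝ) : ℝ :=
  Real.log ((Metric.externalCoveringNumber r.toNNReal A).toNat : ℝ) / (-Real.log r)

lemma boxQuotient_nonneg {k : ℕ} (A : Set (Euc k)) : ∀ᶠ r : ℝ in 𝓝[>] 0, 0 ≤ boxQuotient A r := by
  filter_upwards [Ioo_mem_nhdsGT one_pos] with r hr
  refine div_nonneg (Real.log_natCast_nonneg _) ?_
  linarith [Real.log_nonpos hr.1.le hr.2.le]

lemma boxQuotient_le_of_cover {A : Set (Euc n)} {C : ℝ}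
    (h : ∀ r : ℝ≥0, 0 < r → r ≤ 1 → ∃ D : Finset (Euc n),
      Metric.IsCover r A D ∧ (D.card : ℝ) * r ^ n ≤ C * r) (hn : 1 ≤ n) :
    ∀ᶠ r : ℝ in 𝓝[>] 0, boxQuotient A r ≤ (n - 1 : ℝ) + Real.log (max C 1) / (-Real.log r) := by
  filter_upwards [Ioo_mem_nhdsGT one_pos] with r hr
  have hr0 : 0 < r := hr.1
  have hlog : 0 < -Real.log r := by linarith [Real.log_neg hr.1 hr.2]
  obtain ⟨D, hD, hDc⟩ := h r.toNNReal (by simpa using hr.1) (by simpa using hr.2.le)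
  rw [Real.coe_toNNReal r hr0.le] at hDc
  set N := (Metric.externalCoveringNumber r.toNNReal A).toNat with hN
  have hND : N ≤ D.card := by
    have h1 := hD.externalCoveringNumber_le_encard
    rw [Set.encard_coe_eq_coe_finsetCard] at h1
    exact ENat.toNat_le_of_le_natCast h1
  unfold boxQuotient
  rw [← hN, div_le_iff₀ hlog, add_mul, div_mul_cancel₀ _ hlog.ne']
  rcases Nat.eq_zero_or_pos N with h0 | h0
  · rw [h0, Nat.cast_zero, Real.log_zero]
    have h1 : (1 : ℝ) ≤ n := by exact_mod_cast hn
    have h2 : 0 ≤ Real.log (max C 1) := Real.log_nonneg (le_max_right _ _)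
    have h3 : 0 ≤ ((n : ℝ) - 1) * (-Real.log r) := mul_nonneg (by linarith) hlog.le
    linarith
  · have hNpos : (0 : ℝ) < N := by exact_mod_cast h0
    have h1 : (N : ℝ) * r ^ n ≤ max C 1 * r := by
      have : (N : ℝ) ≤ D.card := by exact_mod_cast hND
      calc _ ≤ (D.card : ℝ) * r ^ n := by gcongr
        _ ≤ C * r := hDc
        _ ≤ _ := by gcongr; exact le_max_left _ _
    have h2 := Real.log_le_log (by positivity) h1
    have hC1 : 0 < max C 1 := lt_max_of_lt_right one_pos
    rw [Real.log_mul hNpos.ne' (by positivity), Real.log_mul hC1.ne' hr0.ne', Real.log_pow] at h2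
    linarith

lemma tendsto_div_neg_log (c : ℝ) : Tendsto (fun r : ℝ => c / (-Real.log r)) (𝓝[>] 0) (𝓝 0) :=
  Tendsto.const_div_atTop (tendsto_neg_atBot_atTop.comp Real.tendsto_log_nhdsGT_zero) c

/-- The boundedness is recorded because a real-valued `limsup` controls the function eventually only
if the function is eventually bounded above. -/
lemma dimension_add_one_le (hstd : StandingAssumptions X f g y0 Y Lg M gLow g0 fbar Lf)
    (hbdd : Bornology.IsBounded {y : Euc m | ∃ x ∈ X, IsDegenerateStationary g x y})
    (hfold : ∀ x ∈ X, ∀ y, IsDegenerateStationary g x y → IsFold g x y)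
    (hdn : upperMinkowskiDim (bifurcationSet X g) < n) :
    (upperMinkowskiDim (bifurcationSet X g) + 1 ≤ n) ∧
      (𝓝[>] (0 : ℝ)).IsBoundedUnder (· ≤ ·) (boxQuotient (bifurcationSet X g)) := by
  have hlim : upperMinkowskiDim (bifurcationSet X g)
      = limsup (boxQuotient (bifurcationSet X g)) (𝓝[>] 0) := rfl
  -- In dimension `0` the vector `w` cannot be nonzero, so there are no folds; the bifurcation set
  -- is empty, of dimension `0`, against `d < n`.
  have hn : 1 ≤ n := by
    by_contra! hn0
    have hn0 : n = 0 := by omega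
    subst hn0
    have hempty : bifurcationSet X g = ∅ := by
      rw [bifurcationSet_eq_image, Set.image_eq_empty, Set.eq_empty_iff_forall_notMem]
      rintro ⟨x, y⟩ ⟨hx, hxy⟩
      have hf := hfold x hx y hxy
      obtain ⟨v, hv, hHv⟩ := hf.exists_unit_ker
      exact hf.unfolding v hv hHv (Subsingleton.elim _ _)
    rw [hempty] at hdn
    simp [upperMinkowskiDim] at hdn
  obtain ⟨C, hC, h⟩ := exists_cover_bifurcationSet hstd hbdd hfold
  have hle := boxQuotient_le_of_cover h hn
  have ht : Tendsto (fun r : ℝ => (n - 1 : ℝ) + Real.log (max C 1) / (-Real.log r)) (𝓝[>] 0)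
      (𝓝 ((n - 1 : ℝ) + 0)) := (tendsto_div_neg_log _).const_add _
  have hco : (𝓝[>] (0 : ℝ)).IsCoboundedUnder (· ≤ ·) (boxQuotient (bifurcationSet X g)) :=
    (isBoundedUnder_of_eventually_ge (boxQuotient_nonneg _)).isCoboundedUnder_le
  refine ⟨?_, ht.isBoundedUnder_le.mono_le hle⟩
  have := limsup_le_limsup hle hco ht.isBoundedUnder_le
  rw [ht.limsup_eq, ← hlim] at this
  linarith

/-- Since `d < (n + d)/2`, covering numbers at small scales are at most `δ^(-(n+d)/2)`; times the
volume of order `δ^n` of the enlarged balls this gives `δ^((n-d)/2)`. Half of the gap `n - d` is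
given up because the upper limit alone does not bound covering numbers by a multiple of `δ^(-d)`.
The exponent `-2/(n-d)` of `δ_t` compensates for it. -/
lemma volume_cthickening_le (hstd : StandingAssumptions X f g y0 Y Lg M gLow g0 fbar Lf)
    (hbdd : Bornology.IsBounded {y : Euc m | ∃ x ∈ X, IsDegenerateStationary g x y})
    (hfold : ∀ x ∈ X, ∀ y, IsDegenerateStationary g x y → IsFold g x y) {d : ℝ}
    (hd : d = upperMinkowskiDim (bifurcationSet X g)) (hdn : d < n) :
    ∃ C : ℝ, 0 ≤ C ∧ ∀ δ : ℝ, 0 < δ → δ ≤ 1 →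
      volume (Metric.cthickening δ (bifurcationSet X g))
        ≤ ENNReal.ofReal (C * δ ^ (((n : ℝ) - d) / 2)) := by
  set B := bifurcationSet X g with hB
  have hBc : IsCompact B := isCompact_bifurcationSet hstd hbdd
  have hbd := (dimension_add_one_le hstd hbdd hfold (hd ▸ hdn)).2
  have hlim : upperMinkowskiDim B = limsup (boxQuotient B) (𝓝[>] 0) := rfl
  have hlt : limsup (boxQuotient B) (𝓝[>] 0) < (n + d) / 2 := by rw [← hlim, ← hd]; linarith
  have hev := eventually_lt_of_limsup_lt hlt hbd
  rw [eventually_nhdsWithin_iff, Metric.eventually_nhds_iff] at hev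
  obtain ⟨r0, hr0, hev⟩ := hev
  set r1 := min (r0 / 2) (1 / 2) with hr1
  have hr1pos : 0 < r1 := by positivity
  set V := (volume (Metric.ball (0 : Euc n) 1)).toReal with hV
  have hVe : volume (Metric.ball (0 : Euc n) 1) = ENNReal.ofReal V :=
    (ENNReal.ofReal_toReal measure_ball_lt_top.ne).symm
  set W := (volume (Metric.cthickening 1 B)).toReal with hW
  have hWe : volume (Metric.cthickening 1 B) = ENNReal.ofReal W :=
    (ENNReal.ofReal_toReal (hBc.isBounded.cthickening.measure_lt_top).ne).symm
  have hV0 : 0 ≤ V := ENNReal.toReal_nonneg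
  have hW0 : 0 ≤ W := ENNReal.toReal_nonneg
  set e := ((n : ℝ) - d) / 2 with he
  have he0 : 0 < e := by rw [he]; linarith
  -- The first summand serves the scales where the covering bound holds; the second uses the total
  -- volume `W` for `δ > r1`.
  refine ⟨3 ^ n * V + W * r1⁻¹ ^ e, by positivity, fun δ hδ hδ1 => ?_⟩
  rcases le_or_gt δ r1 with hδr | hδr
  · have hδ1' : δ < 1 := by
      have := hδr.trans (min_le_right _ _)
      linarith
    have hlog : 0 < -Real.log δ := by linarith [Real.log_neg hδ hδ1']
    have hbox : boxQuotient B δ < (n + d) / 2 := by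
      refine hev ?_ hδ
      rw [Real.dist_eq, sub_zero, abs_of_pos hδ]
      have := hδr.trans (min_le_left _ _)
      linarith
    unfold boxQuotient at hbox
    obtain ⟨D0, -, hD0f, hD0c⟩ := Metric.exists_finite_isCover_of_isCompact
      (ε := δ.toNNReal) (by simpa using hδ) hBc
    have hfin : Metric.externalCoveringNumber δ.toNNReal B ≠ ⊤ :=
      ne_top_of_le_ne_top (Set.encard_ne_top_iff.2 hD0f) hD0c.externalCoveringNumber_le_encard
    set N := (Metric.externalCoveringNumber δ.toNNReal B).toNat with hN
    have hNe : (N : ℕ∞) = Metric.externalCoveringNumber δ.toNNReal B := ENat.natCast_toNat hfin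
    obtain ⟨D, hD, hDN⟩ : ∃ D : Set (Euc n), Metric.IsCover δ.toNNReal B D ∧ D.encard ≤ N := by
      have h1 : Metric.externalCoveringNumber δ.toNNReal B < (N : ℕ∞) + 1 := by
        rw [← hNe]; exact_mod_cast Nat.lt_succ_self N
      unfold Metric.externalCoveringNumber at h1
      simp only [iInf_lt_iff] at h1
      obtain ⟨D, hD, h2⟩ := h1
      exact ⟨D, hD, Order.le_of_lt_add_one h2⟩
    have hDfin : D.Finite := Set.encard_ne_top_iff.1 (ne_top_of_le_ne_top (ENat.natCast_ne_top N) hDN)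
    have hcard : hDfin.toFinset.card ≤ N := by
      rw [hDfin.encard_eq_coe_toFinset_card] at hDN
      exact_mod_cast hDN
    have hNle : (N : ℝ) ≤ δ ^ (-((n + d) / 2)) := by
      rcases Nat.eq_zero_or_pos N with h0 | h0
      · rw [h0, Nat.cast_zero]; positivity
      · rw [div_lt_iff₀ hlog] at hbox
        rw [← Real.log_le_log_iff (by exact_mod_cast h0) (by positivity), Real.log_rpow hδ]
        linarith
    have hsub : Metric.cthickening δ B ⊆ ⋃ c ∈ hDfin.toFinset, Metric.closedBall c (3 * δ) := by
      intro x hx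
      have hx' : x ∈ Metric.thickening (2 * δ) B :=
        Metric.cthickening_subset_thickening' (by positivity) (by linarith) B hx
      obtain ⟨z, hz, hxz⟩ := Metric.mem_thickening_iff.1 hx'
      have hz' := Metric.isCover_iff_subset_iUnion_closedBall.1 hD hz
      simp only [Set.mem_iUnion, exists_prop, Metric.mem_closedBall, Real.coe_toNNReal δ hδ.le] at hz'
      obtain ⟨c, hc, hzc⟩ := hz'
      simp only [Set.mem_iUnion, exists_prop, Metric.mem_closedBall, Set.Finite.mem_toFinset]
      exact ⟨c, hc, (dist_triangle x z c).trans (by linarith)⟩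
    calc volume (Metric.cthickening δ B)
        ≤ volume (⋃ c ∈ hDfin.toFinset, Metric.closedBall c (3 * δ)) := measure_mono hsub
      _ ≤ ∑ c ∈ hDfin.toFinset, volume (Metric.closedBall c (3 * δ)) :=
          measure_biUnion_finset_le _ _
      _ = ENNReal.ofReal (hDfin.toFinset.card * ((3 * δ) ^ n * V)) := by
          simp_rw [Measure.addHaar_closedBall volume _ (by positivity : 0 ≤ 3 * δ)]
          rw [Finset.sum_const, nsmul_eq_mul, hVe, finrank_euclideanSpace_fin,
            ← ENNReal.ofReal_mul (by positivity), ← ENNReal.ofReal_natCast,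
            ← ENNReal.ofReal_mul (Nat.cast_nonneg _)]
      _ ≤ _ := by
          refine ENNReal.ofReal_le_ofReal ?_
          have h1 : (hDfin.toFinset.card : ℝ) ≤ δ ^ (-((n + d) / 2)) :=
            le_trans (by exact_mod_cast hcard) hNle
          have h2 : δ ^ (-((n + d) / 2)) * δ ^ n = δ ^ e := by
            rw [← Real.rpow_natCast, ← Real.rpow_add hδ, he]
            congr 1; ring
          calc (hDfin.toFinset.card : ℝ) * ((3 * δ) ^ n * V)
              ≤ δ ^ (-((n + d) / 2)) * ((3 * δ) ^ n * V) := by gcongr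
            _ = 3 ^ n * V * (δ ^ (-((n + d) / 2)) * δ ^ n) := by rw [mul_pow]; ring
            _ = 3 ^ n * V * δ ^ e := by rw [h2]
            _ ≤ _ := by
              gcongr
              have : 0 ≤ W * r1⁻¹ ^ e := by positivity
              linarith
  · refine (measure_mono (Metric.cthickening_mono hδ1 B)).trans ?_
    rw [hWe]
    refine ENNReal.ofReal_le_ofReal ?_
    have h1 : 1 ≤ r1⁻¹ ^ e * δ ^ e := by
      rw [← Real.mul_rpow (by positivity) hδ.le]
      refine Real.one_le_rpow ?_ he0.le
      rw [inv_mul_eq_div, one_le_div hr1pos]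
      exact hδr.le
    have h2 : 0 ≤ 3 ^ n * V * δ ^ e := by positivity
    nlinarith

end Dimension

/-! ### The standard Gaussian measure -/

section Gaussian

variable {n : ℕ}

/-- Density of the standard Gaussian measure on `ℝⁿ`. -/
noncomputable def gaussDensity (n : ℕ) (u : Euc n) : ℝ :=
  ((2 * Real.pi) ^ ((n : ℝ) / 2))⁻¹ * Real.exp (-(1 / 2) * ‖u‖ ^ 2)

lemma gaussDensity_pos (u : Euc n) : 0 < gaussDensity n u := by
  unfold gaussDensity; positivity

lemma continuous_gaussDensity : Continuous (gaussDensity n) := by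
  unfold gaussDensity; fun_prop

lemma integrable_gaussDensity : Integrable (gaussDensity n) := by
  have h := (GaussianFourier.integrable_cexp_neg_mul_sq_norm_add (V := Euc n) (b := (1 / 2 : ℂ))
    (by norm_num) 0 0).norm
  refine (h.const_mul ((2 * Real.pi) ^ ((n : ℝ) / 2))⁻¹).congr (Eventually.of_forall fun u => ?_)
  simp only [gaussDensity, Complex.norm_exp]
  congr 2
  rw [zero_mul, add_zero]
  have : (-(1 / 2 : ℂ) * (‖u‖ : ℂ) ^ 2) = ((-(1 / 2) * ‖u‖ ^ 2 : ℝ) : ℂ) := by push_cast; ring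
  rw [this, Complex.ofReal_re]

lemma stdGaussian_eq_withDensity :
    stdGaussian (Euc n) = volume.withDensity fun u => ENNReal.ofReal (gaussDensity n u) := by
  have hfin : IsFiniteMeasure (volume.withDensity fun u => ENNReal.ofReal (gaussDensity n u)) :=
    isFiniteMeasure_withDensity_ofReal integrable_gaussDensity.2
  refine Measure.ext_of_charFun ?_
  ext t
  rw [charFun_stdGaussian, charFun_apply, integral_withDensity_eq_integral_toReal_smul
    (by exact continuous_gaussDensity.measurable.ennreal_ofReal)
    (Eventually.of_forall fun _ => ENNReal.ofReal_lt_top)]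
  have h1 : ∀ u : Euc n, (ENNReal.ofReal (gaussDensity n u)).toReal •
      Complex.exp ((inner ℝ u t : ℝ) * Complex.I)
      = (((2 * Real.pi) ^ ((n : ℝ) / 2))⁻¹ : ℝ) •
        Complex.exp (-(1 / 2 : ℂ) * (‖u‖ : ℂ) ^ 2 + Complex.I * (inner ℝ t u : ℝ)) := by
    intro u
    rw [ENNReal.toReal_ofReal (gaussDensity_pos u).le, gaussDensity, mul_smul]
    congr 1
    rw [Complex.real_smul, Complex.ofReal_exp, ← Complex.exp_add, real_inner_comm]
    congr 1
    push_cast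
    ring
  simp_rw [h1]
  rw [integral_smul, GaussianFourier.integral_cexp_neg_mul_sq_norm_add (by norm_num),
    finrank_euclideanSpace_fin, Complex.I_sq, Complex.real_smul]
  have h2 : ((Real.pi : ℂ) / (1 / 2 : ℂ)) ^ ((n : ℂ) / 2)
      = (((2 * Real.pi) ^ ((n : ℝ) / 2) : ℝ) : ℂ) := by
    rw [Complex.ofReal_cpow (by positivity)]
    congr 1
    · push_cast; ring
    · push_cast; ring
  rw [h2, ← mul_assoc, ← Complex.ofReal_mul, inv_mul_cancel₀ (by positivity), Complex.ofReal_one,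
    one_mul]
  congr 1
  ring

lemma stdGaussian_le : stdGaussian (Euc n) ≤
    ENNReal.ofReal ((2 * Real.pi) ^ ((n : ℝ) / 2))⁻¹ • volume := by
  rw [stdGaussian_eq_withDensity, ← withDensity_const]
  refine withDensity_mono (Eventually.of_forall fun u => ENNReal.ofReal_le_ofReal ?_)
  unfold gaussDensity
  refine mul_le_of_le_one_right (by positivity) (Real.exp_le_one_iff.2 ?_)
  nlinarith [sq_nonneg ‖u‖]

/-- The density of a shifted Gaussian with respect to the Gaussian. -/
noncomputable def shiftDensity (h u : Euc n) : ℝ := Real.exp (inner ℝ u h - ‖h‖ ^ 2 / 2)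

lemma continuous_shiftDensity (h : Euc n) : Continuous (shiftDensity h) := by
  unfold shiftDensity; fun_prop

lemma shiftDensity_pos (h u : Euc n) : 0 < shiftDensity h u := Real.exp_pos _

/-- The Cameron-Martin formula, from `‖u + h‖² = ‖u‖² + 2⟨u, h⟩ + ‖h‖²` in the exponent. -/
lemma stdGaussian_map_add (h : Euc n) : (stdGaussian (Euc n)).map (fun u => u + h)
    = (stdGaussian (Euc n)).withDensity fun u => ENNReal.ofReal (shiftDensity h u) := by
  have hm1 : Measurable fun u : Euc n => ENNReal.ofReal (gaussDensity n u) :=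
    continuous_gaussDensity.measurable.ennreal_ofReal
  have hm2 : Measurable fun u : Euc n => ENNReal.ofReal (shiftDensity h u) :=
    (continuous_shiftDensity h).measurable.ennreal_ofReal
  rw [stdGaussian_eq_withDensity, ← withDensity_mul _ hm1 hm2]
  ext s hs
  have hmap : Measurable fun u : Euc n => u + h := measurable_add_const h
  rw [Measure.map_apply hmap hs, withDensity_apply _ (hmap hs), withDensity_apply _ hs,
    ← lintegral_indicator (hmap hs), ← lintegral_indicator hs,
    ← lintegral_add_right_eq_self (fun u => s.indicator ((fun u => ENNReal.ofReal
      (gaussDensity n u)) * fun u => ENNReal.ofReal (shiftDensity h u)) u) h]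
  refine lintegral_congr fun u => ?_
  by_cases hu : u + h ∈ s
  · rw [Set.indicator_of_mem (show u ∈ (fun u => u + h) ⁻¹' s from hu), Set.indicator_of_mem hu,
      Pi.mul_apply, ← ENNReal.ofReal_mul (gaussDensity_pos _).le, gaussDensity, gaussDensity,
      shiftDensity, mul_assoc, ← Real.exp_add]
    congr 3
    rw [norm_add_sq_real, inner_add_left, real_inner_self_eq_norm_sq]
    ring
  · rw [Set.indicator_of_notMem (show u ∉ (fun u => u + h) ⁻¹' s from hu),
      Set.indicator_of_notMem hu]

lemma lintegral_stdGaussian_add (h : Euc n) {φ : Euc n → ℝ≥0∞} (hφ : Measurable φ) :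
    ∫⁻ u, φ (u + h) ∂(stdGaussian (Euc n))
      = ∫⁻ u, ENNReal.ofReal (shiftDensity h u) * φ u ∂(stdGaussian (Euc n)) := by
  rw [← lintegral_map hφ (measurable_add_const h), stdGaussian_map_add,
    lintegral_withDensity_eq_lintegral_mul _ (continuous_shiftDensity h).measurable.ennreal_ofReal hφ]
  rfl

lemma integral_stdGaussian_add (h : Euc n) {φ : Euc n → ℝ} (hφ : Measurable φ) :
    ∫ u, φ (u + h) ∂(stdGaussian (Euc n)) = ∫ u, shiftDensity h u * φ u ∂(stdGaussian (Euc n)) := by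
  rw [← integral_map (measurable_add_const h).aemeasurable hφ.aestronglyMeasurable,
    stdGaussian_map_add, integral_withDensity_eq_integral_toReal_smul
      (continuous_shiftDensity h).measurable.ennreal_ofReal
      (Eventually.of_forall fun _ => ENNReal.ofReal_lt_top)]
  refine integral_congr_ae (Eventually.of_forall fun u => ?_)
  simp only [smul_eq_mul]
  rw [ENNReal.toReal_ofReal (shiftDensity_pos h u).le]

lemma integrable_shiftDensity (h : Euc n) : Integrable (shiftDensity h) (stdGaussian (Euc n)) := by
  refine ⟨(continuous_shiftDensity h).aestronglyMeasurable, ?_⟩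
  rw [hasFiniteIntegral_iff_ofReal (Eventually.of_forall fun u => (shiftDensity_pos h u).le)]
  have := lintegral_stdGaussian_add h (φ := fun _ => 1) measurable_const
  simp only [mul_one, lintegral_one, measure_univ] at this
  rw [← this]
  exact ENNReal.one_lt_top

lemma memLp_id_stdGaussian : MemLp (fun u : Euc n => u) 2 (stdGaussian (Euc n)) :=
  IsGaussian.memLp_two_id

lemma integrable_norm_sq_stdGaussian :
    Integrable (fun u : Euc n => ‖u‖ ^ 2) (stdGaussian (Euc n)) :=
  memLp_id_stdGaussian.integrable_norm_pow (by norm_num)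

lemma integrable_id_stdGaussian : Integrable (fun u : Euc n => u) (stdGaussian (Euc n)) :=
  IsGaussian.integrable_id

lemma integrable_inner_stdGaussian (h : Euc n) :
    Integrable (fun u : Euc n => (inner ℝ u h : ℝ)) (stdGaussian (Euc n)) :=
  integrable_id_stdGaussian.inner_const h

lemma integrable_inner_sq_stdGaussian (h : Euc n) :
    Integrable (fun u : Euc n => (inner ℝ u h : ℝ) ^ 2) (stdGaussian (Euc n)) :=
  (memLp_id_stdGaussian.inner_const h).integrable_sq

lemma integral_inner_sq_stdGaussian (h : Euc n) :
    ∫ u, (inner ℝ u h : ℝ) ^ 2 ∂(stdGaussian (Euc n)) = ‖h‖ ^ 2 := by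
  have h1 := variance_dual_stdGaussian (innerSL ℝ h : StrongDual ℝ (Euc n))
  rw [variance_eq_integral (by fun_prop), integral_strongDual_stdGaussian, innerSL_apply_norm] at h1
  rw [← h1]
  refine integral_congr_ae (Eventually.of_forall fun u => ?_)
  simp [real_inner_comm]

/-- Taylor's formula with integral remainder on `[0, 1]` for `q r = exp (r z - r² s² / 2)`; the
antiderivative of `(1 - r) q''` is `q + (1 - r) q'`. -/
lemma taylor_shift (z s : ℝ) : Real.exp (z - s ^ 2 / 2) - 1 - z
    = ∫ r in (0 : ℝ)..1, (1 - r) * (((z - r * s ^ 2) ^ 2 - s ^ 2)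
      * Real.exp (r * z - r ^ 2 * s ^ 2 / 2)) := by
  have hq : ∀ r : ℝ, HasDerivAt (fun r : ℝ => Real.exp (r * z - r ^ 2 * s ^ 2 / 2))
      (Real.exp (r * z - r ^ 2 * s ^ 2 / 2) * (z - r * s ^ 2)) r := by
    intro r
    have h1 : HasDerivAt (fun r : ℝ => r * z - r ^ 2 * s ^ 2 / 2) (z - r * s ^ 2) r := by
      have := ((hasDerivAt_id r).mul_const z).sub (((hasDerivAt_pow 2 r).mul_const (s ^ 2)).div_const 2)
      refine this.congr_deriv ?_
      push_cast; ring
    exact h1.exp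
  have hF : ∀ r : ℝ, HasDerivAt (fun r : ℝ => Real.exp (r * z - r ^ 2 * s ^ 2 / 2)
      + (1 - r) * (Real.exp (r * z - r ^ 2 * s ^ 2 / 2) * (z - r * s ^ 2)))
      ((1 - r) * (((z - r * s ^ 2) ^ 2 - s ^ 2) * Real.exp (r * z - r ^ 2 * s ^ 2 / 2))) r := by
    intro r
    have h1 : HasDerivAt (fun r : ℝ => z - r * s ^ 2) (-s ^ 2) r := by
      refine (((hasDerivAt_id r).mul_const (s ^ 2)).const_sub z).congr_deriv ?_
      ring
    have h2 : HasDerivAt (fun r : ℝ => 1 - r) (-1) r := by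
      simpa using (hasDerivAt_id r).const_sub 1
    have := (hq r).add (h2.mul ((hq r).mul h1))
    refine this.congr_deriv ?_
    simp only [Pi.mul_apply]
    ring
  rw [intervalIntegral.integral_eq_sub_of_hasDerivAt (fun r _ => hF r)
    (Continuous.intervalIntegrable (by fun_prop) _ _)]
  simp
  ring

/-- After Fubini, the weight in the remainder is the density of the Gaussian shifted by `r h`.
Undoing the shift turns `⟨u, h⟩ - r ‖h‖²` into `⟨u, h⟩`, so the inner integral is at most `2 ‖h‖²`
for every `r`, and `∫ (1 - r) = 1/2`. -/
lemma lintegral_shiftDensity_taylor_le (h : Euc n) :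
    ∫⁻ u, ENNReal.ofReal |shiftDensity h u - 1 - inner ℝ u h| ∂(stdGaussian (Euc n))
      ≤ ENNReal.ofReal (‖h‖ ^ 2) := by
  set γ := stdGaussian (Euc n)
  set κ : Euc n → ℝ → ℝ := fun u r => |(inner ℝ u h - r * ‖h‖ ^ 2) ^ 2 - ‖h‖ ^ 2| with hκ
  have hpt : ∀ u : Euc n, ENNReal.ofReal |shiftDensity h u - 1 - inner ℝ u h|
      ≤ ∫⁻ r in Set.Ioc (0 : ℝ) 1, ENNReal.ofReal (1 - r) *
        (ENNReal.ofReal (shiftDensity (r • h) u) * ENNReal.ofReal (κ u r)) := by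
    intro u
    have h0 : shiftDensity h u = Real.exp (inner ℝ u h - ‖h‖ ^ 2 / 2) := rfl
    rw [h0, taylor_shift, intervalIntegral.integral_of_le zero_le_one, ← Real.norm_eq_abs,
      ofReal_norm]
    refine (enorm_integral_le_lintegral_enorm _).trans (setLIntegral_mono_ae' measurableSet_Ioc
      (Eventually.of_forall fun r hr => le_of_eq ?_))
    have h1 : (0 : ℝ) ≤ 1 - r := by linarith [hr.2]
    rw [← ofReal_norm, norm_mul, norm_mul, Real.norm_of_nonneg h1, Real.norm_eq_abs,
      Real.norm_of_nonneg (Real.exp_pos _).le, ENNReal.ofReal_mul h1,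
      mul_comm |_|, ENNReal.ofReal_mul (Real.exp_pos _).le]
    congr 3
    unfold shiftDensity
    rw [real_inner_smul_right, norm_smul, mul_pow, Real.norm_eq_abs, sq_abs]
  have hmeas : Measurable fun p : Euc n × ℝ => ENNReal.ofReal (1 - p.2) *
        (ENNReal.ofReal (shiftDensity (p.2 • h) p.1) * ENNReal.ofReal (κ p.1 p.2)) := by
    have h1 : Continuous fun p : Euc n × ℝ => shiftDensity (p.2 • h) p.1 := by
      unfold shiftDensity; fun_prop
    have h2 : Continuous fun p : Euc n × ℝ => κ p.1 p.2 := by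
      simp only [hκ]; fun_prop
    have h3 : Continuous fun p : Euc n × ℝ => 1 - p.2 := by fun_prop
    exact h3.measurable.ennreal_ofReal.mul (h1.measurable.ennreal_ofReal.mul h2.measurable.ennreal_ofReal)
  have hinner : ∀ r : ℝ, ∫⁻ u, ENNReal.ofReal (shiftDensity (r • h) u) * ENNReal.ofReal (κ u r) ∂γ
      ≤ ENNReal.ofReal (2 * ‖h‖ ^ 2) := by
    intro r
    have hm : Measurable fun u : Euc n => ENNReal.ofReal (κ u r) := by
      have : Continuous fun u : Euc n => κ u r := by simp only [hκ]; fun_prop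
      exact this.measurable.ennreal_ofReal
    rw [← lintegral_stdGaussian_add (r • h) hm]
    have hint : Integrable (fun u : Euc n => (inner ℝ u h : ℝ) ^ 2 + ‖h‖ ^ 2) γ :=
      (integrable_inner_sq_stdGaussian h).add (integrable_const _)
    have h1 : ∫ u, ((inner ℝ u h : ℝ) ^ 2 + ‖h‖ ^ 2) ∂γ = 2 * ‖h‖ ^ 2 := by
      rw [integral_add (integrable_inner_sq_stdGaussian h) (integrable_const _),
        integral_inner_sq_stdGaussian, integral_const]
      simp
      ring
    rw [← h1, ofReal_integral_eq_lintegral_ofReal hint (Eventually.of_forall fun u => by positivity)]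
    refine lintegral_mono fun u => ENNReal.ofReal_le_ofReal ?_
    simp only [hκ]
    rw [inner_add_left, real_inner_smul_left, real_inner_self_eq_norm_sq, add_sub_cancel_right]
    refine (abs_sub _ _).trans ?_
    rw [abs_of_nonneg (by positivity), abs_of_nonneg (by positivity)]
  calc ∫⁻ u, ENNReal.ofReal |shiftDensity h u - 1 - inner ℝ u h| ∂γ
      ≤ ∫⁻ u, (∫⁻ r in Set.Ioc (0 : ℝ) 1, ENNReal.ofReal (1 - r) *
        (ENNReal.ofReal (shiftDensity (r • h) u) * ENNReal.ofReal (κ u r))) ∂γ :=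
        lintegral_mono hpt
    _ = ∫⁻ r in Set.Ioc (0 : ℝ) 1, ∫⁻ u, ENNReal.ofReal (1 - r) *
        (ENNReal.ofReal (shiftDensity (r • h) u) * ENNReal.ofReal (κ u r)) ∂γ :=
        lintegral_lintegral_swap hmeas.aemeasurable
    _ ≤ ∫⁻ r in Set.Ioc (0 : ℝ) 1, ENNReal.ofReal (1 - r) * ENNReal.ofReal (2 * ‖h‖ ^ 2) := by
        refine lintegral_mono fun r => ?_
        rw [lintegral_const_mul' _ _ ENNReal.ofReal_ne_top]
        gcongr
        exact hinner r
    _ = ENNReal.ofReal (1 / 2) * ENNReal.ofReal (2 * ‖h‖ ^ 2) := by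
        rw [lintegral_mul_const' _ _ ENNReal.ofReal_ne_top]
        congr 1
        rw [← ofReal_integral_eq_lintegral_ofReal, ← intervalIntegral.integral_of_le zero_le_one]
        · congr 1
          rw [intervalIntegral.integral_sub (by simp) (by simp)]
          simp; norm_num
        · exact (Continuous.integrableOn_Icc (by fun_prop)).mono_set Set.Ioc_subset_Icc_self
        · exact (ae_restrict_iff' measurableSet_Ioc).2 (Eventually.of_forall fun r hr => by
            simpa using hr.2)
    _ = _ := by
        rw [← ENNReal.ofReal_mul (by norm_num)]
        congr 1; ring

/-- Gaussian smoothing of `F` with parameter `ξ`. -/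
noncomputable def gaussSmooth (F : Euc n → ℝ) (ξ : ℝ) (x : Euc n) : ℝ :=
  ∫ u, F (x + ξ • u) ∂(stdGaussian (Euc n))

/-- Gradient of the Gaussian smoothing of `F`. -/
noncomputable def gaussSmoothGrad (F : Euc n → ℝ) (ξ : ℝ) (x : Euc n) : Euc n :=
  (1 / ξ) • ∫ u, F (x + ξ • u) • u ∂(stdGaussian (Euc n))

lemma measurable_comp_affine {F : Euc n → ℝ} (hF : Measurable F) (x : Euc n) (ξ : ℝ) :
    Measurable fun u : Euc n => F (x + ξ • u) := by
  refine hF.comp ?_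
  fun_prop

lemma integrable_smul_id {F : Euc n → ℝ} (hF : Measurable F) {b : ℝ} (hb : ∀ x, |F x| ≤ b)
    (x : Euc n) (ξ : ℝ) :
    Integrable (fun u : Euc n => F (x + ξ • u) • u) (stdGaussian (Euc n)) :=
  integrable_id_stdGaussian.bdd_smul b
    (measurable_comp_affine hF x ξ).aestronglyMeasurable
    (Eventually.of_forall fun _ => hb _)

lemma integrable_comp_affine {F : Euc n → ℝ} (hF : Measurable F) {b : ℝ} (hb : ∀ x, |F x| ≤ b)
    (x : Euc n) (ξ : ℝ) :
    Integrable (fun u : Euc n => F (x + ξ • u)) (stdGaussian (Euc n)) :=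
  Integrable.of_bound (measurable_comp_affine hF x ξ).aestronglyMeasurable b
    (Eventually.of_forall fun _ => hb _)

lemma abs_gaussSmooth_le {F : Euc n → ℝ} {b : ℝ} (hb : ∀ x, |F x| ≤ b)
    (ξ : ℝ) (x : Euc n) : |gaussSmooth F ξ x| ≤ b := by
  have := norm_integral_le_of_norm_le_const (μ := stdGaussian (Euc n)) (C := b)
    (f := fun u => F (x + ξ • u)) (Eventually.of_forall fun _ => hb _)
  unfold gaussSmooth
  simpa using this

/-- With `h = a/ξ` the shift by `a` is absorbed into `shiftDensity h`. Its first-order expansion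
reproduces the gradient term, and the remainder has `L¹` norm at most `‖h‖²`, multiplied by the
bound `b` of `F`. -/
lemma gaussSmooth_add_le {F : Euc n → ℝ} (hF : Measurable F) {b : ℝ} (hb : ∀ x, |F x| ≤ b)
    {ξ : ℝ} (hξ : 0 < ξ) (x a : Euc n) :
    gaussSmooth F ξ (x + a) ≤ gaussSmooth F ξ x + inner ℝ (gaussSmoothGrad F ξ x) a
      + b / ξ ^ 2 * ‖a‖ ^ 2 := by
  have hb0 : 0 ≤ b := (abs_nonneg _).trans (hb x)
  set γ := stdGaussian (Euc n) with hγ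
  set h := (1 / ξ) • a with hh
  have hah : a = ξ • h := by rw [hh, smul_smul, mul_one_div_cancel hξ.ne', one_smul]
  have hm := measurable_comp_affine hF x ξ
  have h1 : gaussSmooth F ξ (x + a) = ∫ u, shiftDensity h u * F (x + ξ • u) ∂γ := by
    rw [← integral_stdGaussian_add h hm]
    unfold gaussSmooth
    refine integral_congr_ae (Eventually.of_forall fun u => ?_)
    simp only
    congr 1
    rw [hah, smul_add]; abel
  have h2 : inner ℝ (gaussSmoothGrad F ξ x) a = ∫ u, inner ℝ u h * F (x + ξ • u) ∂γ := by
    unfold gaussSmoothGrad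
    rw [real_inner_smul_left, ← real_inner_smul_right, ← hh, real_inner_comm,
      ← integral_inner (integrable_smul_id hF hb x ξ)]
    refine integral_congr_ae (Eventually.of_forall fun u => ?_)
    simp only
    rw [real_inner_smul_right, real_inner_comm, mul_comm]
  have hbd : ∀ᵐ u ∂γ, ‖F (x + ξ • u)‖ ≤ b := Eventually.of_forall fun _ => hb _
  have i1 : Integrable (fun u => shiftDensity h u * F (x + ξ • u)) γ :=
    (integrable_shiftDensity h).mul_bdd hm.aestronglyMeasurable hbd
  have i2 : Integrable (fun u => inner ℝ u h * F (x + ξ • u)) γ :=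
    (integrable_inner_stdGaussian h).mul_bdd hm.aestronglyMeasurable hbd
  have i3 := integrable_comp_affine hF hb x ξ
  have i4 : Integrable (fun u => |shiftDensity h u - 1 - inner ℝ u h|) γ :=
    (((integrable_shiftDensity h).sub (integrable_const 1)).sub
      (integrable_inner_stdGaussian h)).abs
  have h3 : ∫ u, |shiftDensity h u - 1 - inner ℝ u h| ∂γ ≤ ‖h‖ ^ 2 := by
    have h4 := lintegral_shiftDensity_taylor_le h
    rw [← ofReal_integral_eq_lintegral_ofReal i4 (Eventually.of_forall fun u => abs_nonneg _)] at h4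
    exact (ENNReal.ofReal_le_ofReal_iff (by positivity)).1 h4
  have h5 : gaussSmooth F ξ (x + a) - gaussSmooth F ξ x - inner ℝ (gaussSmoothGrad F ξ x) a
      = ∫ u, (shiftDensity h u - 1 - inner ℝ u h) * F (x + ξ • u) ∂γ := by
    rw [h1, h2]
    unfold gaussSmooth
    have i13 : Integrable (fun u => shiftDensity h u * F (x + ξ • u) - F (x + ξ • u)) γ := i1.sub i3
    rw [← integral_sub i1 i3, ← integral_sub i13 i2]
    refine integral_congr_ae (Eventually.of_forall fun u => ?_)
    simp only
    ring
  have h6 : ∫ u, (shiftDensity h u - 1 - inner ℝ u h) * F (x + ξ • u) ∂γ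
      ≤ ∫ u, |shiftDensity h u - 1 - inner ℝ u h| * b ∂γ := by
    refine integral_mono (((((integrable_shiftDensity h).sub (integrable_const 1)).sub
      (integrable_inner_stdGaussian h))).mul_bdd hm.aestronglyMeasurable hbd) (i4.mul_const b) fun u => ?_
    refine (le_abs_self _).trans ?_
    rw [abs_mul]
    exact mul_le_mul_of_nonneg_left (hb _) (abs_nonneg _)
  rw [integral_mul_const] at h6
  have h7 : ‖h‖ ^ 2 = ‖a‖ ^ 2 / ξ ^ 2 := by
    rw [hh, norm_smul, mul_pow, Real.norm_of_nonneg (by positivity)]; ring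
  have h8 : ‖h‖ ^ 2 * b = b / ξ ^ 2 * ‖a‖ ^ 2 := by rw [h7]; ring
  have h9 := mul_le_mul_of_nonneg_right h3 hb0
  linarith

end Gaussian

/-! ### The bias of the gradient estimator -/

section GaussianBias

variable {n : ℕ}

lemma stdGaussian_affine_preimage_le {ξ : ℝ} (hξ : 0 < ξ) {S : Set (Euc n)}
    {v : ℝ} (hv : volume S ≤ ENNReal.ofReal v) (x : Euc n) :
    stdGaussian (Euc n) {u | x + ξ • u ∈ S}
      ≤ ENNReal.ofReal (((2 * Real.pi) ^ ((n : ℝ) / 2))⁻¹ * ((ξ ^ n)⁻¹ * v)) := by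
  refine (stdGaussian_le _).trans ?_
  rw [Measure.smul_apply, smul_eq_mul, ENNReal.ofReal_mul (by positivity),
    ENNReal.ofReal_mul (by positivity)]
  gcongr
  have h1 : {u : Euc n | x + ξ • u ∈ S} = (ξ • ·) ⁻¹' ((fun u => x + u) ⁻¹' S) := rfl
  rw [h1, Measure.addHaar_preimage_smul _ hξ.ne', measure_preimage_add, finrank_euclideanSpace_fin,
    abs_of_pos (by positivity)]
  gcongr

lemma integral_sq_sub_comp_affine_le {F F' : Euc n → ℝ}
    {b : ℝ} (hb : ∀ x, |F x| ≤ b) (hb' : ∀ x, |F' x| ≤ b) {ξ : ℝ} (hξ : 0 < ξ) {S : Set (Euc n)}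
    (hS : MeasurableSet S) {v : ℝ} (hv0 : 0 ≤ v) (hv : volume S ≤ ENNReal.ofReal v) {c : ℝ}
    (hc : ∀ x ∉ S, |F x - F' x| ≤ c) (x : Euc n) :
    ∫ u, (F (x + ξ • u) - F' (x + ξ • u)) ^ 2 ∂(stdGaussian (Euc n))
      ≤ c ^ 2 + 4 * b ^ 2 * (((2 * Real.pi) ^ ((n : ℝ) / 2))⁻¹ * ((ξ ^ n)⁻¹ * v)) := by
  set γ := stdGaussian (Euc n)
  set A : Set (Euc n) := {u | x + ξ • u ∈ S} with hA
  have hAm : MeasurableSet A := by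
    have : Measurable fun u : Euc n => x + ξ • u := by fun_prop
    exact this hS
  have hγA : γ.real A ≤ ((2 * Real.pi) ^ ((n : ℝ) / 2))⁻¹ * ((ξ ^ n)⁻¹ * v) :=
    ENNReal.toReal_le_of_le_ofReal (by positivity) (stdGaussian_affine_preimage_le hξ hv x)
  have hi : Integrable (fun u => c ^ 2 + A.indicator (fun _ => 4 * b ^ 2) u) γ :=
    (integrable_const _).add ((integrable_const _).indicator hAm)
  have h1 : ∫ u, (F (x + ξ • u) - F' (x + ξ • u)) ^ 2 ∂γ
      ≤ ∫ u, (c ^ 2 + A.indicator (fun _ => 4 * b ^ 2) u) ∂γ := by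
    refine integral_mono_of_nonneg (Eventually.of_forall fun u => sq_nonneg _) hi
      (Eventually.of_forall fun u => ?_)
    simp only
    by_cases hu : u ∈ A
    · rw [Set.indicator_of_mem hu]
      have h2 := abs_le.1 (hb (x + ξ • u))
      have h3 := abs_le.1 (hb' (x + ξ • u))
      have h4 : (F (x + ξ • u) - F' (x + ξ • u)) ^ 2 ≤ (2 * b) ^ 2 :=
        sq_le_sq' (by linarith) (by linarith)
      nlinarith [sq_nonneg c]
    · rw [Set.indicator_of_notMem hu, add_zero, ← sq_abs]
      exact pow_le_pow_left₀ (abs_nonneg _) (hc _ hu) 2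
  refine h1.trans ?_
  rw [integral_add (integrable_const _) ((integrable_const _).indicator hAm), integral_const,
    integral_indicator_const _ hAm]
  simp only [probReal_univ, smul_eq_mul, one_mul]
  nlinarith [sq_nonneg b]

/-- By Cauchy-Schwarz the squared bias is governed by a mean square, hence linearly by the Gaussian
mass of the exceptional set. -/
lemma norm_sq_integral_smul_le {D : Euc n → ℝ} (hD : Measurable D) {b : ℝ} (hb : ∀ u, |D u| ≤ b) :
    ‖∫ u, D u • u ∂(stdGaussian (Euc n))‖ ^ 2
      ≤ (∫ u, D u ^ 2 ∂(stdGaussian (Euc n))) * ∫ u, ‖u‖ ^ 2 ∂(stdGaussian (Euc n)) := by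
  set γ := stdGaussian (Euc n)
  have h1 : ‖∫ u, D u • u ∂γ‖ ≤ ∫ u, ‖D u‖ * ‖u‖ ∂γ := by
    refine (norm_integral_le_integral_norm _).trans (le_of_eq ?_)
    simp_rw [norm_smul]
  have hDL : MemLp D (ENNReal.ofReal 2) γ :=
    MemLp.of_bound hD.aestronglyMeasurable b (Eventually.of_forall fun u => hb u)
  have hiL : MemLp (fun u : Euc n => u) (ENNReal.ofReal 2) γ := by
    simpa using memLp_id_stdGaussian (n := n)
  have h2 := integral_mul_norm_le_Lp_mul_Lq (μ := γ) (f := D) (g := fun u : Euc n => ‖u‖)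
    Real.HolderConjugate.two_two hDL hiL.norm
  simp only [norm_norm, Real.rpow_two] at h2
  have h3 := pow_le_pow_left₀ (norm_nonneg _) (h1.trans h2) 2
  refine h3.trans (le_of_eq ?_)
  rw [mul_pow, ← Real.sqrt_eq_rpow, ← Real.sqrt_eq_rpow,
    Real.sq_sqrt (integral_nonneg fun u => sq_nonneg _),
    Real.sq_sqrt (integral_nonneg fun u => sq_nonneg _)]
  simp

lemma norm_sq_gaussSmoothGrad_sub_le {F F' : Euc n → ℝ} (hF : Measurable F) (hF' : Measurable F')
    {b : ℝ} (hb : ∀ x, |F x| ≤ b) (hb' : ∀ x, |F' x| ≤ b) (ξ : ℝ) (x : Euc n) :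
    ‖gaussSmoothGrad F ξ x - gaussSmoothGrad F' ξ x‖ ^ 2
      ≤ 1 / ξ ^ 2 * ((∫ u, (F (x + ξ • u) - F' (x + ξ • u)) ^ 2 ∂(stdGaussian (Euc n)))
        * ∫ u, ‖u‖ ^ 2 ∂(stdGaussian (Euc n))) := by
  unfold gaussSmoothGrad
  rw [← smul_sub, ← integral_sub (integrable_smul_id hF hb x ξ) (integrable_smul_id hF' hb' x ξ),
    norm_smul, mul_pow, Real.norm_eq_abs, sq_abs, div_pow, one_pow]
  simp_rw [← sub_smul]
  gcongr
  refine norm_sq_integral_smul_le ((measurable_comp_affine hF x ξ).sub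
    (measurable_comp_affine hF' x ξ)) (b := b + b) fun u => ?_
  exact (abs_sub _ _).trans (add_le_add (hb _) (hb' _))

end GaussianBias

/-! ### The limiting upper-level objective and the resulting bias. -/

section LimitFunction

/-- As `B` is closed and `δ t → 0`, each point off `B` eventually leaves the neighbourhoods. The
candidate values `z`, chosen pointwise, are therefore limits there, which provides measurability; on
`B` the limit function is set to `0`. -/
lemma exists_measurable_limit {n : ℕ} {F : ℕ → Euc n → ℝ} (hF : ∀ t, Measurable (F t)) {b : ℝ}
    (hb0 : 0 ≤ b) (hb : ∀ t x, |F t x| ≤ b) {B : Set (Euc n)} (hB : IsClosed B) {δ c : ℕ → ℝ}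
    (hδ : Tendsto δ atTop (𝓝 0)) (hc : Tendsto c atTop (𝓝 0))
    (h : ∀ x, ∃ z, ∀ t, x ∉ Metric.cthickening (δ t) B → |F t x - z| ≤ c t) :
    ∃ F' : Euc n → ℝ, Measurable F' ∧ (∀ x, |F' x| ≤ b) ∧
      ∀ t x, x ∉ Metric.cthickening (δ t) B → |F t x - F' x| ≤ c t := by
  choose z hz using h
  have hlim : ∀ x ∉ B, Tendsto (fun t => F t x) atTop (𝓝 (z x)) := by
    intro x hx
    have hx1 : 0 < Metric.infEDist x B := by
      rw [pos_iff_ne_zero]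
      intro h0
      exact hx (by rw [← hB.closure_eq]; exact Metric.mem_closure_iff_infEDist_zero.2 h0)
    have hδ' : Tendsto (fun t => ENNReal.ofReal (δ t)) atTop (𝓝 0) := by
      simpa using ENNReal.tendsto_ofReal hδ
    have hev : ∀ᶠ t in atTop, |F t x - z x| ≤ c t := by
      filter_upwards [hδ'.eventually_lt_const hx1] with t ht
      refine hz x t fun hmem => ?_
      exact absurd (Metric.mem_cthickening_iff.1 hmem) (not_le.2 ht)
    rw [tendsto_iff_dist_tendsto_zero]
    exact squeeze_zero' (Eventually.of_forall fun _ => dist_nonneg) hev hc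
  refine ⟨Bᶜ.indicator z, ?_, fun x => ?_, fun t x hx => ?_⟩
  · refine measurable_of_tendsto_metrizable
      (f := fun t => Bᶜ.indicator (F t)) (fun t => (hF t).indicator hB.measurableSet.compl) ?_
    rw [tendsto_pi_nhds]
    intro x
    by_cases hx : x ∈ B
    · simp [hx]
    · simpa [hx] using hlim x hx
  · by_cases hx : x ∈ B
    · simpa [hx] using hb0
    · simp only [Set.indicator, Set.mem_compl_iff, hx, not_false_eq_true, if_true]
      exact le_of_tendsto (hlim x hx).abs (Eventually.of_forall fun t => hb t x)
  · have hxB : x ∉ B := fun hxB => hx (Metric.self_subset_cthickening B hxB)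
    simpa [Set.indicator, hxB] using hz x t hx

variable {n m : ℕ} {X : Set (Euc n)} {f g : Euc n → Euc m → ℝ} {y0 : Euc m}
  {Y Y' : Set (Euc m)} {Lg M gLow g0 fbar Lf d : ℝ}

lemma output_mem_sublevel (hstd : StandingAssumptions X f g y0 Y Lg M gLow g0 fbar Lf)
    {x : Euc n} (hx : x ∈ X) {y : ℕ → Euc m} (hy : IsCubicNewtonRun g M x y0 y) {K : ℕ}
    {yhat : Euc m} (hout : IsCubicNewtonOutput g M x y K yhat) : g x yhat ≤ g x y0 := by
  have hg := hstd.g_smooth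
  have hH : ∀ y y', ‖hessYY g x y - hessYY g x y'‖ ≤ M * ‖y - y'‖ := fun y y' => by
    have := hstd.hess_lipschitz x hx x hx y y'
    simpa [Real.sqrt_sq] using this
  have hs : ∀ k, IsCubicMin (gradY g x (y k)) (hessYY g x (y k)) M (y (k + 1) - y k) :=
    fun k t => hy.2 k t
  have hanti := antitone_of_cubicMin (hasFDerivAt_g hg x) (hasFDerivAt_gradY hg x)
    hstd.M_pos.le hH (hessYY_symm hg x) hs
  obtain ⟨k, -, rfl, -⟩ := hout
  have := hanti (Nat.zero_le k)
  simpa [hy.1] using this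

lemma fbar_nonneg (hstd : StandingAssumptions X f g y0 Y Lg M gLow g0 fbar Lf) : 0 ≤ fbar := by
  obtain ⟨x, hx⟩ := hstd.X_nonempty
  exact (abs_nonneg _).trans (hstd.f_bound x hx y0 le_rfl)

lemma abs_sampleValue_le (hstd : StandingAssumptions X f g y0 Y Lg M gLow g0 fbar Lf)
    {yhat : Euc n → Euc m} (hyhat : ∀ x ∈ X, g x (yhat x) ≤ g x y0) (x : Euc n) :
    |sampleValue X f fbar yhat x| ≤ fbar := by
  unfold sampleValue
  split_ifs with hx
  · exact hstd.f_bound x hx _ (hyhat x hx)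
  · exact (abs_of_nonneg (fbar_nonneg hstd)).le

lemma measurable_sampleValue (hstd : StandingAssumptions X f g y0 Y Lg M gLow g0 fbar Lf)
    {yhat : Euc n → Euc m} (hyhat : Measurable fun x : X => yhat x) :
    Measurable (sampleValue X f fbar yhat) := by
  refine measurable_of_restrict_of_restrict_compl hstd.X_compact.isClosed.measurableSet ?_ ?_
  · have h1 : X.domRestrict (sampleValue X f fbar yhat)
        = (fun p : (X ×ˢ (Set.univ : Set (Euc m)) : Set _) => Function.uncurry f p) ∘
          fun x : X => ⟨(x, yhat x), x.2, Set.mem_univ _⟩ := by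
      funext x
      simp [sampleValue, Set.domRestrict]
    rw [h1]
    refine (continuousOn_iff_continuous_domRestrict.1 hstd.f_cont).measurable.comp ?_
    exact (measurable_subtype_coe.prodMk hyhat).subtype_mk
  · have h1 : Xᶜ.domRestrict (sampleValue X f fbar yhat) = fun _ => fbar := by
      funext x
      have := x.2
      simp only [Set.mem_compl_iff] at this
      simp [sampleValue, Set.domRestrict, this]
    rw [h1]
    exact measurable_const

lemma tendsto_rhoSeq : Tendsto rhoSeq atTop (𝓝 0) :=
  tendsto_one_div_add_atTop_nhds_zero_nat

lemma tendsto_deltaSeq (hdn : d < n) : Tendsto (deltaSeq n d) atTop (𝓝 0) := by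
  have h1 : Tendsto (fun t : ℕ => (t : ℝ) + 1) atTop atTop :=
    tendsto_atTop_add_const_right _ _ tendsto_natCast_atTop_atTop
  have h2 := (tendsto_rpow_neg_atTop (y := 2 / ((n : ℝ) - d))
    (div_pos two_pos (by linarith))).comp h1
  refine h2.congr fun t => ?_
  simp [deltaSeq, neg_div]

lemma deltaSeq_rpow (hdn : d < n) (t : ℕ) :
    deltaSeq n d t ^ (((n : ℝ) - d) / 2) = 1 / ((t : ℝ) + 1) := by
  have h : (n : ℝ) - d ≠ 0 := by linarith
  unfold deltaSeq
  rw [← Real.rpow_mul (by positivity), show -2 / ((n : ℝ) - d) * (((n : ℝ) - d) / 2) = -1 by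
    field_simp, Real.rpow_neg_one, one_div]

lemma exists_limit_sampleValue (hstd : StandingAssumptions X f g y0 Y Lg M gLow g0 fbar Lf)
    (hY' : IsCompact Y') (hYY' : Y ⊆ interior Y')
    (hdn : d < n) (hbdd : Bornology.IsBounded {y : Euc m | ∃ x ∈ X, IsDegenerateStationary g x y})
    (hfold : ∀ x ∈ X, ∀ y, IsDegenerateStationary g x y → IsFold g x y)
    (htan : ∀ x ∈ X, ∀ y, IsDegenerateStationary g x y → IsNontangential X g x y)
    {traj : Euc n → ℕ → Euc m} (htraj : ∀ x ∈ X, IsCubicNewtonRun g M x y0 (traj x))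
    {yhat : ℕ → Euc n → Euc m}
    (hyhat : ∀ K, ∀ x ∈ X, IsCubicNewtonOutput g M x (traj x) K (yhat K x))
    (hyhat_meas : ∀ K, Measurable (fun x : X => yhat K x)) {K : ℕ → ℕ}
    (hK : ∀ t, innerStepBoundSeq X g Y Y' M gLow g0 d t < K t) :
    ∃ F : Euc n → ℝ, Measurable F ∧ (∀ x, |F x| ≤ fbar) ∧ ∀ t x,
      x ∉ Metric.cthickening (deltaSeq n d t) (bifurcationSet X g) →
      |sampleValue X f fbar (yhat (K t)) x - F x| ≤ |Lf| * rhoSeq t := by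
  refine exists_measurable_limit (fun t => measurable_sampleValue hstd (hyhat_meas _))
    (fbar_nonneg hstd) (fun t => abs_sampleValue_le hstd fun x hx =>
      output_mem_sublevel hstd hx (htraj x hx) (hyhat _ x hx))
    (isCompact_bifurcationSet hstd hbdd).isClosed (tendsto_deltaSeq hdn)
    (by simpa using tendsto_rhoSeq.const_mul |Lf|) fun x => ?_
  have hρ : ∀ t, 0 ≤ rhoSeq t := fun t => by unfold rhoSeq; positivity
  by_cases hx : x ∈ X
  · by_cases hlim : ∃ z, Tendsto (traj x) atTop (𝓝 z)
    · obtain ⟨z, hz⟩ := hlim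
      refine ⟨f x z, fun t ht => ?_⟩
      obtain ⟨z', hz', h1, h2, h3⟩ := lower_level_limit hstd hY' hYY' hfold htan hdn (hK t)
        ⟨hx, fun h => ht h.2⟩ (htraj x hx) (hyhat _ x hx)
      obtain rfl := tendsto_nhds_unique hz hz'
      simp only [sampleValue, hx, if_true]
      refine (hstd.f_lipschitz x hx _ _ h3 h2).trans ?_
      exact mul_le_mul (le_abs_self _) h1 (norm_nonneg _) (abs_nonneg _)
    -- Without convergence of the iterates, `x` lies in every neighbourhood of the bifurcation set,
    -- and nothing is required.
    · refine ⟨0, fun t ht => absurd ?_ hlim⟩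
      obtain ⟨z', hz', -⟩ := lower_level_limit hstd hY' hYY' hfold htan hdn (hK t)
        ⟨hx, fun h => ht h.2⟩ (htraj x hx) (hyhat _ x hx)
      exact ⟨z', hz'⟩
  · refine ⟨fbar, fun t _ => ?_⟩
    simp only [sampleValue, hx, if_false, sub_self, abs_zero]
    exact mul_nonneg (abs_nonneg _) (hρ t)

/-- Both contributions balance: `ρ_t² ≤ 1/(t + 1)` off the neighbourhood, and `δ_t^((n-d)/2) = 1/(t
+ 1)` for its mass. -/
lemma exists_bias_le (hstd : StandingAssumptions X f g y0 Y Lg M gLow g0 fbar Lf)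
    (hY' : IsCompact Y') (hYY' : Y ⊆ interior Y')
    (hd : d = upperMinkowskiDim (bifurcationSet X g)) (hdn : d < n)
    (hbdd : Bornology.IsBounded {y : Euc m | ∃ x ∈ X, IsDegenerateStationary g x y})
    (hfold : ∀ x ∈ X, ∀ y, IsDegenerateStationary g x y → IsFold g x y)
    (htan : ∀ x ∈ X, ∀ y, IsDegenerateStationary g x y → IsNontangential X g x y)
    {traj : Euc n → ℕ → Euc m} (htraj : ∀ x ∈ X, IsCubicNewtonRun g M x y0 (traj x))
    {yhat : ℕ → Euc n → Euc m}
    (hyhat : ∀ K, ∀ x ∈ X, IsCubicNewtonOutput g M x (traj x) K (yhat K x))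
    (hyhat_meas : ∀ K, Measurable (fun x : X => yhat K x)) {ξ : ℝ} (hξ : 0 < ξ) {K : ℕ → ℕ}
    (hK : ∀ t, innerStepBoundSeq X g Y Y' M gLow g0 d t < K t) :
    ∃ F : Euc n → ℝ, Measurable F ∧ (∀ x, |F x| ≤ fbar) ∧ ∃ C, 0 ≤ C ∧ ∀ t x,
      ‖gaussSmoothGrad (sampleValue X f fbar (yhat (K t))) ξ x - gaussSmoothGrad F ξ x‖ ^ 2
        ≤ C / ((t : ℝ) + 1) := by
  obtain ⟨F, hF, hFb, hFt⟩ := exists_limit_sampleValue hstd hY' hYY' hdn hbdd hfold htan htraj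
    hyhat hyhat_meas hK
  obtain ⟨V, hV, hVt⟩ := volume_cthickening_le hstd hbdd hfold hd hdn
  set κ := ∫ u, ‖u‖ ^ 2 ∂(stdGaussian (Euc n)) with hκdef
  have hκ : 0 ≤ κ := integral_nonneg fun u => sq_nonneg _
  set c := ((2 * Real.pi) ^ ((n : ℝ) / 2))⁻¹ * (ξ ^ n)⁻¹ * V with hcdef
  have hc : 0 ≤ c := by positivity
  refine ⟨F, hF, hFb, 1 / ξ ^ 2 * ((Lf ^ 2 + 4 * fbar ^ 2 * c) * κ), by positivity, fun t x => ?_⟩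
  have ht : (0 : ℝ) < (t : ℝ) + 1 := by positivity
  have h1 := integral_sq_sub_comp_affine_le
    (abs_sampleValue_le hstd fun x hx => output_mem_sublevel hstd hx (htraj x hx) (hyhat _ x hx))
    hFb hξ Metric.isClosed_cthickening.measurableSet
    (mul_nonneg hV (Real.rpow_nonneg (deltaSeq_pos n d t).le _))
    (hVt _ (deltaSeq_pos n d t) (deltaSeq_le_one hdn t)) (hFt t) x
  rw [deltaSeq_rpow hdn] at h1
  have h2 : (|Lf| * rhoSeq t) ^ 2 ≤ Lf ^ 2 / ((t : ℝ) + 1) := by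
    have h3 : rhoSeq t ^ 2 ≤ 1 / ((t : ℝ) + 1) := by
      unfold rhoSeq
      rw [sq]
      refine mul_le_of_le_one_left (by positivity) ?_
      rw [div_le_one ht]
      linarith [Nat.cast_nonneg (α := ℝ) t]
    rw [mul_pow, sq_abs]
    refine (mul_le_mul_of_nonneg_left h3 (sq_nonneg _)).trans (le_of_eq (by ring))
  refine (norm_sq_gaussSmoothGrad_sub_le (measurable_sampleValue hstd (hyhat_meas (K t))) hF
    (abs_sampleValue_le hstd fun x hx => output_mem_sublevel hstd hx (htraj x hx) (hyhat _ x hx))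
    hFb ξ x).trans ?_
  have h4 : ∫ u, (sampleValue X f fbar (yhat (K t)) (x + ξ • u) - F (x + ξ • u)) ^ 2
      ∂(stdGaussian (Euc n)) ≤ (Lf ^ 2 + 4 * fbar ^ 2 * c) / ((t : ℝ) + 1) := by
    refine (h1.trans (add_le_add_left h2 _)).trans (le_of_eq ?_)
    rw [hcdef]; ring
  calc _ ≤ 1 / ξ ^ 2 * ((Lf ^ 2 + 4 * fbar ^ 2 * c) / ((t : ℝ) + 1) * κ) := by gcongr
    _ = _ := by ring

end LimitFunction

/-! ### Euclidean projection -/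

section Projection

variable {n : ℕ} {X : Set (Euc n)}

lemma proj_spec (hne : X.Nonempty) (hX : IsClosed X) (z : Euc n) :
    proj X z ∈ X ∧ ∀ q ∈ X, dist z (proj X z) ≤ dist z q := by
  obtain ⟨p, hp, hpd⟩ := hX.exists_infDist_eq_dist hne z
  exact Classical.epsilon_spec (p := fun p => p ∈ X ∧ ∀ q ∈ X, dist z p ≤ dist z q)
    ⟨p, hp, fun q hq => hpd ▸ Metric.infDist_le_dist_of_mem hq⟩

lemma proj_inner_le (hne : X.Nonempty) (hX : IsClosed X) (hc : Convex ℝ X) (z : Euc n) {q : Euc n}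
    (hq : q ∈ X) : inner ℝ (z - proj X z) (q - proj X z) ≤ 0 := by
  obtain ⟨h1, h2⟩ := proj_spec hne hX z
  refine (norm_eq_iInf_iff_real_inner_le_zero hc h1).1 ?_ q hq
  have : Nonempty X := hne.to_subtype
  refine le_antisymm (le_ciInf fun w => ?_)
    (ciInf_le (f := fun w : X => ‖z - w‖) ⟨0, by rintro _ ⟨w, rfl⟩; exact norm_nonneg _⟩
      ⟨proj X z, h1⟩)
  simpa [dist_eq_norm] using h2 w w.2

lemma continuous_proj (hne : X.Nonempty) (hX : IsClosed X) (hc : Convex ℝ X) :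
    Continuous (proj X) := by
  refine LipschitzWith.continuous (K := 1) (LipschitzWith.of_dist_le_mul fun z w => ?_)
  rw [NNReal.coe_one, one_mul, dist_eq_norm, dist_eq_norm]
  have h1 := proj_inner_le hne hX hc z (proj_spec hne hX w).1
  have h2 := proj_inner_le hne hX hc w (proj_spec hne hX z).1
  set a := proj X z
  set b := proj X w
  have h3 : ‖a - b‖ ^ 2 ≤ inner ℝ (z - w) (a - b) := by
    have e1 : inner ℝ (z - a) (b - a) = -inner ℝ (z - a) (a - b) := by
      rw [← inner_neg_right, neg_sub]
    have e2 : inner ℝ (z - w) (a - b)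
        = inner ℝ (z - a) (a - b) - inner ℝ (w - b) (a - b) + ‖a - b‖ ^ 2 := by
      rw [← real_inner_self_eq_norm_sq, ← inner_sub_left, ← inner_add_left]
      congr 1; abel
    rw [e1] at h1
    linarith
  have h4 := real_inner_le_norm (z - w) (a - b)
  rcases (norm_nonneg (a - b)).eq_or_lt with h0 | h0
  · rw [← h0]; exact norm_nonneg _
  · nlinarith

end Projection

/-! ### The variance of the gradient estimator -/

section Variance

variable {n : ℕ} {F : Euc n → ℝ} {b ξ : ℝ}

lemma measurable_gaussSmoothGrad (hF : Measurable F) (ξ : ℝ) :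
    Measurable (gaussSmoothGrad F ξ) := by
  have h : Measurable fun p : Euc n × Euc n => p.1 + ξ • p.2 := by fun_prop
  have h1 : StronglyMeasurable fun p : Euc n × Euc n => F (p.1 + ξ • p.2) • p.2 :=
    ((hF.comp h).smul measurable_snd).stronglyMeasurable
  have h2 : Measurable fun x : Euc n => ∫ u, F (x + ξ • u) • u ∂(stdGaussian (Euc n)) :=
    h1.integral_prod_right.measurable
  exact h2.const_smul (1 / ξ)

lemma norm_gaussSmoothGrad_le (hb : ∀ x, |F x| ≤ b) (hξ : 0 < ξ) (x : Euc n) :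
    ‖gaussSmoothGrad F ξ x‖ ≤ b / ξ * ∫ u, ‖u‖ ∂(stdGaussian (Euc n)) := by
  unfold gaussSmoothGrad
  rw [norm_smul, Real.norm_of_nonneg (by positivity)]
  have h1 : ‖∫ u, F (x + ξ • u) • u ∂(stdGaussian (Euc n))‖
      ≤ ∫ u, b * ‖u‖ ∂(stdGaussian (Euc n)) := by
    refine norm_integral_le_of_norm_le (integrable_id_stdGaussian.norm.const_mul b)
      (Eventually.of_forall fun u => ?_)
    rw [norm_smul]
    exact mul_le_mul_of_nonneg_right (hb _) (norm_nonneg _)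
  rw [integral_const_mul] at h1
  calc _ ≤ 1 / ξ * (b * ∫ u, ‖u‖ ∂(stdGaussian (Euc n))) := by gcongr
    _ = _ := by ring

/-- The centered contribution of one sample to the gradient estimator. -/
noncomputable def sampleNoise (F : Euc n → ℝ) (ξ : ℝ) (x u : Euc n) : Euc n :=
  (1 / ξ) • F (x + ξ • u) • u - gaussSmoothGrad F ξ x

lemma measurable_sampleNoise (hF : Measurable F) (ξ : ℝ) :
    Measurable fun p : Euc n × Euc n => sampleNoise F ξ p.1 p.2 := by
  unfold sampleNoise
  have h : Measurable fun p : Euc n × Euc n => p.1 + ξ • p.2 := by fun_prop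
  have h1 : Measurable fun p : Euc n × Euc n => F (p.1 + ξ • p.2) • p.2 :=
    (hF.comp h).smul measurable_snd
  exact (h1.const_smul (1 / ξ)).sub ((measurable_gaussSmoothGrad hF ξ).comp measurable_fst)

lemma integrable_sampleNoise (hF : Measurable F) (hb : ∀ x, |F x| ≤ b) (x : Euc n) :
    Integrable (sampleNoise F ξ x) (stdGaussian (Euc n)) :=
  ((integrable_smul_id hF hb x ξ).smul (1 / ξ)).sub (integrable_const _)

lemma integral_sampleNoise (hF : Measurable F) (hb : ∀ x, |F x| ≤ b) (x : Euc n) :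
    ∫ u, sampleNoise F ξ x u ∂(stdGaussian (Euc n)) = 0 := by
  unfold sampleNoise
  have h1 : Integrable (fun u => (1 / ξ) • F (x + ξ • u) • u) (stdGaussian (Euc n)) :=
    (integrable_smul_id hF hb x ξ).smul (1 / ξ)
  rw [integral_sub h1 (integrable_const _), integral_smul, integral_const, probReal_univ, one_smul, gaussSmoothGrad, sub_self]

lemma norm_sq_sampleNoise_le (hb : ∀ x, |F x| ≤ b) (hξ : 0 < ξ) (x u : Euc n) :
    ‖sampleNoise F ξ x u‖ ^ 2
      ≤ 2 * (b / ξ) ^ 2 * (‖u‖ ^ 2 + (∫ u, ‖u‖ ∂(stdGaussian (Euc n))) ^ 2) := by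
  have hb0 : 0 ≤ b := (abs_nonneg _).trans (hb x)
  have h1 : ‖(1 / ξ) • F (x + ξ • u) • u‖ ≤ b / ξ * ‖u‖ := by
    rw [norm_smul, norm_smul, Real.norm_of_nonneg (by positivity), Real.norm_eq_abs]
    calc 1 / ξ * (|F (x + ξ • u)| * ‖u‖) ≤ 1 / ξ * (b * ‖u‖) := by gcongr; exact hb _
      _ = _ := by ring
  have h2 := norm_gaussSmoothGrad_le hb hξ x
  set m := ∫ u, ‖u‖ ∂(stdGaussian (Euc n))
  have h3 : ‖sampleNoise F ξ x u‖ ≤ b / ξ * ‖u‖ + b / ξ * m :=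
    (norm_sub_le _ _).trans (add_le_add h1 h2)
  refine (pow_le_pow_left₀ (norm_nonneg _) h3 2).trans ?_
  nlinarith [sq_nonneg (b / ξ * ‖u‖ - b / ξ * m)]

variable {z : Euc n → Euc n → Euc n} {a c : ℝ} {Ω : Type*} [MeasurableSpace Ω] {P : Measure Ω}

lemma integrable_norm_sq_of_map_eq {V : Ω → Euc n} (hV : Measurable V)
    (hlaw : P.map V = stdGaussian (Euc n)) : Integrable (fun ω => ‖V ω‖ ^ 2) P := by
  have h := integrable_norm_sq_stdGaussian (n := n)
  rw [← hlaw] at h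
  exact h.comp_measurable hV

lemma integral_norm_sq_of_map_eq {V : Ω → Euc n} (hV : Measurable V)
    (hlaw : P.map V = stdGaussian (Euc n)) :
    ∫ ω, ‖V ω‖ ^ 2 ∂P = ∫ u, ‖u‖ ^ 2 ∂(stdGaussian (Euc n)) := by
  rw [← hlaw, integral_map hV.aemeasurable (by fun_prop)]

lemma integrable_norm_sq_noise [IsProbabilityMeasure P] (hz : Measurable fun p : Euc n × Euc n => z p.1 p.2)
    (hz2 : ∀ x u, ‖z x u‖ ^ 2 ≤ a * (‖u‖ ^ 2 + c))
    {x V : Ω → Euc n} (hx : Measurable x) (hV : Measurable V)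
    (hlaw : P.map V = stdGaussian (Euc n)) :
    Integrable (fun ω => ‖z (x ω) (V ω)‖ ^ 2) P := by
  refine Integrable.mono' (((integrable_norm_sq_of_map_eq hV hlaw).add
    (integrable_const c)).const_mul a) ?_
    (Eventually.of_forall fun ω => ?_)
  · exact ((hz.comp (hx.prodMk hV)).norm.pow_const 2).aestronglyMeasurable
  · rw [Real.norm_of_nonneg (sq_nonneg _)]
    exact hz2 _ _

lemma integral_norm_sq_noise_le [IsProbabilityMeasure P] (hz2 : ∀ x u, ‖z x u‖ ^ 2 ≤ a * (‖u‖ ^ 2 + c))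
    {x V : Ω → Euc n} (hV : Measurable V) (hlaw : P.map V = stdGaussian (Euc n)) :
    ∫ ω, ‖z (x ω) (V ω)‖ ^ 2 ∂P
      ≤ a * ((∫ u, ‖u‖ ^ 2 ∂(stdGaussian (Euc n)))
        + c) := by
  have hi := integrable_norm_sq_of_map_eq hV hlaw
  have h1 := integral_mono_of_nonneg (μ := P) (f := fun ω => ‖z (x ω) (V ω)‖ ^ 2)
    (Eventually.of_forall fun ω => sq_nonneg _)
    ((hi.add (integrable_const c)).const_mul
      a) (Eventually.of_forall fun ω => hz2 _ _)
  refine h1.trans (le_of_eq ?_)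
  rw [integral_const_mul]
  simp only [Pi.add_apply]
  rw [integral_add hi (integrable_const _), integral_const, integral_norm_sq_of_map_eq hV hlaw,
    probReal_univ, one_smul]

lemma integrable_inner_of_norm_sq {f g : Ω → Euc n} (hf : Measurable f) (hg : Measurable g)
    (hf2 : Integrable (fun ω => ‖f ω‖ ^ 2) P) (hg2 : Integrable (fun ω => ‖g ω‖ ^ 2) P) :
    Integrable (fun ω => (inner ℝ (f ω) (g ω) : ℝ)) P := by
  refine Integrable.mono' (hf2.add hg2) (hf.inner hg).aestronglyMeasurable
    (Eventually.of_forall fun ω => ?_)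
  refine (norm_inner_le_norm _ _).trans ?_
  simp only [Pi.add_apply]
  nlinarith [sq_nonneg (‖f ω‖ - ‖g ω‖), sq_nonneg ‖f ω‖, sq_nonneg ‖g ω‖]

/-- `W` is integrated first with `(x, V)` fixed; the noise has mean zero for each fixed `x`. These
are the cross terms in the variance of the average. -/
lemma integral_inner_noise_eq_zero [IsProbabilityMeasure P] (hz : Measurable fun p : Euc n × Euc n => z p.1 p.2)
    (hz2 : ∀ x u, ‖z x u‖ ^ 2 ≤ a * (‖u‖ ^ 2 + c))
    (hzi : ∀ x, Integrable (z x) (stdGaussian (Euc n)))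
    (hz0 : ∀ x, ∫ u, z x u ∂(stdGaussian (Euc n)) = 0)
    {x V W : Ω → Euc n} (hx : Measurable x) (hV : Measurable V) (hW : Measurable W)
    (hVlaw : P.map V = stdGaussian (Euc n)) (hWlaw : P.map W = stdGaussian (Euc n))
    (hind : IndepFun (fun ω => (x ω, V ω)) W P) :
    ∫ ω, (inner ℝ (z (x ω) (V ω)) (z (x ω) (W ω)) : ℝ) ∂P = 0 := by
  set h : (Euc n × Euc n) × Euc n → ℝ := fun p =>
    inner ℝ (z p.1.1 p.1.2) (z p.1.1 p.2) with hh
  have hm := hz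
  have hhm : Measurable h := (hm.comp measurable_fst).inner
    (hm.comp ((measurable_fst.comp measurable_fst).prodMk measurable_snd))
  have hpair : Measurable fun ω => (x ω, V ω) := hx.prodMk hV
  have hmap := (indepFun_iff_map_prod_eq_prod_map_map hpair.aemeasurable hW.aemeasurable).1 hind
  have hint : Integrable (fun ω => h ((x ω, V ω), W ω)) P :=
    integrable_inner_of_norm_sq (hm.comp hpair) (hm.comp (hx.prodMk hW))
      (integrable_norm_sq_noise hz hz2 hx hV hVlaw)
      (integrable_norm_sq_noise hz hz2 hx hW hWlaw)
  have hint' : Integrable h ((P.map fun ω => (x ω, V ω)).prod (P.map W)) := by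
    rw [← hmap]
    exact (integrable_map_measure hhm.aestronglyMeasurable
      (hpair.prodMk hW).aemeasurable).2 hint
  have h1 : ∫ ω, h ((x ω, V ω), W ω) ∂P
      = ∫ p, h p ∂((P.map fun ω => (x ω, V ω)).prod (P.map W)) := by
    rw [← hmap, integral_map (hpair.prodMk hW).aemeasurable hhm.aestronglyMeasurable]
  refine h1.trans ?_
  have : IsProbabilityMeasure (P.map fun ω => (x ω, V ω)) :=
    Measure.isProbabilityMeasure_map hpair.aemeasurable
  have : IsProbabilityMeasure (P.map W) := Measure.isProbabilityMeasure_map hW.aemeasurable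
  rw [integral_prod _ hint', hWlaw]
  refine integral_eq_zero_of_ae (Eventually.of_forall fun p => ?_)
  simp only [hh]
  rw [integral_inner (hzi _), hz0, inner_zero_right]
  rfl

lemma integral_norm_sq_average_noise_le [IsProbabilityMeasure P] (hz : Measurable fun p : Euc n × Euc n => z p.1 p.2)
    (hz2 : ∀ x u, ‖z x u‖ ^ 2 ≤ a * (‖u‖ ^ 2 + c))
    (hzi : ∀ x, Integrable (z x) (stdGaussian (Euc n)))
    (hz0 : ∀ x, ∫ u, z x u ∂(stdGaussian (Euc n)) = 0)
    {x : Ω → Euc n} {V : ℕ → Ω → Euc n} (hx : Measurable x) (hV : ∀ i, Measurable (V i))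
    (hlaw : ∀ i, P.map (V i) = stdGaussian (Euc n))
    (hind : ∀ i j, i ≠ j → IndepFun (fun ω => (x ω, V i ω)) (V j) P) {N : ℕ} (hN : 0 < N) :
    Integrable (fun ω => ‖(1 / (N : ℝ)) • ∑ i ∈ Finset.range N,
      z (x ω) (V i ω)‖ ^ 2) P ∧
    ∫ ω, ‖(1 / (N : ℝ)) • ∑ i ∈ Finset.range N, z (x ω) (V i ω)‖ ^ 2 ∂P
      ≤ a * ((∫ u, ‖u‖ ^ 2 ∂(stdGaussian (Euc n)))
        + c) / N := by
  set C := a * ((∫ u, ‖u‖ ^ 2 ∂(stdGaussian (Euc n)))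
        + c) with hC
  have hm := hz
  have hij : ∀ i j, Integrable (fun ω =>
      (inner ℝ (z (x ω) (V i ω)) (z (x ω) (V j ω)) : ℝ)) P := fun i j =>
    integrable_inner_of_norm_sq (hm.comp (hx.prodMk (hV i))) (hm.comp (hx.prodMk (hV j)))
      (integrable_norm_sq_noise hz hz2 hx (hV i) (hlaw i))
      (integrable_norm_sq_noise hz hz2 hx (hV j) (hlaw j))
  have hexp : (fun ω => ‖(1 / (N : ℝ)) • ∑ i ∈ Finset.range N, z (x ω) (V i ω)‖ ^ 2)
      = fun ω => (1 / (N : ℝ)) ^ 2 * ∑ i ∈ Finset.range N, ∑ j ∈ Finset.range N,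
        (inner ℝ (z (x ω) (V i ω)) (z (x ω) (V j ω)) : ℝ) := by
    funext ω
    rw [norm_smul, mul_pow, Real.norm_eq_abs, sq_abs, ← real_inner_self_eq_norm_sq, sum_inner]
    simp_rw [inner_sum]
  rw [hexp]
  refine ⟨(integrable_finsetSum _ fun i _ => integrable_finsetSum _ fun j _ =>
    hij i j).const_mul _, ?_⟩
  rw [integral_const_mul, integral_finsetSum _ fun i _ => integrable_finsetSum _ fun j _ => hij i j]
  have h1 : ∀ i ∈ Finset.range N, ∫ ω, ∑ j ∈ Finset.range N,
      (inner ℝ (z (x ω) (V i ω)) (z (x ω) (V j ω)) : ℝ) ∂P ≤ C := by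
    intro i hi
    rw [integral_finsetSum _ fun j _ => hij i j, Finset.sum_eq_single_of_mem i hi]
    · simp_rw [real_inner_self_eq_norm_sq]
      exact integral_norm_sq_noise_le hz2 (hV i) (hlaw i)
    · intro j _ hj
      exact integral_inner_noise_eq_zero hz hz2 hzi hz0 hx (hV i) (hV j) (hlaw i) (hlaw j)
        (hind i j hj.symm)
  have hN' : (0 : ℝ) < N := by exact_mod_cast hN
  calc _ ≤ (1 / (N : ℝ)) ^ 2 * ∑ i ∈ Finset.range N, C := by
        gcongr with i hi
        exact h1 i hi
    _ = C / N := by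
        rw [Finset.sum_const, Finset.card_range, nsmul_eq_mul]; field_simp

end Variance

/-! ### The upper-level iteration -/

section UpperLevel

variable {n m : ℕ} {X : Set (Euc n)} {f : Euc n → Euc m → ℝ} {fbar ξ β : ℝ}

lemma measurable_gradEstimator {yhat : Euc n → Euc m}
    (hF : Measurable (sampleValue X f fbar yhat)) (ξ : ℝ) (N : ℕ) {Ω : Type*} [MeasurableSpace Ω]
    {V : ℕ → Ω → Euc n} (hV : ∀ i, Measurable (V i)) {x : Ω → Euc n} (hx : Measurable x) :
    Measurable fun ω => gradEstimator X f fbar ξ yhat N (fun i => V i ω) (x ω) := by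
  unfold gradEstimator
  refine (Finset.measurable_sum _ fun i _ => ?_).const_smul (1 / ((N : ℝ) * ξ))
  exact (hF.comp (hx.add ((hV i).const_smul ξ))).smul (hV i)

/-- Measurability is demanded only of samples before `t`, so that the statement also applies with
the σ-algebra generated by the past. -/
lemma measurable_iterate {yhat : ℕ → Euc n → Euc m} {K N : ℕ → ℕ}
    (hF : ∀ t, Measurable (sampleValue X f fbar (yhat (K t)))) (hproj : Measurable (proj X))
    (xinit : Euc n) {Ω : Type*} [MeasurableSpace Ω] {U : ℕ → ℕ → Ω → Euc n} (t : ℕ)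
    (hU : ∀ s < t, ∀ i, Measurable (U s i)) :
    Measurable fun ω => iterate X f fbar ξ β yhat K N xinit (fun t i => U t i ω) t := by
  induction t with
  | zero => exact measurable_const
  | succ t ih =>
    have h := ih fun s hs => hU s (hs.trans t.lt_succ_self)
    exact hproj.comp (h.sub ((measurable_gradEstimator (hF t) ξ (N t)
      (hU t t.lt_succ_self) h).const_smul β))

lemma measurable_projGradMap {yhat : ℕ → Euc n → Euc m} {K N : ℕ → ℕ}
    (hF : ∀ t, Measurable (sampleValue X f fbar (yhat (K t)))) (hproj : Measurable (proj X))
    (xinit : Euc n) {Ω : Type*} [MeasurableSpace Ω] {U : ℕ → ℕ → Ω → Euc n}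
    (hU : ∀ s i, Measurable (U s i)) (t : ℕ) :
    Measurable fun ω => projGradMap X f fbar ξ β yhat K N xinit (fun t i => U t i ω) t := by
  have h := measurable_iterate (ξ := ξ) (β := β) (N := N) hF hproj xinit t fun s _ => hU s
  have h1 := h.sub (hproj.comp (h.sub ((measurable_gradEstimator (hF t) ξ (N t)
      (hU t) h).const_smul β)))
  exact h1.const_smul (1 / β)

lemma iterate_succ_mem (hne : X.Nonempty) (hX : IsClosed X) {yhat : ℕ → Euc n → Euc m}
    {K N : ℕ → ℕ} (xinit : Euc n) (u : ℕ → ℕ → Euc n) (t : ℕ) :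
    iterate X f fbar ξ β yhat K N xinit u (t + 1) ∈ X :=
  (proj_spec hne hX _).1

lemma projGradMap_eq {yhat : ℕ → Euc n → Euc m} {K N : ℕ → ℕ} (xinit : Euc n) (u : ℕ → ℕ → Euc n)
    (t : ℕ) : projGradMap X f fbar ξ β yhat K N xinit u t
      = (1 / β) • (iterate X f fbar ξ β yhat K N xinit u t
        - iterate X f fbar ξ β yhat K N xinit u (t + 1)) := rfl

lemma gradEstimator_sub_eq {yhat : Euc n → Euc m} {N : ℕ} (hN : 0 < N) (u : ℕ → Euc n) (x : Euc n) :
    gradEstimator X f fbar ξ yhat N u x - gaussSmoothGrad (sampleValue X f fbar yhat) ξ x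
      = (1 / (N : ℝ)) • ∑ i ∈ Finset.range N,
        sampleNoise (sampleValue X f fbar yhat) ξ x (u i) := by
  have hN' : (N : ℝ) ≠ 0 := by exact_mod_cast hN.ne'
  unfold sampleNoise gradEstimator
  rw [Finset.sum_sub_distrib, smul_sub, Finset.sum_const, Finset.card_range, ← Nat.cast_smul_eq_nsmul ℝ,
    smul_smul, one_div_mul_cancel hN', one_smul, ← Finset.smul_sum, smul_smul, one_div_mul_one_div]

/-- One step of the projected stochastic gradient method decreases the smoothed objective, up to the
error of the gradient estimator. -/
lemma projected_step_le (hne : X.Nonempty) (hX : IsClosed X) (hc : Convex ℝ X)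
    {Φ : Euc n → ℝ} {G : Euc n → Euc n} {L : ℝ}
    (hΦ : ∀ x a, Φ (x + a) ≤ Φ x + inner ℝ (G x) a + L * ‖a‖ ^ 2) (hβ : 0 < β) (hβL : β * L < 1)
    {x : Euc n} (hx : x ∈ X) (e : Euc n) :
    β * (1 - β * L) / 2 * ‖(1 / β) • (x - proj X (x - β • e))‖ ^ 2
      ≤ Φ x - Φ (proj X (x - β • e)) + β / (2 * (1 - β * L)) * ‖e - G x‖ ^ 2 := by
  have hc0 : 0 < 1 - β * L := by linarith
  set x' := proj X (x - β • e) with hx'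
  set p := (1 / β) • (x - x') with hp
  have hxp : x - x' = β • p := by rw [hp, smul_smul, mul_one_div_cancel hβ.ne', one_smul]
  have hx'e : x' = x + -(β • p) := by rw [← hxp]; abel
  -- The variational inequality of the projection, tested at the current point `x`, which must lie
  -- in `X`.
  have h1 : ‖p‖ ^ 2 ≤ inner ℝ e p := by
    have h := proj_inner_le hne hX hc (x - β • e) hx
    rw [← hx', hxp, show x - β • e - x' = β • (p - e) by rw [smul_sub, ← hxp]; abel,
      real_inner_smul_left, real_inner_smul_right, inner_sub_left, real_inner_self_eq_norm_sq] at h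
    have h2 : 0 < β * β := mul_pos hβ hβ
    by_contra! hcon
    nlinarith
  have h2 := hΦ x (-(β • p))
  rw [← hx'e, inner_neg_right, real_inner_smul_right, norm_neg, norm_smul, mul_pow,
    Real.norm_eq_abs, sq_abs] at h2
  have h3 : inner ℝ (G x) p = inner ℝ e p - inner ℝ (e - G x) p := by
    rw [inner_sub_left]; ring
  have h4 := real_inner_le_norm (e - G x) p
  set E := ‖e - G x‖
  have h5 : E * ‖p‖ ≤ (1 - β * L) / 2 * ‖p‖ ^ 2 + 1 / (2 * (1 - β * L)) * E ^ 2 := by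
    have h6 : 0 ≤ ((1 - β * L) * ‖p‖ - E) ^ 2 / (2 * (1 - β * L)) := by positivity
    have h7 : ((1 - β * L) * ‖p‖ - E) ^ 2 / (2 * (1 - β * L))
        = (1 - β * L) / 2 * ‖p‖ ^ 2 + 1 / (2 * (1 - β * L)) * E ^ 2 - E * ‖p‖ := by
      field_simp
      ring
    linarith
  have h8 : Φ x' ≤ Φ x - β * (1 - β * L) * ‖p‖ ^ 2 + β * (E * ‖p‖) := by
    rw [h3] at h2
    nlinarith
  have h9 := mul_le_mul_of_nonneg_left h5 hβ.le
  have h10 : β / (2 * (1 - β * L)) * E ^ 2 = β * (1 / (2 * (1 - β * L)) * E ^ 2) := by ring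
  rw [h10]
  nlinarith

lemma sum_Icc_sub_succ (φ : ℕ → ℝ) (T : ℕ) :
    ∑ t ∈ Finset.Icc 1 T, (φ t - φ (t + 1)) = φ 1 - φ (T + 1) := by
  induction T with
  | zero => simp
  | succ T ih => rw [Finset.sum_Icc_succ_top (by omega), ih]; ring

lemma sum_Icc_one_div_succ_le {T : ℕ} :
    ∑ t ∈ Finset.Icc 1 T, 1 / ((t : ℝ) + 1) ≤ 1 + Real.log T := by
  refine le_trans ?_ (harmonic_le_one_add_log T)
  rw [harmonic_eq_sum_Icc]
  push_cast
  refine Finset.sum_le_sum fun t ht => ?_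
  have : (0 : ℝ) < t := by exact_mod_cast (Finset.mem_Icc.1 ht).1
  rw [one_div]
  exact inv_anti₀ this (by linarith)

end UpperLevel

/-! ### Independence of the current iterate from fresh samples. -/

section Independence

lemma measurable_iSup_comap {n : ℕ} {Ω : Type*} (U : ℕ → ℕ → Ω → Euc n) {S : Set (ℕ × ℕ)} {q : ℕ × ℕ} (hq : q ∈ S) :
    Measurable[⨆ q ∈ S, MeasurableSpace.comap (U q.1 q.2) inferInstance] (U q.1 q.2) :=
  Measurable.mono (comap_measurable _) (le_iSup₂ (f := fun (q : ℕ × ℕ) (_ : q ∈ S) =>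
    MeasurableSpace.comap (U q.1 q.2) inferInstance) q hq) le_rfl

variable {n : ℕ} {Ω : Type*} [mΩ : MeasurableSpace Ω] {P : Measure Ω}

/-- Functions of disjoint families of independent samples are independent. -/
lemma indepFun_of_disjoint {U : ℕ → ℕ → Ω → Euc n} (hU : ∀ t i, Measurable (U t i))
    (hind : iIndepFun (fun q : ℕ × ℕ => U q.1 q.2) P) {S T : Set (ℕ × ℕ)} (hST : Disjoint S T)
    {α β : Type*} [MeasurableSpace α] [MeasurableSpace β] {φ : Ω → α} {ψ : Ω → β}
    (hφ : Measurable[⨆ q ∈ S, MeasurableSpace.comap (U q.1 q.2) inferInstance] φ)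
    (hψ : Measurable[⨆ q ∈ T, MeasurableSpace.comap (U q.1 q.2) inferInstance] ψ) :
    IndepFun φ ψ P := by
  have h := indep_iSup_of_disjoint (fun q : ℕ × ℕ => (hU q.1 q.2).comap_le) hind.iIndep hST
  rw [IndepFun_iff_Indep]
  exact indep_of_indep_of_le_left (indep_of_indep_of_le_right h hψ.comap_le) hφ.comap_le

/-- The iterate depends only on samples of earlier rounds, so together with sample `(t, i)` it uses
an index set that omits `(t, j)`. -/
lemma indepFun_iterate_sample {m : ℕ} {X : Set (Euc n)} {f : Euc n → Euc m → ℝ} {fbar ξ β : ℝ}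
    {yhat : ℕ → Euc n → Euc m} {K N : ℕ → ℕ}
    (hF : ∀ t, Measurable (sampleValue X f fbar (yhat (K t)))) (hproj : Measurable (proj X))
    (xinit : Euc n) {U : ℕ → ℕ → Ω → Euc n} (hU : ∀ t i, Measurable (U t i))
    (hind : iIndepFun (fun q : ℕ × ℕ => U q.1 q.2) P) (t : ℕ) {i j : ℕ} (hij : i ≠ j) :
    IndepFun (fun ω => (iterate X f fbar ξ β yhat K N xinit (fun t i => U t i ω) t, U t i ω))
      (U t j) P := by
  refine indepFun_of_disjoint hU hind (S := {q | q.1 < t ∨ q = (t, i)}) (T := {(t, j)}) ?_ ?_ ?_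
  · rw [Set.disjoint_singleton_right]
    rintro (h | h)
    · exact lt_irrefl _ h
    · exact hij (congrArg Prod.snd h).symm
  · refine Measurable.prodMk ?_ (measurable_iSup_comap U (q := (t, i)) (Or.inr rfl))
    refine @measurable_iterate _ _ _ _ _ _ _ _ _ _ hF hproj xinit _
      (⨆ q ∈ {q : ℕ × ℕ | q.1 < t ∨ q = (t, i)}, MeasurableSpace.comap (U q.1 q.2) inferInstance)
      U t fun s hs i' => measurable_iSup_comap U (q := (s, i')) (Or.inl hs)
  · exact measurable_iSup_comap U (q := (t, j)) rfl

end Independence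

/-! ### Mean squared estimator error and the summed descent inequality. -/

section ExpectedError

variable {n m : ℕ} {X : Set (Euc n)} {f : Euc n → Euc m → ℝ} {fbar ξ β : ℝ}
  {yhat : ℕ → Euc n → Euc m} {K : ℕ → ℕ} {Ω : Type*} [MeasurableSpace Ω] {P : Measure Ω}
  [IsProbabilityMeasure P]

/-- Bound of the variance of the contribution of one sample to the gradient estimator. -/
noncomputable def noiseBound (n : ℕ) (fbar ξ : ℝ) : ℝ :=
  2 * (fbar / ξ) ^ 2 * ((∫ u, ‖u‖ ^ 2 ∂(stdGaussian (Euc n)))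
    + (∫ u, ‖u‖ ∂(stdGaussian (Euc n))) ^ 2)

lemma noiseBound_nonneg (n : ℕ) (fbar ξ : ℝ) : 0 ≤ noiseBound n fbar ξ := by
  have h1 : 0 ≤ ∫ u, ‖u‖ ^ 2 ∂(stdGaussian (Euc n)) := integral_nonneg fun u => sq_nonneg _
  unfold noiseBound
  positivity

lemma integral_norm_sq_estimator_error_le
    (hF : ∀ t, Measurable (sampleValue X f fbar (yhat (K t))))
    (hb : ∀ t x, |sampleValue X f fbar (yhat (K t)) x| ≤ fbar) (hproj : Measurable (proj X))
    (hξ : 0 < ξ) {F : Euc n → ℝ} (hFm : Measurable F) {C : ℝ}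
    (hbias : ∀ t x, ‖gaussSmoothGrad (sampleValue X f fbar (yhat (K t))) ξ x
      - gaussSmoothGrad F ξ x‖ ^ 2 ≤ C / ((t : ℝ) + 1))
    (xinit : Euc n) {U : ℕ → ℕ → Ω → Euc n} (hU : ∀ t i, Measurable (U t i))
    (hlaw : ∀ t i, P.map (U t i) = stdGaussian (Euc n))
    (hind : iIndepFun (fun q : ℕ × ℕ => U q.1 q.2) P) (t : ℕ) :
    let x := fun ω => iterate X f fbar ξ β yhat K sampleSeq xinit (fun t i => U t i ω) t
    let e := fun ω => gradEstimator X f fbar ξ (yhat (K t)) (sampleSeq t) (fun i => U t i ω) (x ω)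
    Integrable (fun ω => ‖e ω - gaussSmoothGrad F ξ (x ω)‖ ^ 2) P ∧
      ∫ ω, ‖e ω - gaussSmoothGrad F ξ (x ω)‖ ^ 2 ∂P
        ≤ 2 * (noiseBound n fbar ξ + C) / ((t : ℝ) + 1) := by
  intro x e
  have hx : Measurable x := measurable_iterate hF hproj xinit t fun s _ => hU s
  have he : Measurable e := measurable_gradEstimator (hF t) ξ _ (hU t) hx
  set Ft := sampleValue X f fbar (yhat (K t))
  have hN : 0 < sampleSeq t := Nat.succ_pos t
  obtain ⟨hvi, hvle⟩ := integral_norm_sq_average_noise_le (P := P) (x := x) (V := U t)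
    (measurable_sampleNoise (hF t) ξ) (norm_sq_sampleNoise_le (hb t) hξ)
    (integrable_sampleNoise (hF t) (hb t)) (integral_sampleNoise (hF t) (hb t)) hx (hU t) (hlaw t)
    (fun i j hij => indepFun_iterate_sample hF hproj xinit hU hind t hij) hN
  simp only [← gradEstimator_sub_eq hN] at hvi hvle
  change Integrable (fun ω => ‖e ω - gaussSmoothGrad Ft ξ (x ω)‖ ^ 2) P at hvi
  change ∫ ω, ‖e ω - gaussSmoothGrad Ft ξ (x ω)‖ ^ 2 ∂P ≤ noiseBound n fbar ξ / sampleSeq t at hvle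
  have hcast : ((sampleSeq t : ℕ) : ℝ) = (t : ℝ) + 1 := by simp [sampleSeq]
  rw [hcast] at hvle
  have hpt : ∀ ω, ‖e ω - gaussSmoothGrad F ξ (x ω)‖ ^ 2
      ≤ 2 * ‖e ω - gaussSmoothGrad Ft ξ (x ω)‖ ^ 2 + 2 * (C / ((t : ℝ) + 1)) := by
    intro ω
    have h1 : e ω - gaussSmoothGrad F ξ (x ω) = (e ω - gaussSmoothGrad Ft ξ (x ω))
        + (gaussSmoothGrad Ft ξ (x ω) - gaussSmoothGrad F ξ (x ω)) := by abel
    have h2 := pow_le_pow_left₀ (norm_nonneg _) (norm_add_le (e ω - gaussSmoothGrad Ft ξ (x ω))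
      (gaussSmoothGrad Ft ξ (x ω) - gaussSmoothGrad F ξ (x ω))) 2
    have h3 := hbias t (x ω)
    rw [h1]
    refine h2.trans (add_sq_le.trans ?_)
    linarith
  have hdom : Integrable (fun ω => 2 * ‖e ω - gaussSmoothGrad Ft ξ (x ω)‖ ^ 2
      + 2 * (C / ((t : ℝ) + 1))) P := (hvi.const_mul 2).add (integrable_const _)
  refine ⟨hdom.mono' ?_ (Eventually.of_forall fun ω => ?_), ?_⟩
  · exact ((he.sub ((measurable_gaussSmoothGrad hFm ξ).comp hx)).norm.pow_const 2).aestronglyMeasurable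
  · rw [Real.norm_of_nonneg (sq_nonneg _)]
    exact hpt ω
  · refine (integral_mono_of_nonneg (Eventually.of_forall fun ω => sq_nonneg _) hdom
      (Eventually.of_forall hpt)).trans ?_
    rw [integral_add (hvi.const_mul 2) (integrable_const _), integral_const_mul, integral_const,
      probReal_univ, one_smul]
    refine (add_le_add_left (mul_le_mul_of_nonneg_left hvle zero_le_two) _).trans (le_of_eq ?_)
    ring

/-- The starting point may lie outside `X`; from `t = 1` on, both consecutive iterates are
projections and differ by at most the diameter. -/
lemma norm_sq_projGradMap_le (hne : X.Nonempty) (hX : IsCompact X) (hβ : 0 < β) {N : ℕ → ℕ}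
    (xinit : Euc n) (u : ℕ → ℕ → Euc n) {t : ℕ} (ht : 1 ≤ t) :
    ‖projGradMap X f fbar ξ β yhat K N xinit u t‖ ^ 2 ≤ (1 / β * Metric.diam X) ^ 2 := by
  obtain ⟨s, rfl⟩ : ∃ s, t = s + 1 := ⟨t - 1, by omega⟩
  rw [projGradMap_eq, norm_smul, Real.norm_of_nonneg (by positivity), ← dist_eq_norm]
  gcongr
  exact Metric.dist_le_diam_of_mem hX.isBounded (iterate_succ_mem hne hX.isClosed _ _ _)
    (iterate_succ_mem hne hX.isClosed _ _ _)

lemma integrable_norm_sq_projGradMap (hne : X.Nonempty) (hX : IsCompact X) (hβ : 0 < β)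
    (hF : ∀ t, Measurable (sampleValue X f fbar (yhat (K t)))) (hproj : Measurable (proj X))
    {N : ℕ → ℕ} (xinit : Euc n) {U : ℕ → ℕ → Ω → Euc n} (hU : ∀ t i, Measurable (U t i)) {t : ℕ}
    (ht : 1 ≤ t) :
    Integrable (fun ω => ‖projGradMap X f fbar ξ β yhat K N xinit
      (fun t i => U t i ω) t‖ ^ 2) P := by
  refine Integrable.of_bound
    ((measurable_projGradMap hF hproj xinit hU t).norm.pow_const 2).aestronglyMeasurable
    ((1 / β * Metric.diam X) ^ 2) (Eventually.of_forall fun ω => ?_)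
  rw [Real.norm_of_nonneg (sq_nonneg _)]
  exact norm_sq_projGradMap_le hne hX hβ xinit _ ht

/-- The one-step inequality is summed pathwise. The smoothed objective, bounded by `fbar`,
telescopes to at most `2 fbar`; the errors of order `1/(t + 1)` sum to a logarithm. -/
lemma sum_integral_norm_sq_projGradMap_le (hne : X.Nonempty) (hX : IsCompact X)
    (hcvx : Convex ℝ X) (hβ : 0 < β) (hξ : 0 < ξ) (hβL : β * smoothLip fbar ξ < 1)
    (hF : ∀ t, Measurable (sampleValue X f fbar (yhat (K t))))
    (hb : ∀ t x, |sampleValue X f fbar (yhat (K t)) x| ≤ fbar)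
    {F : Euc n → ℝ} (hFm : Measurable F) (hFb : ∀ x, |F x| ≤ fbar) {C : ℝ} (hC : 0 ≤ C)
    (hbias : ∀ t x, ‖gaussSmoothGrad (sampleValue X f fbar (yhat (K t))) ξ x
      - gaussSmoothGrad F ξ x‖ ^ 2 ≤ C / ((t : ℝ) + 1))
    (xinit : Euc n) {U : ℕ → ℕ → Ω → Euc n} (hU : ∀ t i, Measurable (U t i))
    (hlaw : ∀ t i, P.map (U t i) = stdGaussian (Euc n))
    (hind : iIndepFun (fun q : ℕ × ℕ => U q.1 q.2) P) {T : ℕ} (hT : 1 ≤ T) :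
    β * (1 - β * smoothLip fbar ξ) / 2 * ∑ t ∈ Finset.Icc 1 T,
        ∫ ω, ‖projGradMap X f fbar ξ β yhat K sampleSeq xinit (fun t i => U t i ω) t‖ ^ 2 ∂P
      ≤ (2 * fbar + β / (2 * (1 - β * smoothLip fbar ξ)) * (2 * (noiseBound n fbar ξ + C)))
        * (1 + Real.log T) := by
  have hproj := (continuous_proj hne hX.isClosed hcvx).measurable
  set c := 1 - β * smoothLip fbar ξ with hc
  have hc0 : 0 < c := by rw [hc]; linarith
  set Φ := gaussSmooth F ξ
  set x : ℕ → Ω → Euc n := fun t ω =>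
    iterate X f fbar ξ β yhat K sampleSeq xinit (fun t i => U t i ω) t with hx
  set p : ℕ → Ω → Euc n := fun t ω =>
    projGradMap X f fbar ξ β yhat K sampleSeq xinit (fun t i => U t i ω) t with hp
  set e : ℕ → Ω → ℝ := fun t ω => ‖gradEstimator X f fbar ξ (yhat (K t)) (sampleSeq t)
    (fun i => U t i ω) (x t ω) - gaussSmoothGrad F ξ (x t ω)‖ ^ 2 with he
  have herr : ∀ t, Integrable (e t) P ∧ ∫ ω, e t ω ∂P
      ≤ 2 * (noiseBound n fbar ξ + C) / ((t : ℝ) + 1) := fun t =>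
    integral_norm_sq_estimator_error_le hF hb hproj hξ hFm hbias xinit hU hlaw hind t
  have hpi : ∀ t ∈ Finset.Icc 1 T, Integrable (fun ω => ‖p t ω‖ ^ 2) P := fun t ht =>
    integrable_norm_sq_projGradMap hne hX hβ hF hproj xinit hU (Finset.mem_Icc.1 ht).1
  have hstep : ∀ ω, ∀ t ∈ Finset.Icc 1 T, β * c / 2 * ‖p t ω‖ ^ 2
      ≤ (Φ (x t ω) - Φ (x (t + 1) ω)) + β / (2 * c) * e t ω := by
    intro ω t ht
    obtain ⟨s, rfl⟩ : ∃ s, t = s + 1 := ⟨t - 1, by have := (Finset.mem_Icc.1 ht).1; omega⟩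
    exact projected_step_le hne hX.isClosed hcvx (gaussSmooth_add_le hFm hFb hξ) hβ hβL
      (iterate_succ_mem hne hX.isClosed _ _ _) _
  have hsum : ∀ ω, β * c / 2 * ∑ t ∈ Finset.Icc 1 T, ‖p t ω‖ ^ 2
      ≤ 2 * fbar + β / (2 * c) * ∑ t ∈ Finset.Icc 1 T, e t ω := by
    intro ω
    have h1 := Finset.sum_le_sum (hstep ω)
    rw [← Finset.mul_sum, Finset.sum_add_distrib, ← Finset.mul_sum,
      sum_Icc_sub_succ fun t => Φ (x t ω)] at h1
    have h2 := abs_le.1 (abs_gaussSmooth_le hFb ξ (x 1 ω))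
    have h3 := abs_le.1 (abs_gaussSmooth_le hFb ξ (x (T + 1) ω))
    have h4 : Φ (x 1 ω) - Φ (x (T + 1) ω) ≤ 2 * fbar := by linarith [h2.2, h3.1]
    linarith
  have hint1 : Integrable (fun ω => ∑ t ∈ Finset.Icc 1 T, ‖p t ω‖ ^ 2) P := integrable_finsetSum _ hpi
  have hint2 : Integrable (fun ω => ∑ t ∈ Finset.Icc 1 T, e t ω) P :=
    integrable_finsetSum _ fun t _ => (herr t).1
  have hE := integral_mono (hint1.const_mul (β * c / 2))
    ((integrable_const (2 * fbar)).add (hint2.const_mul (β / (2 * c)))) hsum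
  simp only [Pi.add_apply] at hE
  rw [integral_const_mul, integral_finsetSum _ hpi, integral_add (integrable_const _)
    (hint2.const_mul _), integral_const, probReal_univ, one_smul, integral_const_mul,
    integral_finsetSum _ fun t _ => (herr t).1] at hE
  refine hE.trans ?_
  have hlog : 0 ≤ Real.log T := Real.log_nonneg (by exact_mod_cast hT)
  have hD : 0 ≤ 2 * (noiseBound n fbar ξ + C) := by
    have := noiseBound_nonneg n fbar ξ
    linarith
  have hfb : 0 ≤ fbar := (abs_nonneg _).trans (hFb 0)
  have h5 : ∑ t ∈ Finset.Icc 1 T, ∫ ω, e t ω ∂P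
      ≤ 2 * (noiseBound n fbar ξ + C) * (1 + Real.log T) := by
    refine (Finset.sum_le_sum fun t _ => (herr t).2).trans ?_
    simp_rw [div_eq_mul_one_div (2 * (noiseBound n fbar ξ + C))]
    rw [← Finset.mul_sum]
    exact mul_le_mul_of_nonneg_left sum_Icc_one_div_succ_le hD
  have h6 : 0 ≤ β / (2 * c) := by positivity
  have h7 := mul_le_mul_of_nonneg_left h5 h6
  have h8 : 0 ≤ 2 * fbar * Real.log T := by positivity
  linarith

end ExpectedError

/-! ### The randomly chosen output index. -/

section RandomIndex

variable {Ω : Type*} [MeasurableSpace Ω] {P : Measure Ω}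

lemma indexPmf_eq {β L : ℝ} (hβ : 0 < β) (hβL : β * L < 1) {T t : ℕ} (ht : t ∈ Finset.Icc 1 T) :
    indexPmf β L T t = 1 / T := by
  have h : 0 < β - L * β ^ 2 := by nlinarith
  rw [indexPmf, if_pos ht, Finset.sum_const, Nat.card_Icc, nsmul_eq_mul, add_tsub_cancel_right]
  have hT : (T : ℝ) ≠ 0 := by
    have := Finset.mem_Icc.1 ht
    exact_mod_cast (by omega : T ≠ 0)
  generalize β - L * β ^ 2 = w at h
  field_simp

lemma integral_random_index {q : ℕ → Ω → ℝ} {R : Ω → ℕ} (hR : Measurable R) {β L : ℝ} (hβ : 0 < β)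
    (hβL : β * L < 1) {T : ℕ}
    (hRlaw : ∀ t, P (R ⁻¹' {t}) = ENNReal.ofReal (indexPmf β L T t))
    (hqm : ∀ t, Measurable (q t)) (hqi : ∀ t ∈ Finset.Icc 1 T, Integrable (q t) P)
    (hind : ∀ t, IndepFun R (q t) P) :
    Integrable (fun ω => q (R ω) ω) P ∧
      ∫ ω, q (R ω) ω ∂P = 1 / T * ∑ t ∈ Finset.Icc 1 T, ∫ ω, q t ω ∂P := by
  have hRae : ∀ᵐ ω ∂P, R ω ∈ Finset.Icc 1 T := by
    have h1 : ∀ t, ∀ᵐ ω ∂P, t ∉ Finset.Icc 1 T → R ω ≠ t := by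
      intro t
      by_cases ht : t ∈ Finset.Icc 1 T
      · exact Eventually.of_forall fun ω h => absurd ht h
      · have h2 : P (R ⁻¹' {t}) = 0 := by rw [hRlaw, indexPmf, if_neg ht, ENNReal.ofReal_zero]
        filter_upwards [measure_eq_zero_iff_ae_notMem.1 h2] with ω hω _ h
        exact hω h
    filter_upwards [ae_all_iff.2 h1] with ω hω
    by_contra h
    exact hω _ h rfl
  have hS : ∀ t, MeasurableSet (R ⁻¹' {t}) := fun t => hR (measurableSet_singleton t)
  have hae : (fun ω => q (R ω) ω) =ᵐ[P]
      fun ω => ∑ t ∈ Finset.Icc 1 T, (R ⁻¹' {t}).indicator (q t) ω := by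
    filter_upwards [hRae] with ω hω
    rw [Finset.sum_eq_single_of_mem _ hω]
    · rw [Set.indicator_of_mem (show ω ∈ R ⁻¹' {R ω} from rfl)]
    · intro t _ ht
      exact Set.indicator_of_notMem (fun h => ht (by simpa using Eq.symm h)) _
  have hii : ∀ t ∈ Finset.Icc 1 T, Integrable ((R ⁻¹' {t}).indicator (q t)) P := fun t ht =>
    (hqi t ht).indicator (hS t)
  refine ⟨(integrable_congr hae).2 (integrable_finsetSum _ hii), ?_⟩
  rw [integral_congr_ae hae, integral_finsetSum _ hii, Finset.mul_sum]
  refine Finset.sum_congr rfl fun t ht => ?_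
  have h1 : (fun ω => (R ⁻¹' {t}).indicator (q t) ω)
      = fun ω => ((Set.indicator {t} (fun _ => (1 : ℝ))) ∘ R) ω * q t ω := by
    funext ω
    by_cases h : R ω = t
    · simp [h]
    · simp [h]
  have h2 : IndepFun ((Set.indicator {t} (fun _ => (1 : ℝ))) ∘ R) (q t) P :=
    (hind t).comp (φ := Set.indicator {t} (fun _ => (1 : ℝ))) (ψ := id) (measurable_of_countable _)
      measurable_id
  rw [h1, h2.integral_fun_mul_eq_mul_integral
    ((measurable_of_countable _).comp hR).aestronglyMeasurable (hqm t).aestronglyMeasurable]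
  congr 1
  have h3 : ((Set.indicator {t} (fun _ => (1 : ℝ))) ∘ R) = (R ⁻¹' {t}).indicator fun _ => 1 := rfl
  rw [h3, integral_indicator_const _ (hS t), smul_eq_mul, mul_one, measureReal_def, hRlaw,
    indexPmf_eq hβ hβL ht, ENNReal.toReal_ofReal (by positivity)]

end RandomIndex

/-! ### Expected squared gradient mapping at the random index. -/

section MainBound

variable {n m : ℕ} {X : Set (Euc n)} {f : Euc n → Euc m → ℝ} {fbar ξ β : ℝ}
  {yhat : ℕ → Euc n → Euc m} {K : ℕ → ℕ}

lemma integral_norm_sq_projGradMap_random_le (hne : X.Nonempty) (hX : IsCompact X)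
    (hcvx : Convex ℝ X) (hβ : 0 < β) (hξ : 0 < ξ) (hβL : β * smoothLip fbar ξ < 1)
    (hF : ∀ t, Measurable (sampleValue X f fbar (yhat (K t))))
    (hb : ∀ t x, |sampleValue X f fbar (yhat (K t)) x| ≤ fbar)
    {F : Euc n → ℝ} (hFm : Measurable F) (hFb : ∀ x, |F x| ≤ fbar) {C : ℝ} (hC : 0 ≤ C)
    (hbias : ∀ t x, ‖gaussSmoothGrad (sampleValue X f fbar (yhat (K t))) ξ x
      - gaussSmoothGrad F ξ x‖ ^ 2 ≤ C / ((t : ℝ) + 1)) :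
    ∃ C', 0 < C' ∧ ∀ T : ℕ, 1 ≤ T →
      ∀ (Ω : Type*) [MeasurableSpace Ω] (P : Measure Ω) [IsProbabilityMeasure P]
        (xinit : Euc n) (U : ℕ → ℕ → Ω → Euc n) (R : Ω → ℕ),
        (∀ t i, Measurable (U t i)) →
        (∀ t i, P.map (U t i) = stdGaussian (Euc n)) →
        iIndepFun (fun (q : ℕ × ℕ) => U q.1 q.2) P →
        Measurable R →
        (∀ t, P (R ⁻¹' {t}) = ENNReal.ofReal (indexPmf β (smoothLip fbar ξ) T t)) →
        IndepFun R (fun ω (q : ℕ × ℕ) => U q.1 q.2 ω) P →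
        Integrable (fun ω => ‖projGradMap X f fbar ξ β yhat K sampleSeq xinit
          (fun t i => U t i ω) (R ω)‖ ^ 2) P ∧
        ∫ ω, ‖projGradMap X f fbar ξ β yhat K sampleSeq xinit
          (fun t i => U t i ω) (R ω)‖ ^ 2 ∂P ≤ C' * (1 + Real.log T) / T := by
  have hproj := (continuous_proj hne hX.isClosed hcvx).measurable
  set c := 1 - β * smoothLip fbar ξ with hc
  have hc0 : 0 < c := by rw [hc]; linarith
  set D := 2 * fbar + β / (2 * c) * (2 * (noiseBound n fbar ξ + C)) with hD
  have hfb : 0 ≤ fbar := (abs_nonneg _).trans (hFb 0)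
  have hD0 : 0 ≤ D := by
    have := noiseBound_nonneg n fbar ξ
    positivity
  -- The summand `1` makes the constant positive even if `D = 0`.
  refine ⟨(D + 1) / (β * c / 2), by positivity, ?_⟩
  intro T hT Ω _ P _ xinit U R hU hlaw hind hR hRlaw hRind
  have hqm := fun t => (measurable_projGradMap (ξ := ξ) (β := β) (N := sampleSeq) hF hproj xinit hU
    t).norm.pow_const 2
  have hqind : ∀ t, IndepFun R (fun ω => ‖projGradMap X f fbar ξ β yhat K sampleSeq xinit
      (fun t i => U t i ω) t‖ ^ 2) P := by
    intro t
    -- The gradient mapping is viewed as a measurable function of the whole sample array, with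
    -- coordinate maps as samples, so that independence of `R` from the array passes to it.
    have h1 := (measurable_projGradMap (ξ := ξ) (β := β) (N := sampleSeq) hF hproj xinit
      (Ω := ℕ × ℕ → Euc n) (U := fun s i w => w (s, i)) (fun s i => measurable_pi_apply _)
      t).norm.pow_const 2
    exact hRind.comp measurable_id h1
  obtain ⟨hI, hE⟩ := integral_random_index hR hβ hβL hRlaw hqm
    (fun t ht => integrable_norm_sq_projGradMap hne hX hβ hF hproj xinit hU
      (Finset.mem_Icc.1 ht).1) hqind
  refine ⟨hI, ?_⟩
  rw [hE]
  have h1 := sum_integral_norm_sq_projGradMap_le hne hX hcvx hβ hξ hβL hF hb hFm hFb hC hbias xinit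
    hU hlaw hind hT
  have hlog : 0 ≤ Real.log T := Real.log_nonneg (by exact_mod_cast hT)
  set S := ∑ t ∈ Finset.Icc 1 T, ∫ ω, ‖projGradMap X f fbar ξ β yhat K sampleSeq xinit
    (fun t i => U t i ω) t‖ ^ 2 ∂P
  have h2 : S ≤ (D + 1) / (β * c / 2) * (1 + Real.log T) := by
    rw [div_mul_eq_mul_div, le_div_iff₀ (by positivity)]
    linarith
  have hT' : (0 : ℝ) < T := by exact_mod_cast hT
  rw [one_div_mul_eq_div]
  exact div_le_div_of_nonneg_right h2 hT'.le

end MainBound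

/-! ### Complexity -/

section Complexity

/-- A horizon after which `C (1 + log T) / T ≤ ε²`. -/
noncomputable def horizon (C ε : ℝ) : ℕ :=
  ⌈2 * C * (|Real.log (2 * C)| + 2 * |Real.log ε|) / ε ^ 2⌉₊ + 1

/-- The inequality `log y ≤ y - 1` at `y = ε² T / (2C)` bounds `C (1 + log T)` by `ε² T / 2` plus `C
(|log 2C| + 2 |log ε|)`; the horizon makes the second part at most `ε² T / 2` too, for every larger
`T` as well. -/
lemma horizon_spec {C ε : ℝ} (hC : 0 < C) (hε : 0 < ε) {T : ℕ} (hT : horizon C ε ≤ T) :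
    C * (1 + Real.log T) / T ≤ ε ^ 2 := by
  have h1 : 2 * C * (|Real.log (2 * C)| + 2 * |Real.log ε|) / ε ^ 2 ≤ T := by
    refine (Nat.le_ceil _).trans ?_
    exact_mod_cast (Nat.le_succ _).trans hT
  have hT0 : (0 : ℝ) < T := by
    have : 0 < T := lt_of_lt_of_le (Nat.succ_pos _) hT
    exact_mod_cast this
  rw [div_le_iff₀ (by positivity)] at h1
  have h2 : Real.log (ε ^ 2 * T / (2 * C)) = 2 * Real.log ε + Real.log T - Real.log (2 * C) := by
    rw [Real.log_div (by positivity) (by positivity), Real.log_mul (by positivity) (by positivity),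
      Real.log_pow]
    push_cast; ring
  have h3 := Real.log_le_sub_one_of_pos (show 0 < ε ^ 2 * T / (2 * C) by positivity)
  rw [h2] at h3
  have h4 : Real.log (2 * C) - 2 * Real.log ε ≤ |Real.log (2 * C)| + 2 * |Real.log ε| := by
    have := le_abs_self (Real.log (2 * C))
    have := neg_abs_le (Real.log ε)
    linarith
  rw [div_le_iff₀ hT0]
  have h5 : C * (1 + Real.log T) ≤ C * (ε ^ 2 * T / (2 * C)
      + (|Real.log (2 * C)| + 2 * |Real.log ε|)) := by
    refine mul_le_mul_of_nonneg_left ?_ hC.le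
    linarith
  have h6 : C * (ε ^ 2 * T / (2 * C)) = ε ^ 2 * T / 2 := by field_simp
  nlinarith

lemma horizon_le {C : ℝ} (hC : 0 < C) : ∃ H, 0 ≤ H ∧ ∀ᶠ ε in 𝓝[>] (0 : ℝ),
    (horizon C ε : ℝ) ≤ H * (|Real.log ε| / ε ^ 2) := by
  refine ⟨2 * C * (|Real.log (2 * C)| + 2) + 2, by positivity, ?_⟩
  filter_upwards [Ioo_mem_nhdsGT (Real.exp_pos (-1))] with ε hε
  have hε0 : 0 < ε := hε.1
  have hlog : Real.log ε < -1 := by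
    rw [← Real.log_exp (-1)]
    exact Real.log_lt_log hε0 hε.2
  have h1 : 1 ≤ |Real.log ε| := by
    rw [abs_of_neg (by linarith)]; linarith
  have hε1 : ε ≤ 1 := by
    refine hε.2.le.trans ?_
    rw [← Real.exp_zero]
    exact Real.exp_le_exp.2 (by norm_num)
  have h2 : 1 ≤ |Real.log ε| / ε ^ 2 := by
    rw [le_div_iff₀ (by positivity), one_mul]
    exact (pow_le_one₀ hε0.le hε1).trans h1
  have h3 : (horizon C ε : ℝ)
      ≤ 2 * C * (|Real.log (2 * C)| + 2 * |Real.log ε|) / ε ^ 2 + 2 := by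
    have := (Nat.ceil_lt_add_one (show 0 ≤ 2 * C * (|Real.log (2 * C)| + 2 * |Real.log ε|) / ε ^ 2
      by positivity)).le
    unfold horizon
    push_cast
    linarith
  have h4 : 2 * C * (|Real.log (2 * C)| + 2 * |Real.log ε|) / ε ^ 2
      ≤ 2 * C * (|Real.log (2 * C)| + 2) * (|Real.log ε| / ε ^ 2) := by
    rw [← mul_div_assoc]
    have : |Real.log (2 * C)| ≤ |Real.log (2 * C)| * |Real.log ε| :=
      le_mul_of_one_le_right (abs_nonneg _) h1
    gcongr ?_ / _
    nlinarith
  linarith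

lemma isSoftO_of_pow_le {C : ℝ} (hC : 0 < C) {Q : ℕ → ℝ} (hQ0 : ∀ T, 0 ≤ Q T) {a : ℝ} (ha : 0 ≤ a)
    {p : ℕ} (hQ : ∀ T : ℕ, 1 ≤ T → Q T ≤ a * (T : ℝ) ^ p) :
    IsSoftO (fun ε => Q (horizon C ε)) (fun ε => 1 / ε ^ (2 * p)) := by
  obtain ⟨H, hH, hHev⟩ := horizon_le hC
  refine ⟨p, Asymptotics.IsBigO.of_bound (a * H ^ p) ?_⟩
  filter_upwards [hHev] with ε hε
  rw [Real.norm_of_nonneg (hQ0 _)]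
  refine (hQ _ (Nat.succ_pos _)).trans ?_
  have h1 := pow_le_pow_left₀ (Nat.cast_nonneg _) hε p
  have h2 : 0 ≤ 1 / ε ^ (2 * p) * |Real.log ε| ^ p := by
    rw [pow_mul]; positivity
  rw [Real.norm_of_nonneg h2]
  refine (mul_le_mul_of_nonneg_left h1 ha).trans (le_of_eq ?_)
  rw [mul_pow, div_pow, pow_mul]
  ring

lemma valueCalls_sampleSeq_le (T : ℕ) (hT : 1 ≤ T) :
    (valueCalls sampleSeq T : ℝ) ≤ 2 * (T : ℝ) ^ 2 := by
  have h : valueCalls sampleSeq T ≤ 2 * T ^ 2 := by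
    unfold valueCalls sampleSeq
    refine (Finset.sum_le_card_nsmul _ _ (2 * T) fun t ht => ?_).trans ?_
    · have := (Finset.mem_Icc.1 ht).2
      omega
    · rw [Nat.card_Icc, smul_eq_mul]
      simp only [add_tsub_cancel_right]
      nlinarith
  exact_mod_cast h

lemma gradientCalls_sampleSeq_le {K : ℕ → ℕ} {a : ℝ} (ha : 0 ≤ a)
    (hK : ∀ t : ℕ, (K t : ℝ) ≤ a * ((t : ℝ) + 1) ^ 3) (T : ℕ) (hT : 1 ≤ T) :
    (gradientCalls K sampleSeq T : ℝ) ≤ 16 * a * (T : ℝ) ^ 5 := by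
  unfold gradientCalls sampleSeq
  push_cast
  refine (Finset.sum_le_card_nsmul _ _ (16 * a * (T : ℝ) ^ 4) fun t ht => ?_).trans (le_of_eq ?_)
  · have h1 : (t : ℝ) + 1 ≤ 2 * T := by
      have h2 := (Finset.mem_Icc.1 ht).2
      have h3 : t + 1 ≤ 2 * T := by omega
      exact_mod_cast h3
    calc (K t : ℝ) * ((t : ℝ) + 1) ≤ a * ((t : ℝ) + 1) ^ 3 * ((t : ℝ) + 1) := by
          gcongr
          exact hK t
      _ = a * ((t : ℝ) + 1) ^ 4 := by ring
      _ ≤ a * (2 * T) ^ 4 := by gcongr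
      _ = _ := by ring
  · rw [Nat.card_Icc, nsmul_eq_mul, add_tsub_cancel_right]
    ring

lemma innerSteps_le {B : ℕ → ℝ≥0∞} {C : ℝ} (hC : 0 ≤ C)
    (hB : ∀ t : ℕ, B t ≤ ENNReal.ofReal (C * ((t : ℝ) + 1) ^ 3)) {K : ℕ → ℕ} {A : ℝ≥0}
    (hK : ∀ t, (K t : ℝ≥0∞) ≤ A * (1 + B t)) (t : ℕ) :
    (K t : ℝ) ≤ A * (1 + C) * ((t : ℝ) + 1) ^ 3 := by
  have h1 : (K t : ℝ≥0∞) ≤ ENNReal.ofReal (A * (1 + C * ((t : ℝ) + 1) ^ 3)) := by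
    refine (hK t).trans ?_
    rw [ENNReal.ofReal_mul A.coe_nonneg, ENNReal.ofReal_coe_nnreal, ENNReal.ofReal_add zero_le_one
      (by positivity), ENNReal.ofReal_one]
    gcongr
    exact hB t
  rw [← ENNReal.ofReal_natCast, ENNReal.ofReal_le_ofReal_iff (by positivity)] at h1
  have h2 : (1 : ℝ) ≤ ((t : ℝ) + 1) ^ 3 := one_le_pow₀ (by linarith [Nat.cast_nonneg (α := ℝ) t])
  refine h1.trans ?_
  rw [mul_assoc]
  refine mul_le_mul_of_nonneg_left ?_ A.coe_nonneg
  linarith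

end Complexity

end SCiNBiO

/-! ### Assembly of the complexity theorem. -/

open SCiNBiO in
theorem mainTheorem7 {n m : ℕ} (X : Set (Euc n)) (f g : Euc n → Euc m → ℝ) (y0 : Euc m)
    (Y Y' : Set (Euc m)) (Lg M gLow g0 fbar Lf : ℝ)
    (hstd : StandingAssumptions X f g y0 Y Lg M gLow g0 fbar Lf)
    (hY' : IsCompact Y') (hYY' : Y ⊆ interior Y')
    -- the bifurcation set has upper Minkowski dimension `d < n`
    (d : ℝ) (hd : d = upperMinkowskiDim (bifurcationSet X g)) (hdn : d < n)
    -- the degenerate stationary points are bounded, of fold type, and not tangent to `∂X`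
    (hbdd : Bornology.IsBounded {y : Euc m | ∃ x ∈ X, IsDegenerateStationary g x y})
    (hfold : ∀ x ∈ X, ∀ y, IsDegenerateStationary g x y → IsFold g x y)
    (htan : ∀ x ∈ X, ∀ y, IsDegenerateStationary g x y → IsNontangential X g x y)
    -- the lower-level method: iterates, outputs after `K` steps, correspondence-driven solution
    (traj : Euc n → ℕ → Euc m) (htraj : ∀ x ∈ X, IsCubicNewtonRun g M x y0 (traj x))
    (yhat : ℕ → Euc n → Euc m)
    (hyhat : ∀ K, ∀ x ∈ X, IsCubicNewtonOutput g M x (traj x) K (yhat K x))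
    (hyhat_meas : ∀ K, Measurable (fun x : X => yhat K x))
    (ycd : Euc n → Euc m) (hycd : ∀ x ∈ X, IsCorrespondenceDriven f g x (traj x) (ycd x))
    (hdisc : volume {x ∈ X \ bifurcationSet X g | ¬ ContinuousWithinAt ycd X x} = 0)
    -- smoothing parameter and constant step size
    (ξ β : ℝ) (hξ : 0 < ξ) (hβ : 0 < β) (hβL : β * smoothLip fbar ξ < 1) :
    -- the requirement on the number of inner steps can be met
    (∀ t, innerStepBoundSeq X g Y Y' M gLow g0 d t < ⊤) ∧
    -- inner step numbers that meet the requirement and are of the required order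
    ∀ (K : ℕ → ℕ) (A : ℝ≥0),
      (∀ t, innerStepBoundSeq X g Y Y' M gLow g0 d t < K t) →
      (∀ t, (K t : ℝ≥0∞) ≤ A * (1 + innerStepBoundSeq X g Y Y' M gLow g0 d t)) →
      ∃ T : ℝ → ℕ,
        (∀ ε, 0 < ε → 1 ≤ T ε ∧ ∀ T' ≥ T ε,
          ∀ (Ω : Type*) [MeasurableSpace Ω] (P : Measure Ω) [IsProbabilityMeasure P]
            (xinit : Euc n) (U : ℕ → ℕ → Ω → Euc n) (R : Ω → ℕ),
            (∀ t i, Measurable (U t i)) →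
            (∀ t i, P.map (U t i) = stdGaussian (Euc n)) →
            iIndepFun (fun (q : ℕ × ℕ) => U q.1 q.2) P →
            Measurable R →
            (∀ t, P (R ⁻¹' {t}) = ENNReal.ofReal (indexPmf β (smoothLip fbar ξ) T' t)) →
            IndepFun R (fun ω (q : ℕ × ℕ) => U q.1 q.2 ω) P →
            Integrable (fun ω => ‖projGradMap X f fbar ξ β yhat K sampleSeq xinit
              (fun t i => U t i ω) (R ω)‖ ^ 2) P ∧
            ∫ ω, ‖projGradMap X f fbar ξ β yhat K sampleSeq xinit
              (fun t i => U t i ω) (R ω)‖ ^ 2 ∂P ≤ ε ^ 2) ∧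
        IsSoftO (fun ε => (valueCalls sampleSeq (T ε) : ℝ)) (fun ε => 1 / ε ^ 4) ∧
        IsSoftO (fun ε => (gradientCalls K sampleSeq (T ε) : ℝ)) (fun ε => 1 / ε ^ 10) ∧
        IsSoftO (fun ε => (hessianCalls K sampleSeq (T ε) : ℝ)) (fun ε => 1 / ε ^ 10) := by
  subst hd
  -- The gap `n - d ≥ 1` gives `δ_t ≥ (t + 1)⁻²`, from which the cubic bound on `B_t` follows.
  have hdim := (dimension_add_one_le hstd hbdd hfold hdn).1
  obtain ⟨CB, hCB, hB⟩ := exists_innerStepBoundSeq_le hstd hY' hYY' hfold htan hdim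
  refine ⟨fun t => (hB t).trans_lt ENNReal.ofReal_lt_top, fun K A hK hKA => ?_⟩
  obtain ⟨F, hFm, hFb, C, hC, hbias⟩ := exists_bias_le hstd hY' hYY' rfl hdn hbdd hfold htan htraj
    hyhat hyhat_meas hξ hK
  obtain ⟨C', hC', hmain⟩ := integral_norm_sq_projGradMap_random_le hstd.X_nonempty hstd.X_compact
    hstd.X_convex hβ hξ hβL (fun t => measurable_sampleValue hstd (hyhat_meas (K t)))
    (fun t => abs_sampleValue_le hstd fun x hx =>
      output_mem_sublevel hstd hx (htraj x hx) (hyhat _ x hx)) hFm hFb hC hbias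
  have ha : (0 : ℝ) ≤ A * (1 + CB) := by positivity
  have hgrad := isSoftO_of_pow_le (Q := fun T => (gradientCalls K sampleSeq T : ℝ)) (p := 5) hC'
    (fun T => Nat.cast_nonneg _) (a := 16 * (A * (1 + CB))) (by positivity)
    (gradientCalls_sampleSeq_le ha (innerSteps_le hCB hB hKA))
  refine ⟨horizon C', fun ε hε => ⟨Nat.succ_pos _, ?_⟩, ?_, hgrad, hgrad⟩
  · intro T' hT' Ω _ P _ xinit U R hU hlaw hind hR hRlaw hRind
    obtain ⟨h1, h2⟩ := hmain T' ((Nat.succ_pos _).trans_le hT') Ω P xinit U R hU hlaw hind hR hRlaw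
      hRind
    exact ⟨h1, h2.trans (horizon_spec hC' hε hT')⟩
  · exact isSoftO_of_pow_le (Q := fun T => (valueCalls sampleSeq T : ℝ)) (p := 2) hC'
      (fun T => Nat.cast_nonneg _) zero_le_two valueCalls_sampleSeq_le
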